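/- Let $(M,h)$ be a smooth four-dimensional manifold with a smooth metric of neutral signature $(+,+,-,-)$. Spinors are taken with respect to local spin frames, i.e. $T_pM\cong S_p\otimes S'_p$ with $h_{ab}=\epsilon_{AB}\epsilon_{A'B'}$; let $[\pi^{A'}]$ be a smooth real projective primed spinor field on $M$, with local scaled representatives (LSRs) $\pi^{A'}$, and let $Z_{[\pi]}=\{\eta^A\pi^{A'}\}\subset TM$ be its distribution of $\alpha$-planes. Suppose that $(M,h,[\pi^{A'}])$ is a real algebraically special $\alpha$-geometry, that is, for every LSR, $$\pi_{B'}\pi^{A'}\nabla_{AA'}\pi^{B'}=0 \quad\text{and}\quad \tilde\Psi_{A'B'C'D'}\pi^{A'}\pi^{B'}\pi^{C'}=0,$$ where $\nabla$ is the Levi-Civita spin connection and $\tilde\Psi_{A'B'C'D'}$ the primed (self-dual) Weyl curvature spinor of $h$. Call $[\pi^{A'}]$ a Ricci principal spinor (RPS) on an open set if $\Phi_{ABA'B'}\pi^{A'}\pi^{B'}=0$ there for every LSR, where $\Phi_{ABA'B'}$ is the Ricci spinor of $h$. Conformal Walker coordinates, with conformal factor $\Omega$, are a smooth chart $(u,v,x,y)$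 on an open set $U\subseteq M$ together with a smooth function $\Omega:U\to(0,\infty)$ such that $h=\Omega^2g$ on $U$, where $(U,g,[\pi^{A'}])$ is a Walker geometry ($\pi_{B'}\nabla^g_a\pi^{B'}=0$ for every LSR) with Walker coordinates $(u,v,x,y)$; the latter means that $Z_{[\pi]}$ is spanned by $\partial_u,\partial_v$ on $U$, that $x,y$ label distinct $\alpha$-surfaces in $U$ (each common level set of $x$ and $y$ in $U$ is connected), and that $$(g_{ij})=\begin{pmatrix}0&0&1&0\\0&0&0&1\\1&0&a&c\\0&1&c&b\end{pmatrix}$$ for some smooth functions $a,b,c$ of $(u,v,x,y)$. Then: 1. $[\pi^{A'}]$ is an RPS on $M$ if and only if, for every system of conformal Walker coordinates $(u,v,x,y)$ for $(M,h,[\pi^{A'}])$, with conformal factor $\Omega$, the function $\Omega^{-1}$ is affine as a function of $u$ and $v$ (on each common level set of $x$ and $y$). 2. For each single system of conformal Walker coordinates, on $U$ say, with conformal factor $\Omega$: $[\pi^{A'}]$ is an RPS on $U$ if and only if $\Omega^{-1}$ is affine as a function of $u$ and $v$; and the latter is equivalent to $$\Omega(u,v,x,y)=\bigl[M(x,y)\,u+N(x,y)\,v+K(x,y)\bigr]^{-1}\quad\text{on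 } U$$ for some smooth functions $M,N,K$ of $(x,y)$. -/

import Mathlib

open Set Matrix
open scoped Manifold ContDiff

noncomputable section

namespace AlphaGeometry

/-- Coordinate space `ℝ⁴`. -/
abbrev E4 : Type := EuclideanSpace ℝ (Fin 4)

/-! ## Local tensor calculus of a metric given by its component matrix on an open subset of `ℝ⁴` -/

/-- The `i`-th coordinate vector. -/
def basisVec (i : Fin 4) : E4 := EuclideanSpace.single i 1

/-- The partial derivative `∂ᵢ f`. -/
def pd (i : Fin 4) (f : E4 → ℝ) (x : E4) : ℝ := fderiv ℝ f x (basisVec i)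

/-- A field of `4 × 4` matrices (metric components) on coordinate space. -/
abbrev MetricField : Type := E4 → Matrix (Fin 4) (Fin 4) ℝ

/-- The scalar product `G(V, W)` at `x`. -/
def dotG (G : MetricField) (x : E4) (V W : E4) : ℝ := ∑ i, ∑ j, G x i j * V i * W j

/-- Christoffel symbols `Γᵏᵢⱼ` of the Levi-Civita connection of `G`. -/
def christoffel (G : MetricField) (k i j : Fin 4) (x : E4) : ℝ :=
  (1 / 2) * ∑ l, (G x)⁻¹ k l *
    (pd i (fun y => G y j l) x + pd j (fun y => G y i l) x - pd l (fun y => G y i j) x)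

/-- The curvature components `Rˡₖᵢⱼ`, where `R(∂ᵢ, ∂ⱼ) ∂ₖ = ∑ₗ Rˡₖᵢⱼ ∂ₗ`
and `R(X, Y) = [∇_X, ∇_Y] - ∇_[X, Y]`. -/
def riemann (G : MetricField) (l k i j : Fin 4) (x : E4) : ℝ :=
  pd i (christoffel G l j k) x - pd j (christoffel G l i k) x
    + ∑ m, (christoffel G l i m x * christoffel G m j k x
      - christoffel G l j m x * christoffel G m i k x)

/-- The covariant curvature components `R_{abcd} = ∑ₗ G_{al} Rˡ_{bcd}`. -/
def riemannLower (G : MetricField) (a b c d : Fin 4) (x : E4) : ℝ :=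
  ∑ l, G x a l * riemann G l b c d x

/-- The Ricci tensor `R_{bd} = ∑ₐ Rᵃ_{bad}`. -/
def ricci (G : MetricField) (b d : Fin 4) (x : E4) : ℝ := ∑ a, riemann G a b a d x

/-- The Ricci scalar curvature. -/
def scalarCurv (G : MetricField) (x : E4) : ℝ := ∑ b, ∑ d, (G x)⁻¹ b d * ricci G b d x

/-- The Weyl tensor `C_{abcd}` (in dimension four). -/
def weyl (G : MetricField) (a b c d : Fin 4) (x : E4) : ℝ :=
  riemannLower G a b c d x
    - (1 / 2) * (G x a c * ricci G b d x - G x a d * ricci G b c x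
      - G x b c * ricci G a d x + G x b d * ricci G a c x)
    + (scalarCurv G x / 6) * (G x a c * G x b d - G x a d * G x b c)

/-- The tensor `Φ_{ab} = (R_{ab} - (R/4) g_{ab}) / 2`, whose spinor form is the Ricci spinor. -/
def phiTensor (G : MetricField) (a b : Fin 4) (x : E4) : ℝ :=
  (1 / 2) * (ricci G a b x - (scalarCurv G x / 4) * G x a b)

/-- The `i`-th component of the covariant derivative `∇ₖ V` of the vector field `V`. -/
def covVec (G : MetricField) (k : Fin 4) (V : E4 → E4) (x : E4) : E4 :=
  WithLp.toLp 2 fun i => pd k (fun y => V y i) x + ∑ j, christoffel G i k j x * V x j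

/-! ## Two-component spinors in a spin frame

A pair of spin frames `{o^A, ι^A}`, `{o^{A'}, ι^{A'}}` is recorded through the null tetrad
`e A A'` that it defines: `e 0 0 = o^A o^{A'}`, `e 0 1 = o^A ι^{A'}`, and so on. A spinor (field)
is then given by its components with respect to these frames. -/

/-- The spinor symbol: `ε 0 1 = 1 = - ε 1 0`. The same array gives `ε_{AB}` and `ε^{AB}`. -/
def eps : Matrix (Fin 2) (Fin 2) ℝ := !![0, 1; -1, 0]

/-- A field of tetrads `e_{AA'}` on coordinate space. -/
abbrev Tetrad : Type := Fin 2 → Fin 2 → E4 → E4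

/-- The components on coordinate space of a primed spinor field `π^{A'}`. -/
abbrev PrimedSpinor : Type := Fin 2 → E4 → ℝ

/-- `e` is the smooth tetrad of spin frames for the metric `G` over `W`:
`g_{ab} = ε_{AB} ε_{A'B'}`. -/
structure IsSpinFrame (G : MetricField) (W : Set E4) (e : Tetrad) : Prop where
  smooth : ∀ A A', ContDiffOn ℝ ∞ (e A A') W
  metric : ∀ x ∈ W, ∀ A A' B B', dotG G x (e A A' x) (e B B' x) = eps A B * eps A' B'

/-- The spinor components `V^{BB'}` of the vector `V` with respect to `e`:
`V^{BB'} = ε^{BC} ε^{B'C'} V_{CC'}`. -/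
def spinComp (G : MetricField) (e : Tetrad) (x : E4) (V : E4) (B B' : Fin 2) : ℝ :=
  ∑ C, ∑ C', eps B C * eps B' C' * dotG G x V (e C C' x)

/-- Connection coefficients of the Levi-Civita spin connection on primed spinors:
`∇ₖ o_{A'} = ∑_{B'} γ̃_{k A'}^{B'} o_{B'}` for the primed spin frame `o_{A'}`.

The connections on the two spin bundles satisfy
`∇ₖ e_{AA'} = ∑_B γ_{k A}^B e_{BA'} + ∑_{B'} γ̃_{k A'}^{B'} e_{AB'}`, and `γ_k`, `γ̃_k` are
trace free because `ε_{AB}` and `ε_{A'B'}` are parallel; contracting unprimed indices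
gives the formula. -/
def primedConn (G : MetricField) (e : Tetrad) (k : Fin 4) (A' B' : Fin 2) (x : E4) : ℝ :=
  (1 / 2) * ∑ A, spinComp G e x (covVec G k (e A A') x) A B'

/-- The components `∇ₖ π^{B'}` of the covariant derivative of a primed spinor field. -/
def covSpinor (G : MetricField) (e : Tetrad) (p : PrimedSpinor) (k : Fin 4) (B' : Fin 2)
    (x : E4) : ℝ :=
  pd k (p B') x + ∑ A', p A' x * primedConn G e k A' B' x

/-- The one-form `S_a = π_{B'} ∇_a π^{B'}`, with `π_{B'} = π^{A'} ε_{A'B'}`. -/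
def sForm (G : MetricField) (e : Tetrad) (p : PrimedSpinor) (k : Fin 4) (x : E4) : ℝ :=
  ∑ B', (∑ A', p A' x * eps A' B') * covSpinor G e p k B' x

/-- The spinor `π_{B'} π^{A'} ∇_{AA'} π^{B'} = π^{A'} S_{AA'}`; its vanishing expresses that the
`α`-distribution of `[π^{A'}]` is integrable. -/
def integrabilitySpinor (G : MetricField) (e : Tetrad) (p : PrimedSpinor) (A : Fin 2)
    (x : E4) : ℝ :=
  ∑ A', p A' x * ∑ k, e A A' x k * sForm G e p k x

/-- The Ricci spinor `Φ_{ABA'B'}`. -/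
def ricciSpinor (G : MetricField) (e : Tetrad) (A B A' B' : Fin 2) (x : E4) : ℝ :=
  ∑ i, ∑ j, phiTensor G i j x * e A A' x i * e B B' x j

/-- The self-dual Weyl curvature spinor
`Ψ̃_{A'B'C'D'} = (1/4) ε^{AB} ε^{CD} C_{AA'BB'CC'DD'}`, from
`C_{abcd} = Ψ_{ABCD} ε_{A'B'} ε_{C'D'} + Ψ̃_{A'B'C'D'} ε_{AB} ε_{CD}`. -/
def weylSpinor (G : MetricField) (e : Tetrad) (A' B' C' D' : Fin 2) (x : E4) : ℝ :=
  (1 / 4) * ∑ A, ∑ B, ∑ C, ∑ D, eps A B * eps C D *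
    ∑ a, ∑ b, ∑ c, ∑ d, weyl G a b c d x *
      e A A' x a * e B B' x b * e C C' x c * e D D' x d

/-- The `α`-plane `{η^A π^{A'}}` at `x` of the spinor `π^{A'}`. -/
def alphaPlane (e : Tetrad) (p : PrimedSpinor) (x : E4) : Submodule ℝ E4 :=
  Submodule.span ℝ (range fun A : Fin 2 => ∑ A', p A' x • e A A' x)

/-- `p` is a smooth, nowhere vanishing primed spinor field over `W` whose `α`-planes are the
planes `Z x`. -/
structure IsScaledRep (e : Tetrad) (p : PrimedSpinor) (Z : E4 → Submodule ℝ E4)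
    (W : Set E4) : Prop where
  smooth : ∀ A', ContDiffOn ℝ ∞ (p A') W
  ne_zero : ∀ x ∈ W, ∃ A', p A' x ≠ 0
  plane : ∀ x ∈ W, Z x = alphaPlane e p x

/-! ## Neutral geometries with a real projective primed spinor field -/

section Manifold

variable (M : Type*) [TopologicalSpace M] [ChartedSpace (EuclideanSpace ℝ (Fin 4)) M]
  [IsManifold (𝓡 4) ∞ M]

/-- A smooth metric of neutral signature `(+, +, -, -)` on a four-dimensional manifold. -/
structure NeutralMetric where
  inner (p : M) : TangentSpace (𝓡 4) p →L[ℝ] TangentSpace (𝓡 4) p →L[ℝ] ℝ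
  symm (p : M) (v w : TangentSpace (𝓡 4) p) : inner p v w = inner p w v
  neutral (p : M) : ∃ b : Module.Basis (Fin 4) ℝ (TangentSpace (𝓡 4) p), ∀ i j,
    inner p (b i) (b j) = Matrix.diagonal ![(1 : ℝ), 1, -1, -1] i j
  contMDiff : ContMDiff (𝓡 4) ((𝓡 4).prod 𝓘(ℝ, E4 →L[ℝ] E4 →L[ℝ] ℝ)) ∞
    (fun p => Bundle.TotalSpace.mk' (E4 →L[ℝ] E4 →L[ℝ] ℝ)
      (E := fun p : M => TangentSpace (𝓡 4) p →L[ℝ] TangentSpace (𝓡 4) p →L[ℝ] ℝ) p (inner p))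

variable {M}

/-- The components of the metric in the chart `φ`. -/
def NeutralMetric.inChart (h : NeutralMetric M) (φ : OpenPartialHomeomorph M E4) :
    MetricField := fun x => Matrix.of fun i j =>
  h.inner (φ.symm x) (mfderiv (𝓡 4) (𝓡 4) φ.symm x (basisVec i))
    (mfderiv (𝓡 4) (𝓡 4) φ.symm x (basisVec j))

/-- The expression in the chart `φ` of a field of subspaces of the tangent spaces. -/
def planeInChart (Z : ∀ p : M, Submodule ℝ (TangentSpace (𝓡 4) p))
    (φ : OpenPartialHomeomorph M E4) : E4 → Submodule ℝ E4 := fun x =>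
  (Z (φ.symm x)).comap (mfderiv (𝓡 4) (𝓡 4) φ.symm x).toLinearMap

/-- A local scaled representative (LSR): a chart of the smooth structure, with spin frames over
its domain for which the planes `Z` are the `α`-planes of the smooth, nowhere vanishing primed
spinor field `π^{A'}`. -/
structure LSR (h : NeutralMetric M) (Z : ∀ p : M, Submodule ℝ (TangentSpace (𝓡 4) p)) where
  chart : OpenPartialHomeomorph M E4
  mem_atlas : chart ∈ IsManifold.maximalAtlas (𝓡 4) ∞ M
  frame : Tetrad
  isSpinFrame : IsSpinFrame (h.inChart chart) chart.target frame
  spinor : PrimedSpinor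
  isScaledRep : IsScaledRep frame spinor (planeInChart Z chart) chart.target

/-- A real projective primed spinor field `[π^{A'}]`. The projective spinor at `p` is recorded
through the `α`-plane `Z_[π] = {η^A π^{A'}}` in `T_p M` that it defines (and that determines it);
the field is required to have a local scaled representative, a smooth spinor field with
respect to smooth spin frames, around each point. The manifold has the orientation for which the
planes of the distribution are `α`-planes. -/
structure ProjectiveSpinorField (h : NeutralMetric M) where
  plane (p : M) : Submodule ℝ (TangentSpace (𝓡 4) p)
  exists_lsr (p : M) : ∃ c : LSR h plane, p ∈ c.chart.source

namespace ProjectiveSpinorField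

variable {h : NeutralMetric M} (π : ProjectiveSpinorField h)

/-- `(M, h, [π^{A'}])` is a (real) `α`-geometry: `π_{B'} π^{A'} ∇_{AA'} π^{B'} = 0`
for every LSR. -/
def IsAlphaGeometry : Prop :=
  ∀ c : LSR h π.plane, ∀ x ∈ c.chart.target, ∀ A,
    integrabilitySpinor (h.inChart c.chart) c.frame c.spinor A x = 0

/-- `[π^{A'}]` is a multiple Weyl principal spinor: `Ψ̃_{A'B'C'D'} π^{A'} π^{B'} π^{C'} = 0`. -/
def IsMultipleWPS : Prop :=
  ∀ c : LSR h π.plane, ∀ x ∈ c.chart.target, ∀ D',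
    ∑ A', ∑ B', ∑ C', weylSpinor (h.inChart c.chart) c.frame A' B' C' D' x *
      c.spinor A' x * c.spinor B' x * c.spinor C' x = 0

/-- `(M, h, [π^{A'}])` is an algebraically special (AS) real `α`-geometry. -/
structure IsASAlphaGeometry : Prop where
  isAlphaGeometry : π.IsAlphaGeometry
  isMultipleWPS : π.IsMultipleWPS

/-- `[π^{A'}]` is a Ricci principal spinor on `U`: `Φ_{ABA'B'} π^{A'} π^{B'} = 0` at the points
of `U` for every LSR. -/
def IsRPSOn (U : Set M) : Prop :=
  ∀ c : LSR h π.plane, ∀ x ∈ c.chart.target, c.chart.symm x ∈ U → ∀ A B,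
    ∑ A', ∑ B', ricciSpinor (h.inChart c.chart) c.frame A B A' B' x *
      c.spinor A' x * c.spinor B' x = 0

/-- `[π^{A'}]` is a Ricci principal spinor (RPS). -/
def IsRPS : Prop := π.IsRPSOn univ

end ProjectiveSpinorField

/-- Walker's form `[[0, 1], [1, W]]` of the metric, `W = [[a, c], [c, b]]`. -/
def walkerMatrix (a b c : E4 → ℝ) : MetricField := fun x =>
  !![0, 0, 1, 0;
     0, 0, 0, 1;
     1, 0, a x, c x;
     0, 1, c x, b x]

/-- The metric `G` over `U ⊆ ℝ⁴` with the projective spinor field of `α`-planes `Z` is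
a Walker geometry: `S_a = π_{B'} ∇_a π^{B'} = 0` for every local scaled representative. -/
def IsWalkerOn (G : MetricField) (Z : E4 → Submodule ℝ E4) (U : Set E4) : Prop :=
  ∀ (W : Set E4) (e : Tetrad) (p : PrimedSpinor), IsOpen W → W ⊆ U →
    IsSpinFrame G W e → IsScaledRep e p Z W → ∀ x ∈ W, ∀ k, sForm G e p k x = 0

/-- `φ = (u, v, x, y)` (coordinates number `0, 1, 2, 3`) is a system of conformal Walker
coordinates for `(M, h, [π^{A'}])` on `U = φ.source`, with conformal factor `Ω`: one has
`h = Ω² g` on `U`, and `φ` is a system of Walker coordinates for the Walker geometry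
`(U, g, [π^{A'}])`, that is to say Frobenius coordinates of the `α`-distribution
(`∂_u` and `∂_v` span it, and `x`, `y` label distinct `α`-surfaces in `U`: each common level set
of `x` and `y` is connected) in which `g` has Walker's form. -/
structure IsConformalWalkerChart (h : NeutralMetric M) (π : ProjectiveSpinorField h)
    (φ : OpenPartialHomeomorph M E4) (Ω : M → ℝ) : Prop where
  mem_atlas : φ ∈ IsManifold.maximalAtlas (𝓡 4) ∞ M
  factor_smooth : ContMDiffOn (𝓡 4) 𝓘(ℝ, ℝ) ∞ Ω φ.source
  factor_pos : ∀ p ∈ φ.source, 0 < Ω p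
  plane_eq : ∀ q ∈ φ.target,
    planeInChart π.plane φ q = Submodule.span ℝ {basisVec 0, basisVec 1}
  connected_slices : ∀ s t : ℝ, IsPreconnected {q : E4 | q ∈ φ.target ∧ q 2 = s ∧ q 3 = t}
  walker : ∃ a b c : E4 → ℝ, ContDiffOn ℝ ∞ a φ.target ∧ ContDiffOn ℝ ∞ b φ.target ∧
    ContDiffOn ℝ ∞ c φ.target ∧
    (∀ q ∈ φ.target, h.inChart φ q = (Ω (φ.symm q)) ^ 2 • walkerMatrix a b c q) ∧
    IsWalkerOn (walkerMatrix a b c) (planeInChart π.plane φ) φ.target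

/-- In the coordinates `φ = (u, v, x, y)`, the function `f` is affine as a function of
`u` and `v`. -/
def IsAffineInUV (φ : OpenPartialHomeomorph M E4) (f : M → ℝ) : Prop :=
  ∀ s t : ℝ, ∃ m n k : ℝ, ∀ q ∈ φ.target, q 2 = s → q 3 = t →
    f (φ.symm q) = m * q 0 + n * q 1 + k

/-- In the coordinates `φ = (u, v, x, y)`,
`Ω(u, v, x, y) = [M(x, y) u + N(x, y) v + K(x, y)]⁻¹` for smooth functions `M, N, K` of `(x, y)`. -/
def HasReciprocalAffineForm (φ : OpenPartialHomeomorph M E4) (Ω : M → ℝ) : Prop :=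
  ∃ m n k : ℝ × ℝ → ℝ,
    (∀ f ∈ ({m, n, k} : Set (ℝ × ℝ → ℝ)),
      ContDiffOn ℝ ∞ f ((fun q : E4 => (q 2, q 3)) '' φ.target)) ∧
    ∀ q ∈ φ.target, Ω (φ.symm q) =
      (m (q 2, q 3) * q 0 + n (q 2, q 3) * q 1 + k (q 2, q 3))⁻¹

end Manifold

end AlphaGeometry

end

/-!
# Ricci principal spinors and conformal Walker coordinates

Both parts come down to one computation and one existence theorem.

**The computation.** In a chart `(u, v, x, y)` in which `h = w⁻² g` has conformal Walker form,
`w = Ω⁻¹`, the leaves of constant `x`, `y` are totally null, hence totally geodesic, and the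
restriction to them of the Ricci tensor of `h` is `2 w⁻¹ ∂ᵢ ∂ⱼ w` (`ricci_leaf`). The Ricci spinor
contracted with `π^{A'} π^{B'}` is, since the `α`-planes are totally null, the restriction of the
Ricci tensor to the `α`-planes; since the Ricci tensor is invariant under changes of coordinates
(`IsPullback.ricciForm_eq`), it may be computed in the given chart (`isRPSOn_source_iff`). So
`[π^{A'}]` is an RPS on the chart domain if and only if the leafwise Hessian of `w` vanishes. The
leaves being connected, this says that `w` is affine on each of them, and then `∂_u w`, `∂_v w`
and `w - u ∂_u w - v ∂_v w` are constant along the leaves, that is, smooth functions of `(x, y)`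
(`affine_tfae`). This is the second part and one half of the first.

**The existence theorem.** For the other half, every point must lie in the domain of some system
of conformal Walker coordinates (`exists_isConformalWalkerChart`). The equation
`π_{B'} π^{A'} ∇_{AA'} π^{B'} = 0` says that the distribution of `α`-planes is involutive
(`IsNullGraph.bracket_eq_zero`): for fields `X_i` spanning it, `g(∇_{X_a} X_i, X_j) = 0`, so
`[X_0, X_1]` is orthogonal to the totally null plane and therefore lies in it. Frobenius' theorem
(`exists_totalDifferential`) yields coordinates in which the first two coordinate fields span the
`α`-planes (`exists_leaf_chart`). There the connection `∇` restricts to the leaves. In the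
component `Ψ̃_{A'B'C'D'} π^{A'} π^{B'} π^{C'}` of the Weyl spinor the Ricci terms cancel, and what
remains is the trace of the leafwise curvature; its vanishing says that the trace `τ_k` of the
leafwise connection is closed along the leaves (`IsLeafNull.pd_leafTrace_comm`), so
`∂_k μ = 2 τ_k` for some function `μ`. With `D` the determinant of the block `(h_{ka})`,
`k ∈ {0, 1}`, `a ∈ {2, 3}`, the one-forms `e^μ D⁻² h_{k2}` and `e^μ D⁻² h_{k3}` are closed along
the leaves (`IsLeafNull.exists_integrating_factor`). Potentials `u`, `v` of them, together with
the transverse coordinates, are conformal Walker coordinates with `Ω² = e^{-μ} D²`, on a ball so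
that the leaves are connected.

Frobenius' theorem with smooth dependence on parameters is proved by applying the inverse function
theorem to an integral operator on the Banach space of curves.
-/

open scoped Topology
open Filter

namespace AlphaGeometry

section

open scoped Topology unitInterval

/-! ### Composition and integration on spaces of continuous curves -/

section Curves

variable {K : Type} [TopologicalSpace K] [CompactSpace K]
variable {E : Type} [NormedAddCommGroup E] [NormedSpace ℝ E]
variable {F : Type} [NormedAddCommGroup F] [NormedSpace ℝ F]

/-- Pointwise application of a family of linear maps to a family of vectors, as a bounded
bilinear operation on spaces of continuous functions. -/
noncomputable def applyCLM : C(K, E →L[ℝ] F) →L[ℝ] C(K, E) →L[ℝ] C(K, F) :=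
  LinearMap.mkContinuous₂
    (LinearMap.mk₂ ℝ (fun (A : C(K, E →L[ℝ] F)) (γ : C(K, E)) =>
        (⟨fun t => A t (γ t), A.continuous.clm_apply γ.continuous⟩ : C(K, F)))
      (fun _ _ _ => by ext; simp) (fun _ _ _ => by ext; simp)
      (fun _ _ _ => by ext; simp) (fun _ _ _ => by ext; simp)) 1
    (fun A γ => by
      rw [ContinuousMap.norm_le _ (by positivity)]
      intro t
      simpa using (A t).le_of_opNorm_le_of_le (A.norm_coe_le_norm t) (γ.norm_coe_le_norm t))

/-- The derivative of `γ ↦ f ∘ γ` on a space of continuous functions is pointwise application of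
the derivative of `f`. -/
lemma hasFDerivAt_comp_continuousMap {f : E → F} (hf : ContDiff ℝ 1 f) (γ : C(K, E)) :
    HasFDerivAt (fun γ : C(K, E) => (⟨f, hf.continuous⟩ : C(E, F)).comp γ)
      (applyCLM ((⟨fderiv ℝ f, hf.continuous_fderiv one_ne_zero⟩ : C(E, E →L[ℝ] F)).comp γ)) γ := by
  set N' : C(K, E) → C(K, E →L[ℝ] F) := fun γ =>
    (⟨fderiv ℝ f, hf.continuous_fderiv one_ne_zero⟩ : C(E, E →L[ℝ] F)).comp γ with hN'
  have hcont : Continuous N' := ContinuousMap.continuous_postcomp _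
  rw [hasFDerivAt_iff_isLittleO, Asymptotics.isLittleO_iff]
  intro ε hε
  obtain ⟨δ, hδ, hδ'⟩ := Metric.eventually_nhds_iff.mp
    (hcont.continuousAt.eventually_mem (Metric.ball_mem_nhds (N' γ) hε))
  filter_upwards [Metric.ball_mem_nhds γ hδ] with η hη
  rw [ContinuousMap.norm_le _ (by positivity)]
  intro t
  -- the mean value inequality on the segment from `γ t` to `η t`, on which the derivative varies
  -- by at most `ε` because every point of it lies on a curve of the `δ`-ball around `γ`
  have key : ∀ z ∈ segment ℝ (γ t) (η t), ‖fderiv ℝ f z - fderiv ℝ f (γ t)‖ ≤ ε := by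
    rintro z hz
    obtain ⟨θ, hθ, rfl⟩ := (segment_eq_image' ℝ (γ t) (η t) ▸ hz)
    have h1 : dist (γ + θ • (η - γ)) γ < δ := by
      rw [dist_eq_norm, add_sub_cancel_left, norm_smul, Real.norm_eq_abs, abs_of_nonneg hθ.1]
      have h2 : ‖η - γ‖ < δ := by rwa [← dist_eq_norm]
      nlinarith [norm_nonneg (η - γ), hθ.2, hθ.1]
    have h3 : dist (N' (γ + θ • (η - γ))) (N' γ) < ε := hδ' h1
    have h5 := (ContinuousMap.dist_apply_le_dist t).trans h3.le
    rwa [dist_eq_norm] at h5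
  have h4 := (convex_segment (γ t) (η t)).norm_image_sub_le_of_norm_fderiv_le' (𝕜 := ℝ)
    (fun z _ => hf.differentiable one_ne_zero z) key
    (left_mem_segment ℝ _ _) (right_mem_segment ℝ _ _)
  calc _ = ‖f (η t) - f (γ t) - fderiv ℝ f (γ t) (η t - γ t)‖ := rfl
    _ ≤ ε * ‖η t - γ t‖ := h4
    _ ≤ ε * ‖η - γ‖ := by gcongr; exact (η - γ).norm_coe_le_norm t

/-- Composition with a smooth map is a smooth operation on continuous functions. -/
theorem contDiff_comp_continuousMap {f : E → F} (hf : ContDiff ℝ ∞ f) :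
    ContDiff ℝ ∞ (fun γ : C(K, E) => (⟨f, hf.continuous⟩ : C(E, F)).comp γ) := by
  rw [contDiff_infty]
  intro n
  induction n generalizing F with
  | zero =>
    simp only [CharP.cast_eq_zero, contDiff_zero]
    exact ContinuousMap.continuous_postcomp _
  | succ n ih =>
    have h1 : ContDiff ℝ 1 f := hf.of_le (by simp)
    have h2 : ContDiff ℝ ∞ (fderiv ℝ f) := hf.fderiv_right (by simp)
    rw [Nat.cast_succ, contDiff_succ_iff_hasFDerivAt]
    exact ⟨_, applyCLM.contDiff.comp (ih h2), hasFDerivAt_comp_continuousMap h1⟩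

/-- Integration of curves `γ : [0, 1] → F` from `0`. -/
noncomputable def primitiveCLM : C(I, F) →L[ℝ] C(I, F) :=
  LinearMap.mkContinuous
    { toFun := fun γ => ⟨fun t => ∫ s in (0 : ℝ)..t, IccExtend zero_le_one γ s,
        (intervalIntegral.continuous_primitive (fun _ _ =>
          (γ.continuous.Icc_extend' (h := zero_le_one)).intervalIntegrable _ _) 0).comp
            continuous_subtype_val⟩
      map_add' := fun γ η => by
        ext t
        simp only [ContinuousMap.coe_mk, ContinuousMap.add_apply]
        rw [← intervalIntegral.integral_add]
        · rfl
        · exact (γ.continuous.Icc_extend' (h := zero_le_one)).intervalIntegrable _ _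
        · exact (η.continuous.Icc_extend' (h := zero_le_one)).intervalIntegrable _ _
      map_smul' := fun c γ => by
        ext t
        simp only [ContinuousMap.coe_mk, RingHom.id_apply, ContinuousMap.smul_apply]
        rw [← intervalIntegral.integral_smul]
        rfl } 1
    (fun γ => by
      rw [ContinuousMap.norm_le _ (by positivity)]
      intro t
      have h := intervalIntegral.norm_integral_le_of_norm_le_const (a := 0) (b := (t : ℝ))
        (f := IccExtend zero_le_one γ) (C := ‖γ‖) (fun x _ => γ.norm_coe_le_norm _)
      simp only [sub_zero] at h
      refine h.trans ?_
      rw [mul_comm, abs_of_nonneg t.2.1]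
      gcongr
      exact t.2.2)

/-- The integrals in `primitiveCLM` solve the differential equation, at the end points too,
since the integrand is extended to `ℝ` by constants. -/
lemma hasDerivAt_primitive [CompleteSpace F] (γ : C(I, F)) (t : ℝ) :
    HasDerivAt (fun t => ∫ s in (0 : ℝ)..t, IccExtend zero_le_one γ s)
      (IccExtend zero_le_one γ t) t :=
  intervalIntegral.integral_hasDerivAt_right
    ((γ.continuous.Icc_extend' (h := zero_le_one)).intervalIntegrable _ _)
    ((γ.continuous.Icc_extend' (h := zero_le_one)).stronglyMeasurableAtFilter _ _)
    (γ.continuous.Icc_extend' (h := zero_le_one)).continuousAt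

end Curves

end

section

open scoped Topology unitInterval

/-! ### The inverse function theorem on a neighbourhood -/

/-- A smooth map with invertible derivative at a point restricts to a diffeomorphism between open
neighbourhoods. -/
theorem exists_openPartialHomeomorph_contDiffOn {E F : Type*} [NormedAddCommGroup E]
    [NormedSpace ℝ E] [CompleteSpace E] [NormedAddCommGroup F] [NormedSpace ℝ F]
    {f : E → F} {U : Set E} (hU : IsOpen U) (hf : ContDiffOn ℝ ∞ f U) {a : E} (ha : a ∈ U)
    {f' : E ≃L[ℝ] F} (hf' : HasFDerivAt f (f' : E →L[ℝ] F) a) :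
    ∃ e : OpenPartialHomeomorph E F, a ∈ e.source ∧ e.source ⊆ U ∧ (e : E → F) = f ∧
      ContDiffOn ℝ ∞ e e.source ∧ ContDiffOn ℝ ∞ e.symm e.target := by
  have hfa : ContDiffAt ℝ ∞ f a := hf.contDiffAt (hU.mem_nhds ha)
  set e₀ := hfa.toOpenPartialHomeomorph f hf' (by simp) with he₀
  set V : Set E := U ∩ fderiv ℝ f ⁻¹' range ((↑) : (E ≃L[ℝ] F) → E →L[ℝ] F) with hV
  have hVo : IsOpen V :=
    (hf.continuousOn_fderiv_of_isOpen hU (by simp)).isOpen_inter_preimage hU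
      ContinuousLinearEquiv.isOpen
  refine ⟨e₀.restrOpen V hVo, ?_, ?_, rfl, ?_, ?_⟩
  · exact ⟨hfa.mem_toOpenPartialHomeomorph_source hf' (by simp), ha, f', hf'.fderiv.symm⟩
  · exact fun x hx => hx.2.1
  · exact hf.mono fun x hx => hx.2.1
  · intro y hy
    have h1 := (e₀.restrOpen V hVo).map_target hy
    obtain ⟨g, hg⟩ := h1.2.2
    have h2 : ContDiffAt ℝ ∞ f ((e₀.restrOpen V hVo).symm y) :=
      hf.contDiffAt (hU.mem_nhds h1.2.1)
    refine ((e₀.restrOpen V hVo).contDiffAt_symm hy (f₀' := g) ?_ h2).contDiffWithinAt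
    rw [hg]
    exact (h2.differentiableAt (by simp)).hasFDerivAt

/-! ### The Frobenius theorem for total differential equations -/

section Frobenius

variable {E Y F : Type}
  [NormedAddCommGroup E] [NormedSpace ℝ E] [NormedAddCommGroup Y] [NormedSpace ℝ Y]
  [NormedAddCommGroup F] [NormedSpace ℝ F]

/-- The curve `t ↦ (((t z, y), γ t), z)` determined by `((z, y), γ)`. -/
noncomputable def rayCurve : ((E × Y) × C(I, F)) →L[ℝ] C(I, ((E × Y) × F) × E) :=
  LinearMap.mkContinuous
    { toFun := fun p => ⟨fun t => ((((t : ℝ) • p.1.1, p.1.2), p.2 t), p.1.1), by fun_prop⟩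
      map_add' := fun p q => by ext t <;> simp
      map_smul' := fun c p => ContinuousMap.ext fun t =>
        Prod.ext (Prod.ext (Prod.ext (smul_comm _ _ _) rfl) rfl) rfl } 1
    (fun p => by
      rw [ContinuousMap.norm_le _ (by positivity)]
      intro t
      have h1 : ‖p.1.1‖ ≤ ‖p‖ := (norm_fst_le _).trans (norm_fst_le p)
      have h2 : ‖p.1.2‖ ≤ ‖p‖ := (norm_snd_le p.1).trans (norm_fst_le p)
      have h3 : ‖p.2 t‖ ≤ ‖p‖ := (p.2.norm_coe_le_norm t).trans (norm_snd_le p)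
      have h4 : ‖(t : ℝ) • p.1.1‖ ≤ ‖p‖ := by
        rw [norm_smul, Real.norm_eq_abs, abs_of_nonneg t.2.1]
        exact (mul_le_of_le_one_left (norm_nonneg _) t.2.2).trans h1
      simp only [LinearMap.coe_mk, AddHom.coe_mk, ContinuousMap.coe_mk, one_mul]
      exact max_le (max_le (max_le h4 h2) h3) h1)

lemma rayCurve_apply (p : (E × Y) × C(I, F)) (t : I) :
    rayCurve p t = ((((t : ℝ) • p.1.1, p.1.2), p.2 t), p.1.1) := rfl

variable [FiniteDimensional ℝ E] [FiniteDimensional ℝ Y] [FiniteDimensional ℝ F]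

/-- The case of the Frobenius theorem in which the right-hand side is globally smooth.

Along the ray `t ↦ t z` the equation is the integral equation `γ = ∫ P(t z, y, γ) z dt` for a curve
`γ : [0, 1] → F`. The inverse function theorem on the Banach space of curves solves it by a `γ`
depending smoothly on `(z, y)`, and `w(z, y) = γ(1)`. The integrability condition makes
`∂γ(t)/∂z · ζ - t P(t z, y, γ(t)) ζ` a solution of a homogeneous linear equation,
so that it vanishes. -/
theorem exists_totalDifferential_of_contDiff {P : (E × Y) × F → E →L[ℝ] F} (hP : ContDiff ℝ ∞ P)
    {y₀ : Y} {U : Set ((E × Y) × F)} (hU : U ∈ 𝓝 ((((0 : E), y₀), (0 : F))))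
    (hint : ∀ p ∈ U, ∀ ζ z : E, fderiv ℝ P p ((ζ, 0), P p ζ) z = fderiv ℝ P p ((z, 0), P p z) ζ) :
    ∃ (w : E × Y → F) (V : Set (E × Y)), IsOpen V ∧ (0, y₀) ∈ V ∧ ContDiffOn ℝ ∞ w V ∧
      (∀ y, (0, y) ∈ V → w (0, y) = 0) ∧
      ∀ x ∈ V, (x, w x) ∈ U ∧ ∀ ζ, fderiv ℝ w x (ζ, 0) = P (x, w x) ζ := by
  set g : ((E × Y) × F) × E → F := fun q => P q.1 q.2 with hg_def
  have hg : ContDiff ℝ ∞ g := (hP.comp contDiff_fst).clm_apply contDiff_snd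
  have hg' : ∀ q q' : ((E × Y) × F) × E,
      fderiv ℝ g q q' = fderiv ℝ P q.1 q'.1 q.2 + P q.1 q'.2 := by
    intro q q'
    have h1 : HasFDerivAt (fun q : ((E × Y) × F) × E => P q.1)
        ((fderiv ℝ P q.1).comp (ContinuousLinearMap.fst ℝ _ _)) q :=
      ((hP.differentiable (by simp)) q.1).hasFDerivAt.comp q hasFDerivAt_fst
    have h2 := h1.clm_apply (hasFDerivAt_snd (p := q))
    rw [hg_def, h2.fderiv]
    simp [add_comm]
  set N : C(I, ((E × Y) × F) × E) → C(I, F) := fun γ =>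
    (⟨g, hg.continuous⟩ : C(((E × Y) × F) × E, F)).comp γ with hN_def
  have hN : ContDiff ℝ ∞ N := contDiff_comp_continuousMap hg
  have hN' := hasFDerivAt_comp_continuousMap (K := I) (hg.of_le (by simp) : ContDiff ℝ 1 g)
  set Φ : (E × Y) × C(I, F) → C(I, F) := fun p => p.2 - primitiveCLM (N (rayCurve p)) with hΦ_def
  have hΦ : ContDiff ℝ ∞ Φ :=
    contDiff_snd.sub (primitiveCLM.contDiff.comp (hN.comp rayCurve.contDiff))
  set H : (E × Y) × C(I, F) → (E × Y) × C(I, F) := fun p => (p.1, Φ p) with hH_def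
  have hH : ContDiff ℝ ∞ H := contDiff_fst.prodMk hΦ
  set b : (E × Y) × C(I, F) := ((0, y₀), 0) with hb
  have hbc : ∀ t : I, rayCurve b t = ((((0 : E), y₀), (0 : F)), (0 : E)) := by
    intro t; simp [rayCurve_apply, hb]
  have hHb : H b = b := by
    have : N (rayCurve b) = 0 := by
      ext t
      change g (rayCurve b t) = 0
      rw [hbc]; simp [hg_def]
    change (b.1, b.2 - primitiveCLM (N (rayCurve b))) = b
    rw [this]; simp [hb]
  -- at the base point the derivative of the integral operator involves only the parameters
  set D₀ : C(I, (((E × Y) × F) × E) →L[ℝ] F) := (⟨fderiv ℝ g, hg.continuous_fderiv (by simp)⟩ :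
    C(((E × Y) × F) × E, (((E × Y) × F) × E) →L[ℝ] F)).comp (rayCurve b) with hD₀
  set A : (E × Y) →L[ℝ] C(I, F) := -(primitiveCLM.comp ((applyCLM D₀).comp
      (rayCurve.comp (ContinuousLinearMap.inl ℝ (E × Y) C(I, F))))) with hA
  have hray : ∀ p, HasFDerivAt (rayCurve (E := E) (Y := Y) (F := F)) rayCurve p := fun p =>
    ContinuousLinearMap.hasFDerivAt _
  have hprim : ∀ γ, HasFDerivAt (primitiveCLM (F := F)) primitiveCLM γ := fun γ =>
    ContinuousLinearMap.hasFDerivAt _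
  have hH' : HasFDerivAt H (((ContinuousLinearEquiv.refl ℝ (E × Y)).skewProd
      (ContinuousLinearEquiv.refl ℝ C(I, F)) A :
        ((E × Y) × C(I, F)) ≃L[ℝ] ((E × Y) × C(I, F))) :
        ((E × Y) × C(I, F)) →L[ℝ] ((E × Y) × C(I, F))) b := by
    have h1 := (hN' (rayCurve b)).comp b (hray b)
    have h2 := (hasFDerivAt_snd (p := b)).sub ((hprim _).comp b h1)
    refine ((hasFDerivAt_fst (p := b)).prodMk h2).congr_fderiv ?_
    refine ContinuousLinearMap.ext fun p => Prod.ext rfl ?_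
    have h3 : ∀ q : (E × Y) × C(I, F), applyCLM D₀ (rayCurve q) =
        ContinuousMap.const I (P (((0 : E), y₀), (0 : F)) q.1.1) := by
      intro q
      ext t
      change fderiv ℝ g (rayCurve b t) (rayCurve q t) = _
      rw [hg', hbc]
      simp [rayCurve_apply]
    change p.2 - primitiveCLM (applyCLM D₀ (rayCurve p)) =
      p.2 + -(primitiveCLM (applyCLM D₀ (rayCurve (p.1, 0))))
    rw [h3 p, h3 (p.1, 0), sub_eq_add_neg]
  obtain ⟨e, hbe, -, he, -, he'⟩ :=
    exists_openPartialHomeomorph_contDiffOn isOpen_univ hH.contDiffOn (mem_univ b) hH'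
  have hbt : b ∈ e.target := by
    have := e.map_source hbe
    rwa [he, hHb] at this
  set j : E × Y → (E × Y) × C(I, F) := fun x => (x, 0) with hj
  have hjc : ContDiff ℝ ∞ j := contDiff_id.prodMk contDiff_const
  set V₁ : Set (E × Y) := j ⁻¹' e.target with hV₁
  have hV₁o : IsOpen V₁ := e.open_target.preimage hjc.continuous
  set Γ : E × Y → C(I, F) := fun x => (e.symm (j x)).2 with hΓ
  have hΓs : ContDiffOn ℝ ∞ Γ V₁ :=
    contDiff_snd.comp_contDiffOn (he'.comp hjc.contDiffOn fun x hx => hx)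
  have hsymm : ∀ x ∈ V₁, e.symm (j x) = (x, Γ x) ∧ Φ (x, Γ x) = 0 := by
    intro x hx
    have h1 : H (e.symm (j x)) = j x := by
      rw [← he]; exact e.right_inv hx
    have h2 : (e.symm (j x)).1 = x := congrArg Prod.fst h1
    have h3 : e.symm (j x) = (x, Γ x) := Prod.ext h2 rfl
    refine ⟨h3, ?_⟩
    rw [h3] at h1
    exact congrArg Prod.snd h1
  have hΓeq : ∀ x ∈ V₁, Γ x = primitiveCLM (N (rayCurve (x, Γ x))) := fun x hx =>
    sub_eq_zero.mp (hsymm x hx).2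
  have hΓb : Γ (0, y₀) = 0 := by
    have : e.symm b = b := by
      conv_lhs => rw [← hHb, ← he]
      exact e.left_inv hbe
    have h2 : e.symm (j (0, y₀)) = b := this
    rw [hΓ]; simp only [h2]; rfl
  -- the part of the domain over which the curves stay in `U`
  obtain ⟨r, hr, hrU⟩ := Metric.mem_nhds_iff.mp hU
  set κ : E × Y → C(I, ((E × Y) × F) × E) := fun x => rayCurve (x, Γ x) with hκ
  have hκc : ContinuousOn κ V₁ :=
    rayCurve.continuous.comp_continuousOn (continuousOn_id.prodMk hΓs.continuousOn)
  set V : Set (E × Y) := V₁ ∩ κ ⁻¹' Metric.ball (rayCurve b) r with hV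
  have hVo : IsOpen V := hκc.isOpen_inter_preimage hV₁o Metric.isOpen_ball
  have hκU : ∀ x ∈ V, ∀ t : I, (κ x t).1 ∈ U := by
    intro x hx t
    apply hrU
    have h1 : dist (κ x t) (rayCurve b t) < r :=
      (ContinuousMap.dist_apply_le_dist t).trans_lt hx.2
    rw [hbc] at h1
    exact (le_max_left _ _).trans_lt h1
  set ev : C(I, F) →L[ℝ] F := LinearMap.mkContinuous
    { toFun := fun γ => γ 1, map_add' := fun _ _ => rfl, map_smul' := fun _ _ => rfl } 1
    (fun γ => by simpa using γ.norm_coe_le_norm 1) with hev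
  refine ⟨fun x => ev (Γ x), V, hVo, ⟨hbt, ?_⟩, ?_, ?_, ?_⟩
  · change rayCurve _ ∈ Metric.ball _ _
    rw [hΓb]; exact Metric.mem_ball_self hr
  · exact ev.contDiff.comp_contDiffOn (hΓs.mono inter_subset_left)
  · intro y hy
    have h1 : N (rayCurve ((0, y), Γ (0, y))) = 0 := by
      ext t
      change P (rayCurve ((0, y), Γ (0, y)) t).1 (rayCurve ((0, y), Γ (0, y)) t).2 = 0
      simp [rayCurve_apply]
    change ev (Γ (0, y)) = 0
    rw [hΓeq _ hy.1, h1, map_zero, map_zero]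
  · intro x hx
    have hκ1 : κ x 1 = ((x, ev (Γ x)), x.1) := by
      simp only [hκ, rayCurve_apply, hev]; simp
    refine ⟨by have := hκU x hx 1; rwa [hκ1] at this, ?_⟩
    intro ζ
    have hΓd : HasFDerivAt Γ (fderiv ℝ Γ x) x :=
      ((hΓs.contDiffAt (hV₁o.mem_nhds hx.1)).differentiableAt (by simp)).hasFDerivAt
    set η : C(I, F) := fderiv ℝ Γ x (ζ, 0) with hη_def
    set c : C(I, F) := N (κ x) with hc
    set d : C(I, F) := applyCLM ((⟨fderiv ℝ g, hg.continuous_fderiv (by simp)⟩ :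
      C(((E × Y) × F) × E, (((E × Y) × F) × E) →L[ℝ] F)).comp (κ x))
      (rayCurve ((ζ, 0), η)) with hd
    have hη : η = primitiveCLM d := by
      have h1 := ((hprim _).comp x ((hN' (κ x)).comp x ((hray _).comp x
        ((hasFDerivAt_id x).prodMk hΓd))))
      have h2 : Γ =ᶠ[𝓝 x] fun x => primitiveCLM (N (rayCurve (x, Γ x))) := by
        filter_upwards [hV₁o.mem_nhds hx.1] with x' hx' using hΓeq x' hx'
      have h3 := (h1.congr_of_eventuallyEq h2).unique hΓd
      rw [hη_def, ← h3]
      rfl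
    set Ge : ℝ → F := fun t => ∫ s in (0 : ℝ)..t, IccExtend zero_le_one c s with hGe
    set ηe : ℝ → F := fun t => ∫ s in (0 : ℝ)..t, IccExtend zero_le_one d s with hηe
    have hGeI : ∀ t : I, Ge t = Γ x t := fun t => by
      rw [hΓeq x hx.1]; rfl
    have hηeI : ∀ t : I, ηe t = η t := fun t => by
      rw [hη]; rfl
    set κe : ℝ → (E × Y) × F := fun t => ((t • x.1, x.2), Ge t) with hκe
    have hκeI : ∀ t : I, κe t = (κ x t).1 := fun t => by
      simp only [hκe, hGeI]; rfl
    have hκe' : ∀ t, HasDerivAt κe ((x.1, 0), IccExtend zero_le_one c t) t := by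
      intro t
      have h1 : HasDerivAt (fun t : ℝ => t • x.1) x.1 t := by
        simpa using (hasDerivAt_id t).smul_const x.1
      exact (h1.prodMk (hasDerivAt_const t x.2)).prodMk (hasDerivAt_primitive c t)
    have hPκ : ∀ t, HasDerivAt (fun t => P (κe t) ζ)
        (fderiv ℝ P (κe t) ((x.1, 0), IccExtend zero_le_one c t) ζ) t := by
      intro t
      have h1 := ((hP.differentiable (by simp)) (κe t)).hasFDerivAt.comp_hasDerivAt t (hκe' t)
      exact (ContinuousLinearMap.apply ℝ F ζ).hasFDerivAt.comp_hasDerivAt t h1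
    -- `δ` satisfies a homogeneous linear differential equation, by the integrability condition
    set δ : ℝ → F := fun t => ηe t - t • P (κe t) ζ with hδ
    have hδ' : ∀ t ∈ Icc (0 : ℝ) 1,
        HasDerivAt δ (fderiv ℝ P (κe t) ((0, 0), δ t) x.1) t := by
      intro t ht
      have h1 := (hasDerivAt_primitive d t).sub ((hasDerivAt_id t).smul (hPκ t))
      refine h1.congr_deriv ?_
      have h2 : IccExtend zero_le_one c t = P (κe t) x.1 := by
        rw [IccExtend_of_mem _ _ ht, hκeI ⟨t, ht⟩]; rfl
      have h3 : IccExtend zero_le_one d t =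
          fderiv ℝ P (κe t) ((t • ζ, 0), ηe t) x.1 + P (κe t) ζ := by
        rw [IccExtend_of_mem _ _ ht, hκeI ⟨t, ht⟩, hηeI ⟨t, ht⟩]
        change fderiv ℝ g (κ x ⟨t, ht⟩) (rayCurve ((ζ, 0), η) ⟨t, ht⟩) = _
        rw [hg']
        rfl
      rw [h2, h3, ← hint (κe t) (by rw [hκeI ⟨t, ht⟩]; exact hκU x hx _) ζ x.1]
      have h4 : (((t • ζ, (0 : Y)), ηe t) : (E × Y) × F) =
          t • ((ζ, 0), P (κe t) ζ) + ((0, 0), δ t) := by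
        simp [hδ]
      rw [h4, map_add, map_smul]
      simp only [_root_.add_apply, _root_.smul_apply, id_eq, one_smul]
      abel
    have hcont : Continuous κe :=
      continuous_iff_continuousAt.mpr fun t => (hκe' t).continuousAt
    obtain ⟨C, hC⟩ := isCompact_Icc (a := (0 : ℝ)) (b := 1) |>.exists_bound_of_continuousOn
      ((hP.continuous_fderiv (by simp)).comp hcont).continuousOn
    have hzero := eq_zero_of_abs_deriv_le_mul_abs_self_of_eq_zero_right (f := δ)
      (f' := fun t => fderiv ℝ P (κe t) ((0, 0), δ t) x.1) (K := C * ‖x.1‖) (a := 0) (b := 1)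
      (fun t ht => (hδ' t ht).continuousAt.continuousWithinAt)
      (fun t ht => (hδ' t ⟨ht.1, ht.2.le⟩).hasDerivWithinAt)
      (by simp [hδ, hηe])
      (fun t ht => by
        have h1 := hC t ⟨ht.1, ht.2.le⟩
        have h2 : ‖(((0 : E), (0 : Y)), δ t)‖ = ‖δ t‖ := by
          simp [Prod.norm_def]
        calc _ ≤ ‖fderiv ℝ P (κe t) ((0, 0), δ t)‖ * ‖x.1‖ := ContinuousLinearMap.le_opNorm _ _
          _ ≤ (C * ‖δ t‖) * ‖x.1‖ := by
            gcongr
            rw [← h2]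
            exact ContinuousLinearMap.le_of_opNorm_le _ h1 _
          _ = C * ‖x.1‖ * ‖δ t‖ := by ring)
      1 (right_mem_Icc.mpr zero_le_one)
    have h5 : fderiv ℝ (fun x => ev (Γ x)) x (ζ, 0) = ev η := by
      have h6 : HasFDerivAt (fun x => ev (Γ x)) (ev.comp (fderiv ℝ Γ x)) x :=
        (ContinuousLinearMap.hasFDerivAt ev).comp x hΓd
      rw [h6.fderiv]
      rfl
    have h7 : ηe 1 = η 1 := hηeI 1
    have h8 : κe 1 = (x, ev (Γ x)) := by
      have := hκeI 1
      rw [hκ1] at this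
      exact this
    rw [h5]
    have h9 : ηe 1 - (1 : ℝ) • P (κe 1) ζ = 0 := hzero
    rw [h7, h8, one_smul, sub_eq_zero] at h9
    exact h9

/-- **Frobenius theorem** with parameters: the total differential equation `∂w/∂z = P(z, y, w)`,
`w(0, y) = 0`, has a smooth local solution if `P` satisfies the integrability condition. -/
theorem exists_totalDifferential {P : (E × Y) × F → E →L[ℝ] F} {y₀ : Y}
    {U : Set ((E × Y) × F)} (hUo : IsOpen U) (hU : (((0 : E), y₀), (0 : F)) ∈ U)
    (hP : ContDiffOn ℝ ∞ P U)
    (hint : ∀ p ∈ U, ∀ ζ z : E, fderiv ℝ P p ((ζ, 0), P p ζ) z = fderiv ℝ P p ((z, 0), P p z) ζ) :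
    ∃ (w : E × Y → F) (V : Set (E × Y)), IsOpen V ∧ (0, y₀) ∈ V ∧ ContDiffOn ℝ ∞ w V ∧
      (∀ y, (0, y) ∈ V → w (0, y) = 0) ∧
      ∀ x ∈ V, (x, w x) ∈ U ∧ ∀ ζ, fderiv ℝ w x (ζ, 0) = P (x, w x) ζ := by
  obtain ⟨χ, hχ⟩ : ∃ χ : ContDiffBump (((0 : E), y₀), (0 : F)),
      Metric.closedBall (((0 : E), y₀), (0 : F)) χ.rOut ⊆ U := by
    obtain ⟨r, hr, hrU⟩ := Metric.nhds_basis_closedBall.mem_iff.mp (hUo.mem_nhds hU)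
    exact ⟨⟨r / 2, r, by positivity, by linarith⟩, hrU⟩
  -- multiplication by the bump function makes the right-hand side globally smooth
  set Q : (E × Y) × F → E →L[ℝ] F := fun p => χ p • P p with hQ
  have hQs : ContDiff ℝ ∞ Q := by
    rw [contDiff_iff_contDiffAt]
    intro p
    by_cases hp : p ∈ U
    · exact χ.contDiffAt.smul (hP.contDiffAt (hUo.mem_nhds hp))
    · have h1 : p ∈ (tsupport χ)ᶜ := by
        rw [χ.tsupport_eq]; exact fun h => hp (hχ h)
      have h2 : Q =ᶠ[𝓝 p] fun _ => 0 := by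
        filter_upwards [(isClosed_tsupport χ).isOpen_compl.mem_nhds h1] with q hq
        simp [hQ, image_eq_zero_of_notMem_tsupport hq]
      exact contDiffAt_const.congr_of_eventuallyEq h2
  have hball : Metric.ball (((0 : E), y₀), (0 : F)) χ.rIn ⊆ U := fun p hp =>
    hχ (Metric.ball_subset_closedBall (Metric.ball_subset_ball χ.rIn_lt_rOut.le hp))
  have hQP : ∀ p ∈ Metric.ball (((0 : E), y₀), (0 : F)) χ.rIn, Q p = P p := fun p hp => by
    simp [hQ, χ.one_of_mem_closedBall (Metric.ball_subset_closedBall hp)]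
  have hQP' : ∀ p ∈ Metric.ball (((0 : E), y₀), (0 : F)) χ.rIn, fderiv ℝ Q p = fderiv ℝ P p :=
    fun p hp => Filter.EventuallyEq.fderiv_eq <| by
      filter_upwards [Metric.isOpen_ball.mem_nhds hp] with q hq using hQP q hq
  obtain ⟨w, V, hV, hV0, hw, hw0, hw1⟩ := exists_totalDifferential_of_contDiff hQs (y₀ := y₀)
    (U := Metric.ball (((0 : E), y₀), (0 : F)) χ.rIn) (Metric.ball_mem_nhds _ χ.rIn_pos)
    (fun p hp ζ z => by rw [hQP' p hp, hQP p hp]; exact hint p (hball hp) ζ z)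
  exact ⟨w, V, hV, hV0, hw, hw0, fun x hx => ⟨hball (hw1 x hx).1, fun ζ => by
    rw [(hw1 x hx).2, hQP _ (hw1 x hx).1]⟩⟩

end Frobenius

end

/-! ### Partial derivatives and smooth matrix fields -/

section PartialDerivatives

variable {U : Set E4} {f g : E4 → ℝ} {x : E4}

lemma pd_congr (i : Fin 4) (h : f =ᶠ[𝓝 x] g) : pd i f x = pd i g x := by
  have h1 : fderiv ℝ f x = fderiv ℝ g x := h.fderiv_eq
  simp only [pd, h1]

lemma pd_eventuallyEq (i : Fin 4) (h : f =ᶠ[𝓝 x] g) : pd i f =ᶠ[𝓝 x] pd i g := by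
  filter_upwards [h.fderiv (𝕜 := ℝ)] with y hy
  simp only [pd, hy]

@[simp] lemma pd_const (i : Fin 4) (c : ℝ) : pd i (fun _ => c) x = 0 := by
  simp [pd]

lemma pd_add (i : Fin 4) (hf : DifferentiableAt ℝ f x) (hg : DifferentiableAt ℝ g x) :
    pd i (fun y => f y + g y) x = pd i f x + pd i g x := by
  simp only [pd]; rw [fderiv_fun_add hf hg]; rfl

lemma pd_sub (i : Fin 4) (hf : DifferentiableAt ℝ f x) (hg : DifferentiableAt ℝ g x) :
    pd i (fun y => f y - g y) x = pd i f x - pd i g x := by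
  simp only [pd]; rw [fderiv_fun_sub hf hg]; rfl

lemma pd_neg (i : Fin 4) : pd i (fun y => -f y) x = -pd i f x := by
  simp only [pd]; rw [fderiv_fun_neg]; rfl

lemma pd_mul (i : Fin 4) (hf : DifferentiableAt ℝ f x) (hg : DifferentiableAt ℝ g x) :
    pd i (fun y => f y * g y) x = pd i f x * g x + f x * pd i g x := by
  simp only [pd]; rw [fderiv_fun_mul hf hg]
  simp only [_root_.add_apply, _root_.smul_apply, smul_eq_mul]; ring

lemma pd_const_mul (i : Fin 4) (c : ℝ) (hf : DifferentiableAt ℝ f x) :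
    pd i (fun y => c * f y) x = c * pd i f x := by
  rw [pd_mul i (differentiableAt_const c) hf]; simp

lemma pd_sum {ι : Type*} (i : Fin 4) (s : Finset ι) {F : ι → E4 → ℝ}
    (hF : ∀ k ∈ s, DifferentiableAt ℝ (F k) x) :
    pd i (fun y => ∑ k ∈ s, F k y) x = ∑ k ∈ s, pd i (F k) x := by
  simp only [pd]; rw [fderiv_fun_sum hF]; simp

lemma pd_comp {φ : ℝ → ℝ} {φ' : ℝ} (i : Fin 4) (hφ : HasDerivAt φ φ' (f x))
    (hf : DifferentiableAt ℝ f x) : pd i (fun y => φ (f y)) x = φ' * pd i f x := by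
  have h : HasFDerivAt (fun y => φ (f y)) (φ' • fderiv ℝ f x) x :=
    hφ.comp_hasFDerivAt x hf.hasFDerivAt
  simp only [pd]; rw [h.fderiv]; rfl

lemma pd_coord (i k : Fin 4) : pd i (fun y => y k) x = if k = i then 1 else 0 := by
  have h : HasFDerivAt (fun y : E4 => y k) (EuclideanSpace.proj (𝕜 := ℝ) k : E4 →L[ℝ] ℝ) x :=
    (EuclideanSpace.proj (𝕜 := ℝ) k : E4 →L[ℝ] ℝ).hasFDerivAt
  simp only [pd]; rw [h.fderiv]
  simp [basisVec]

lemma contDiffOn_pd (hU : IsOpen U) (hf : ContDiffOn ℝ ∞ f U) (i : Fin 4) :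
    ContDiffOn ℝ ∞ (pd i f) U :=
  (hf.fderiv_of_isOpen hU (by simp)).clm_apply contDiffOn_const

lemma differentiableAt_of_contDiffOn {E F : Type*} [NormedAddCommGroup E] [NormedSpace ℝ E]
    [NormedAddCommGroup F] [NormedSpace ℝ F] {f : E → F} {U : Set E} {x : E}
    (hf : ContDiffOn ℝ ∞ f U) (hU : IsOpen U)
    (hx : x ∈ U) : DifferentiableAt ℝ f x :=
  (hf.contDiffAt (hU.mem_nhds hx)).differentiableAt (by simp)

lemma pd_comm (hU : IsOpen U) (hf : ContDiffOn ℝ ∞ f U) (hx : x ∈ U) (i j : Fin 4) :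
    pd i (pd j f) x = pd j (pd i f) x := by
  have h1 : ∀ i j, pd i (pd j f) x = fderiv ℝ (fderiv ℝ f) x (basisVec i) (basisVec j) := by
    intro i j
    have h2 : DifferentiableAt ℝ (fderiv ℝ f) x :=
      differentiableAt_of_contDiffOn (hf.fderiv_of_isOpen hU (by simp)) hU hx
    have h3 := h2.hasFDerivAt.clm_apply (hasFDerivAt_const (basisVec j) x)
    change fderiv ℝ (fun y => fderiv ℝ f y (basisVec j)) x (basisVec i) = _
    rw [h3.fderiv]; simp
  rw [h1, h1]
  exact ((hf.contDiffAt (hU.mem_nhds hx)).isSymmSndFDerivAt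
    (by simpa using WithTop.coe_le_coe.mpr (le_top : (2 : ℕ∞) ≤ ⊤))) _ _

lemma fderiv_apply_eq_sum (f : E4 → ℝ) (x v : E4) : fderiv ℝ f x v = ∑ i, v i * pd i f x := by
  have hv : v = ∑ i, v i • basisVec i := by
    ext k
    simp [basisVec, Pi.single_apply]
  conv_lhs => rw [hv]
  simp [pd]

lemma pd_congr_of_isOpen (hU : IsOpen U) (hx : x ∈ U) (h : ∀ y ∈ U, f y = g y) (i : Fin 4) :
    pd i f x = pd i g x :=
  pd_congr i (Filter.eventually_of_mem (hU.mem_nhds hx) h)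

lemma pd_eq_zero_of_isOpen {c : ℝ} (hU : IsOpen U) (hx : x ∈ U) (h : ∀ y ∈ U, f y = c)
    (i : Fin 4) : pd i f x = 0 :=
  (pd_congr_of_isOpen hU hx h i).trans (pd_const i c)

lemma eq_zero_or_eq_one_of_lt_two {i : Fin 4} (hi : i < 2) : i = 0 ∨ i = 1 := by
  revert i; decide

end PartialDerivatives

section SmoothMatrices

variable {E : Type*} [NormedAddCommGroup E] [NormedSpace ℝ E] {U : Set E}
  {n : Type*} [Fintype n] [DecidableEq n]

lemma contDiffOn_det {A : E → Matrix n n ℝ} (hA : ∀ i j, ContDiffOn ℝ ∞ (fun x => A x i j) U) :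
    ContDiffOn ℝ ∞ (fun x => (A x).det) U := by
  simp only [Matrix.det_apply]
  refine ContDiffOn.sum fun σ _ => ?_
  exact (contDiffOn_prod fun i _ => hA _ _).const_smul _

lemma contDiffOn_inv_apply {A : E → Matrix n n ℝ}
    (hA : ∀ i j, ContDiffOn ℝ ∞ (fun x => A x i j) U) (hdet : ∀ x ∈ U, IsUnit (A x).det)
    (i j : n) : ContDiffOn ℝ ∞ (fun x => (A x)⁻¹ i j) U := by
  simp only [Matrix.inv_def, Matrix.smul_apply, Ring.inverse_eq_inv', smul_eq_mul,
    Matrix.adjugate_apply]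
  refine ((contDiffOn_det hA).inv fun x hx => (hdet x hx).ne_zero).mul
    (contDiffOn_det fun k l => ?_)
  simp only [Matrix.updateRow_apply]
  split_ifs
  · exact contDiffOn_const
  · exact hA k l

end SmoothMatrices

/-! ### Levi-Civita connection and curvature in coordinates -/

/-- `G` is a smooth field of symmetric nondegenerate matrices on `U`. -/
structure IsMetricOn (G : MetricField) (U : Set E4) : Prop where
  isOpen : IsOpen U
  smooth : ∀ i j, ContDiffOn ℝ ∞ (fun x => G x i j) U
  symm : ∀ x ∈ U, ∀ i j, G x i j = G x j i
  isUnit_det : ∀ x ∈ U, IsUnit (G x).det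

namespace IsMetricOn

variable {G : MetricField} {U : Set E4} (hG : IsMetricOn G U) {x : E4}
include hG

lemma mono {V : Set E4} (hV : IsOpen V) (hVU : V ⊆ U) : IsMetricOn G V :=
  ⟨hV, fun i j => (hG.smooth i j).mono hVU, fun x hx => hG.symm x (hVU hx),
    fun x hx => hG.isUnit_det x (hVU hx)⟩

lemma inv_symm (hx : x ∈ U) (i j : Fin 4) : (G x)⁻¹ i j = (G x)⁻¹ j i := by
  have h1 : (G x)ᵀ = G x := Matrix.ext fun i j => hG.symm x hx j i
  have h2 := Matrix.transpose_nonsing_inv (G x)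
  rw [h1] at h2
  exact (congrFun (congrFun h2 j) i)

lemma mul_inv_apply (hx : x ∈ U) (i j : Fin 4) :
    ∑ k, G x i k * (G x)⁻¹ k j = if i = j then 1 else 0 := by
  rw [← Matrix.mul_apply, Matrix.mul_nonsing_inv _ (hG.isUnit_det x hx), Matrix.one_apply]

lemma inv_mul_apply (hx : x ∈ U) (i j : Fin 4) :
    ∑ k, (G x)⁻¹ i k * G x k j = if i = j then 1 else 0 := by
  rw [← Matrix.mul_apply, Matrix.nonsing_inv_mul _ (hG.isUnit_det x hx), Matrix.one_apply]

lemma pd_symm (hx : x ∈ U) (c i j : Fin 4) :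
    pd c (fun y => G y i j) x = pd c (fun y => G y j i) x :=
  pd_congr_of_isOpen hG.isOpen hx (fun y hy => hG.symm y hy i j) c

lemma contDiffOn_christoffel (k i j : Fin 4) : ContDiffOn ℝ ∞ (christoffel G k i j) U := by
  have h1 := fun i j c => contDiffOn_pd hG.isOpen (hG.smooth i j) c
  unfold christoffel
  exact contDiffOn_const.mul (ContDiffOn.sum fun l _ =>
    (contDiffOn_inv_apply hG.smooth hG.isUnit_det k l).mul (((h1 _ _ _).add (h1 _ _ _)).sub
        (h1 _ _ _)))

lemma christoffel_symm (hx : x ∈ U) (k i j : Fin 4) :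
    christoffel G k i j x = christoffel G k j i x := by
  simp only [christoffel]
  congr 1
  refine Finset.sum_congr rfl fun l _ => ?_
  rw [hG.pd_symm hx l i j]; ring

/-- The Christoffel symbols of the first kind. -/
lemma lower_christoffel (hx : x ∈ U) (a i j : Fin 4) :
    ∑ k, G x a k * christoffel G k i j x =
      (1 / 2) * (pd i (fun y => G y j a) x + pd j (fun y => G y i a) x
        - pd a (fun y => G y i j) x) := by
  set T : Fin 4 → ℝ := fun l => pd i (fun y => G y j l) x + pd j (fun y => G y i l) x
        - pd l (fun y => G y i j) x
  calc ∑ k, G x a k * christoffel G k i j x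
      = (1 / 2) * ∑ l, (∑ k, G x a k * (G x)⁻¹ k l) * T l := by
        simp only [christoffel, Finset.mul_sum, Finset.sum_mul]
        rw [Finset.sum_comm]
        exact Finset.sum_congr rfl fun l _ => Finset.sum_congr rfl fun k _ => by ring
    _ = (1 / 2) * T a := by simp [hG.mul_inv_apply hx]

/-- Metric compatibility of the Levi-Civita connection in components. -/
lemma pd_metric (hx : x ∈ U) (c a b : Fin 4) :
    pd c (fun y => G y a b) x =
      ∑ l, G x a l * christoffel G l c b x + ∑ l, G x b l * christoffel G l c a x := by
  rw [hG.lower_christoffel hx, hG.lower_christoffel hx, hG.pd_symm hx c b a, hG.pd_symm hx a c b,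
    hG.pd_symm hx b c a]
  rw [hG.pd_symm hx a b c]; ring

/-- The covariant curvature tensor through second derivatives of the metric. -/
lemma riemannLower_eq (hx : x ∈ U) (a b c d : Fin 4) :
    riemannLower G a b c d x =
      (1 / 2) * (pd c (pd b fun y => G y d a) x - pd c (pd a fun y => G y d b) x
        - pd d (pd b fun y => G y c a) x + pd d (pd a fun y => G y c b) x)
      - ∑ l, ∑ m, G x l m * christoffel G m c a x * christoffel G l d b x
      + ∑ l, ∑ m, G x l m * christoffel G m d a x * christoffel G l c b x := by
  have hΓ := fun k i j => differentiableAt_of_contDiffOn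
      (hG.contDiffOn_christoffel k i j) hG.isOpen hx
  have hGd := fun i j => differentiableAt_of_contDiffOn (hG.smooth i j) hG.isOpen hx
  have hGp := fun i j c => differentiableAt_of_contDiffOn (contDiffOn_pd hG.isOpen
      (hG.smooth i j) c) hG.isOpen hx
  -- the derivative of a Christoffel symbol of the second kind, lowered
  have key : ∀ c d, ∑ l, G x a l * pd c (christoffel G l d b) x =
      (1 / 2) * (pd c (pd d fun y => G y b a) x + pd c (pd b fun y => G y d a) x
        - pd c (pd a fun y => G y d b) x)
      - ∑ l, (∑ m, G x a m * christoffel G m c l x + ∑ m, G x l m * christoffel G m c a x)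
        * christoffel G l d b x := by
    intro c d
    have h1 : pd c (fun y => ∑ l, G y a l * christoffel G l d b y) x =
        pd c (fun y => (1 / 2) * (pd d (fun y => G y b a) y + pd b (fun y => G y d a) y
          - pd a (fun y => G y d b) y)) x :=
      pd_congr_of_isOpen hG.isOpen hx (fun y hy => hG.lower_christoffel hy a d b) c
    rw [pd_const_mul c _ (((hGp _ _ _).fun_add (hGp _ _ _)).fun_sub (hGp _ _ _)),
      pd_sub c ((hGp _ _ _).fun_add (hGp _ _ _)) (hGp _ _ _), pd_add c (hGp _ _ _) (hGp _ _ _),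
      pd_sum c _ (fun l _ => (hGd a l).fun_mul (hΓ l d b))] at h1
    rw [← h1]
    simp only [pd_mul c (hGd a _) (hΓ _ d b), ← hG.pd_metric hx c a, Finset.sum_add_distrib]
    ring
  simp only [riemannLower, riemann, mul_add, mul_sub, Finset.sum_add_distrib,
      Finset.sum_sub_distrib,
    key, pd_comm hG.isOpen (hG.smooth b a) hx c d]
  have h2 : ∀ c d, ∑ l, G x a l * ∑ m, christoffel G l c m x * christoffel G m d b x =
      ∑ l, (∑ m, G x a m * christoffel G m c l x) * christoffel G l d b x := by
    intro c d
    simp only [Finset.mul_sum, Finset.sum_mul]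
    rw [Finset.sum_comm]
    exact Finset.sum_congr rfl fun l _ => Finset.sum_congr rfl fun k _ => by ring
  simp only [h2, add_mul, Finset.sum_add_distrib, Finset.sum_mul]
  ring

lemma riemannLower_antisymm (hx : x ∈ U) (a b c d : Fin 4) :
    riemannLower G a b c d x = -riemannLower G b a c d x := by
  rw [hG.riemannLower_eq hx, hG.riemannLower_eq hx]
  have h : ∀ c a d b, ∑ l, ∑ m, G x l m * christoffel G m c a x * christoffel G l d b x =
      ∑ l, ∑ m, G x l m * christoffel G m d b x * christoffel G l c a x := by
    intro c a d b
    rw [Finset.sum_comm]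
    exact Finset.sum_congr rfl fun l _ => Finset.sum_congr rfl fun m _ => by
      rw [hG.symm x hx l m]; ring
  rw [h c a d b, h d a c b]; ring

/-- The pair symmetry, from which the symmetry of the Ricci tensor follows. -/
lemma riemannLower_pair (hx : x ∈ U) (a b c d : Fin 4) :
    riemannLower G a b c d x = riemannLower G c d a b x := by
  rw [hG.riemannLower_eq hx, hG.riemannLower_eq hx]
  have hd : ∀ i j k l, pd i (pd j fun y => G y k l) x = pd j (pd i fun y => G y l k) x := by
    intro i j k l
    rw [pd_comm hG.isOpen (hG.smooth k l) hx i j]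
    exact pd_congr j (pd_eventuallyEq i (by
      filter_upwards [hG.isOpen.mem_nhds hx] with y hy using hG.symm y hy k l))
  have hs : ∀ i j k l, pd i (pd j fun y => G y k l) x = pd i (pd j fun y => G y l k) x := by
    intro i j k l
    exact pd_congr i (pd_eventuallyEq j (by
      filter_upwards [hG.isOpen.mem_nhds hx] with y hy using hG.symm y hy k l))
  have h : ∀ c a d b, ∑ l, ∑ m, G x l m * christoffel G m c a x * christoffel G l d b x =
      ∑ l, ∑ m, G x l m * christoffel G m d b x * christoffel G l c a x := by
    intro c a d b
    rw [Finset.sum_comm]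
    exact Finset.sum_congr rfl fun l _ => Finset.sum_congr rfl fun m _ => by
      rw [hG.symm x hx l m]; ring
  have h' : ∀ c a d b, ∑ l, ∑ m, G x l m * christoffel G m c a x * christoffel G l d b x =
      ∑ l, ∑ m, G x l m * christoffel G m a c x * christoffel G l b d x := by
    intro c a d b
    simp only [hG.christoffel_symm hx _ c a, hG.christoffel_symm hx _ d b]
  rw [h' c a d b, h d a c b, h' c b d a, hd c b d a, hs c a d b, hd d b c a, hs d a c b]
  rw [pd_comm hG.isOpen (hG.smooth b d) hx c a, pd_comm hG.isOpen (hG.smooth b c) hx d a,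
    hs b d a c, hs a c b d]
  rw [hs b d c a]
  ring

lemma riemann_eq (hx : x ∈ U) (l b c d : Fin 4) :
    riemann G l b c d x = ∑ a, (G x)⁻¹ l a * riemannLower G a b c d x := by
  simp only [riemannLower, Finset.mul_sum, ← mul_assoc]
  rw [Finset.sum_comm]
  simp only [← Finset.sum_mul, hG.inv_mul_apply hx]
  simp

lemma ricci_symm (hx : x ∈ U) (b d : Fin 4) : ricci G b d x = ricci G d b x := by
  simp only [ricci, hG.riemann_eq hx]
  rw [Finset.sum_comm]
  refine Finset.sum_congr rfl fun a _ => Finset.sum_congr rfl fun e _ => ?_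
  rw [hG.riemannLower_pair hx a b e d, hG.inv_symm hx]

end IsMetricOn

/-! ### Invariance of the Ricci tensor under changes of coordinates -/

/-- The `i`-th coordinate as a continuous linear functional. -/
noncomputable abbrev coordCLM (i : Fin 4) : E4 →L[ℝ] ℝ := EuclideanSpace.proj i

/-- The metric `G` as a field of continuous bilinear forms. -/
noncomputable def metricForm (G : MetricField) (x : E4) : E4 →L[ℝ] E4 →L[ℝ] ℝ :=
  ∑ p : Fin 4 × Fin 4, G x p.1 p.2 • (coordCLM p.1).smulRight (coordCLM p.2)

/-- The Christoffel symbols of `G` as a field of continuous bilinear maps. -/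
noncomputable def connForm (G : MetricField) (x : E4) : E4 →L[ℝ] E4 →L[ℝ] E4 :=
  ∑ p : Fin 4 × Fin 4 × Fin 4, christoffel G p.1 p.2.1 p.2.2 x •
    (coordCLM p.2.1).smulRight ((coordCLM p.2.2).smulRight (basisVec p.1))

/-- The curvature operator `R(X, Y) Z` of the Levi-Civita connection of `G`. -/
noncomputable def curvOp (G : MetricField) (x X Y Z : E4) : E4 :=
  fderiv ℝ (connForm G) x X Y Z - fderiv ℝ (connForm G) x Y X Z
    + connForm G x X (connForm G x Y Z) - connForm G x Y (connForm G x X Z)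

/-- The Ricci tensor of `G` as a bilinear form. -/
noncomputable def ricciForm (G : MetricField) (x u v : E4) : ℝ :=
  ∑ b, ∑ d, u b * v d * ricci G b d x

section SumSmul

variable {E ι H : Type*} [NormedAddCommGroup E] [NormedSpace ℝ E] [Fintype ι]
  [NormedAddCommGroup H] [NormedSpace ℝ H] {f : ι → E → ℝ} (c : ι → H) {U : Set E} {x : E}

lemma contDiffOn_sum_smul_const (hf : ∀ i, ContDiffOn ℝ ∞ (f i) U) :
    ContDiffOn ℝ ∞ (fun x => ∑ i, f i x • c i) U :=
  ContDiffOn.sum fun i _ => (hf i).smul contDiffOn_const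

lemma fderiv_sum_smul_const (hf : ∀ i, DifferentiableAt ℝ (f i) x) (w : E) :
    fderiv ℝ (fun x => ∑ i, f i x • c i) x w = ∑ i, fderiv ℝ (f i) x w • c i := by
  have h1 : HasFDerivAt (fun x => ∑ i, f i x • c i)
      (∑ i, (fderiv ℝ (f i) x).smulRight (c i)) x :=
    HasFDerivAt.fun_sum fun i _ => (hf i).hasFDerivAt.smul_const _
  rw [h1.fderiv]
  simp

lemma sum_rotate {R α β γ : Type*} [AddCommMonoid R] [Fintype α] [Fintype β] [Fintype γ]
    (g : α → β → γ → R) : ∑ i, ∑ j, ∑ k, g i j k = ∑ j, ∑ k, ∑ i, g i j k := by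
  rw [Finset.sum_comm]
  exact Finset.sum_congr rfl fun j _ => Finset.sum_comm

end SumSmul

lemma metricForm_apply (G : MetricField) (x u v : E4) : metricForm G x u v = dotG G x u v := by
  simp [metricForm, dotG, mul_assoc, Fintype.sum_prod_type]

lemma basisVec_apply (i j : Fin 4) : basisVec i j = if j = i then 1 else 0 := by
  simp [basisVec]

lemma eq_sum_basisVec (v : E4) : v = ∑ i, v i • basisVec i := by
  ext k
  simp [basisVec_apply]

lemma connForm_apply (G : MetricField) (x u v : E4) (k : Fin 4) :
    connForm G x u v k = ∑ i, ∑ j, christoffel G k i j x * u i * v j := by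
  simp [connForm, basisVec_apply, mul_assoc, Fintype.sum_prod_type]

lemma dotG_basisVec (G : MetricField) (x : E4) (i j : Fin 4) :
    dotG G x (basisVec i) (basisVec j) = G x i j := by
  simp [dotG, basisVec_apply]

namespace IsMetricOn

variable {G : MetricField} {U : Set E4} (hG : IsMetricOn G U) {x : E4}
include hG

lemma dotG_symm (hx : x ∈ U) (u v : E4) : dotG G x u v = dotG G x v u := by
  simp only [dotG]
  rw [Finset.sum_comm]
  exact Finset.sum_congr rfl fun i _ => Finset.sum_congr rfl fun j _ => by
    rw [hG.symm x hx]; ring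

/-- Nondegeneracy of the metric. -/
lemma eq_zero_of_dotG (hx : x ∈ U) {v : E4} (hv : ∀ w, dotG G x v w = 0) : v = 0 := by
  ext k
  have h1 : ∀ j, ∑ i, G x j i * v i = 0 := fun j => by
    have := hv (basisVec j)
    simpa [dotG, basisVec_apply, hG.symm x hx j] using this
  have h2 : ∑ j, (G x)⁻¹ k j * ∑ i, G x j i * v i = v k := by
    simp only [Finset.mul_sum, ← mul_assoc]
    rw [Finset.sum_comm]
    simp only [← Finset.sum_mul, hG.inv_mul_apply hx]
    simp
  rw [← h2]; simp [h1]

lemma contDiffOn_metricForm : ContDiffOn ℝ ∞ (metricForm G) U :=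
  contDiffOn_sum_smul_const _ fun p => hG.smooth p.1 p.2

lemma contDiffOn_connForm : ContDiffOn ℝ ∞ (connForm G) U :=
  contDiffOn_sum_smul_const _ fun p => hG.contDiffOn_christoffel p.1 p.2.1 p.2.2

lemma fderiv_metricForm_apply (hx : x ∈ U) (w u v : E4) :
    fderiv ℝ (metricForm G) x w u v =
      ∑ i, ∑ j, (∑ c, w c * pd c (fun y => G y i j) x) * u i * v j := by
  have h1 := fderiv_sum_smul_const (fun p : Fin 4 × Fin 4 =>
    (coordCLM p.1).smulRight (coordCLM p.2)) (fun p : Fin 4 × Fin 4 =>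
      differentiableAt_of_contDiffOn (hG.smooth p.1 p.2) hG.isOpen hx) w
  have h2 : fderiv ℝ (metricForm G) x w = ∑ p : Fin 4 × Fin 4,
    fderiv ℝ (fun y => G y p.1 p.2) x w • (coordCLM p.1).smulRight (coordCLM p.2) := h1
  rw [h2]
  simp [fderiv_apply_eq_sum, mul_assoc, Fintype.sum_prod_type]

lemma fderiv_connForm_apply (hx : x ∈ U) (w u v : E4) (k : Fin 4) :
    fderiv ℝ (connForm G) x w u v k =
      ∑ i, ∑ j, (∑ c, w c * pd c (christoffel G k i j) x) * u i * v j := by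
  have h1 := fderiv_sum_smul_const (fun p : Fin 4 × Fin 4 × Fin 4 =>
    (coordCLM p.2.1).smulRight ((coordCLM p.2.2).smulRight (basisVec p.1)))
      (fun p : Fin 4 × Fin 4 × Fin 4 => differentiableAt_of_contDiffOn
        (hG.contDiffOn_christoffel p.1 p.2.1 p.2.2) hG.isOpen hx) w
  have h2 : fderiv ℝ (connForm G) x w = ∑ p : Fin 4 × Fin 4 × Fin 4,
    fderiv ℝ (christoffel G p.1 p.2.1 p.2.2) x w •
      (coordCLM p.2.1).smulRight ((coordCLM p.2.2).smulRight (basisVec p.1)) := h1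
  rw [h2]
  simp [fderiv_apply_eq_sum, basisVec_apply, mul_assoc, Fintype.sum_prod_type]

/-- The Koszul formula in a coordinate domain. -/
lemma metricForm_connForm (hx : x ∈ U) (u v w : E4) :
    2 * metricForm G x (connForm G x u v) w =
      fderiv ℝ (metricForm G) x u v w + fderiv ℝ (metricForm G) x v u w
        - fderiv ℝ (metricForm G) x w u v := by
  have h1 : metricForm G x (connForm G x u v) w =
      ∑ i, ∑ j, ∑ a, (∑ k, G x a k * christoffel G k i j x) * u i * v j * w a := by
    simp only [metricForm_apply, dotG, connForm_apply, Finset.mul_sum, Finset.sum_mul]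
    rw [Finset.sum_comm, Finset.sum_congr rfl fun a _ => sum_rotate _, sum_rotate]
    refine Finset.sum_congr rfl fun i _ => Finset.sum_congr rfl fun j _ =>
      Finset.sum_congr rfl fun a _ => Finset.sum_congr rfl fun k _ => ?_
    rw [hG.symm x hx k a]; ring
  have h2 : ∀ u v w : E4, fderiv ℝ (metricForm G) x u v w =
      ∑ i, ∑ j, ∑ a, pd i (fun y => G y j a) x * u i * v j * w a := by
    intro u v w
    rw [hG.fderiv_metricForm_apply hx]
    simp only [Finset.sum_mul]
    rw [← sum_rotate]
    exact Finset.sum_congr rfl fun i _ => Finset.sum_congr rfl fun j _ =>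
      Finset.sum_congr rfl fun a _ => by ring
  have h3 : fderiv ℝ (metricForm G) x v u w =
      ∑ i, ∑ j, ∑ a, pd j (fun y => G y i a) x * u i * v j * w a := by
    rw [h2, Finset.sum_comm]
    exact Finset.sum_congr rfl fun i _ => Finset.sum_congr rfl fun j _ =>
      Finset.sum_congr rfl fun a _ => by ring
  have h4 : fderiv ℝ (metricForm G) x w u v =
      ∑ i, ∑ j, ∑ a, pd a (fun y => G y i j) x * u i * v j * w a := by
    rw [h2, sum_rotate]
    exact Finset.sum_congr rfl fun i _ => Finset.sum_congr rfl fun j _ =>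
      Finset.sum_congr rfl fun a _ => by ring
  rw [h1, h2 u v w, h3, h4]
  simp only [hG.lower_christoffel hx, Finset.mul_sum, ← Finset.sum_add_distrib,
    ← Finset.sum_sub_distrib]
  exact Finset.sum_congr rfl fun i _ => Finset.sum_congr rfl fun j _ =>
      Finset.sum_congr rfl fun a _ => by ring

lemma riemann_eq_curvOp (hx : x ∈ U) (l k i j : Fin 4) :
    riemann G l k i j x = curvOp G x (basisVec i) (basisVec j) (basisVec k) l := by
  simp only [curvOp, PiLp.add_apply, PiLp.sub_apply, hG.fderiv_connForm_apply hx, connForm_apply,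
    basisVec_apply, riemann, Finset.sum_sub_distrib]
  simp
  ring

end IsMetricOn

lemma hasFDerivAt_comp_of_differentiableAt {E F H : Type*} [NormedAddCommGroup E] [NormedSpace ℝ E]
    [NormedAddCommGroup F] [NormedSpace ℝ F] [NormedAddCommGroup H] [NormedSpace ℝ H]
    {g : F → H} {ψ : E → F} {x : E} (hg : DifferentiableAt ℝ g (ψ x))
    (hψ : DifferentiableAt ℝ ψ x) :
    HasFDerivAt (fun y => g (ψ y)) ((fderiv ℝ g (ψ x)).comp (fderiv ℝ ψ x)) x :=
  hg.hasFDerivAt.comp x hψ.hasFDerivAt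

lemma curvOp_eq_sum (G : MetricField) (x X v u : E4) :
    curvOp G x X v u =
      ∑ b, ∑ d, (u b * v d) • curvOp G x X (basisVec d) (basisVec b) := by
  set B : E4 →ₗ[ℝ] E4 →ₗ[ℝ] E4 := LinearMap.mk₂ ℝ (fun u v => curvOp G x X v u)
    (fun a b c => by simp only [curvOp, map_add]; abel)
    (fun c a b => by simp only [curvOp, map_smul, smul_sub, smul_add])
    (fun a b c => by simp only [curvOp, map_add, _root_.add_apply]; abel)
    (fun c a b => by simp only [curvOp, map_smul, _root_.smul_apply, smul_sub, smul_add]) with hB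
  have h : B u v = ∑ b, ∑ d, (u b * v d) • B (basisVec b) (basisVec d) := by
    conv_lhs => rw [eq_sum_basisVec u, eq_sum_basisVec v]
    simp only [map_sum, map_smul, LinearMap.sum_apply, LinearMap.smul_apply, Finset.smul_sum,
      smul_smul]
    rw [Finset.sum_comm]
    exact Finset.sum_congr rfl fun b _ => Finset.sum_congr rfl fun d _ => by rw [mul_comm]
  exact h

/-- The Ricci tensor as a trace, the form in which it is manifestly invariant. -/
lemma ricciForm_eq_trace {G : MetricField} {U : Set E4} (hG : IsMetricOn G U) {x : E4}
    (hx : x ∈ U) (u v : E4) (T : E4 →ₗ[ℝ] E4) (hT : ∀ X, T X = curvOp G x X v u) :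
    ricciForm G x u v = LinearMap.trace ℝ E4 T := by
  have h1 : LinearMap.trace ℝ E4 T = ∑ a, T (basisVec a) a := by
    rw [LinearMap.trace_eq_matrix_trace ℝ (EuclideanSpace.basisFun (Fin 4) ℝ).toBasis]
    simp [Matrix.trace, LinearMap.toMatrix_apply, basisVec]
  have h2 : ∀ a, T (basisVec a) a = ∑ b, ∑ d, u b * v d * riemann G a b a d x := by
    intro a
    rw [hT, curvOp_eq_sum, WithLp.ofLp_sum, Finset.sum_apply]
    refine Finset.sum_congr rfl fun b _ => ?_
    rw [WithLp.ofLp_sum, Finset.sum_apply]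
    refine Finset.sum_congr rfl fun d _ => ?_
    rw [PiLp.smul_apply, hG.riemann_eq_curvOp hx, smul_eq_mul]
  rw [h1]
  simp only [h2, ricciForm, ricci, Finset.mul_sum]
  rw [← sum_rotate]

lemma fderiv_transformation_law {E : Type*} [NormedAddCommGroup E] [NormedSpace ℝ E]
    {J : E → E →L[ℝ] E} {J₂ C C' : E → E →L[ℝ] E →L[ℝ] E} {x : E}
    (hJ : DifferentiableAt ℝ J x) (hJ₂ : DifferentiableAt ℝ J₂ x) (hC' : DifferentiableAt ℝ C' x)
    (hC : DifferentiableAt ℝ C x) (u v : E)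
    (h : ∀ᶠ y in 𝓝 x, J y (C' y u v) = C y (J y u) (J y v) + J₂ y u v) (X : E) :
    fderiv ℝ J x X (C' x u v) + J x (fderiv ℝ C' x X u v) =
      fderiv ℝ C x X (J x u) (J x v) + C x (fderiv ℝ J x X u) (J x v)
        + C x (J x u) (fderiv ℝ J x X v) + fderiv ℝ J₂ x X u v := by
  have hc : ∀ u : E, HasFDerivAt (fun _ : E => u) (0 : E →L[ℝ] E) x := fun u =>
    hasFDerivAt_const u x
  have h1 := ((hC.hasFDerivAt.clm_apply (hJ.hasFDerivAt.clm_apply (hc u))).clm_apply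
    (hJ.hasFDerivAt.clm_apply (hc v))).fun_add
      ((hJ₂.hasFDerivAt.clm_apply (hc u)).clm_apply (hc v))
  have h2 := hJ.hasFDerivAt.clm_apply ((hC'.hasFDerivAt.clm_apply (hc u)).clm_apply (hc v))
  have h4 := congrArg (fun L : E →L[ℝ] E => L X) (h2.unique (h1.congr_of_eventuallyEq h))
  simp at h4
  rw [add_comm, h4]
  abel

/-- `ψ` maps `U'` to `U` by a local diffeomorphism for which `G'` is the pull-back of `G`. -/
structure IsPullback (ψ : E4 → E4) (G' G : MetricField) (U' U : Set E4) : Prop where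
  smooth : ContDiffOn ℝ ∞ ψ U'
  mapsTo : MapsTo ψ U' U
  invertible : ∀ x ∈ U', ∃ L : E4 ≃L[ℝ] E4, (L : E4 →L[ℝ] E4) = fderiv ℝ ψ x
  pullback : ∀ x ∈ U', ∀ i j,
    G' x i j = dotG G (ψ x) (fderiv ℝ ψ x (basisVec i)) (fderiv ℝ ψ x (basisVec j))

namespace IsPullback

variable {ψ : E4 → E4} {G G' : MetricField} {U U' : Set E4} {x : E4}
  (hψ : IsPullback ψ G' G U' U) (hG' : IsMetricOn G' U') (hG : IsMetricOn G U)
include hψ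

lemma metricForm_eq (hx : x ∈ U') (u v : E4) :
    metricForm G' x u v = metricForm G (ψ x) (fderiv ℝ ψ x u) (fderiv ℝ ψ x v) := by
  conv_lhs => rw [eq_sum_basisVec u, eq_sum_basisVec v]
  conv_rhs => rw [eq_sum_basisVec u, eq_sum_basisVec v]
  simp only [map_sum, map_smul, _root_.sum_apply, _root_.smul_apply]
  refine Finset.sum_congr rfl fun i _ => ?_
  congr 1
  refine Finset.sum_congr rfl fun j _ => ?_
  congr 1
  rw [metricForm_apply, metricForm_apply, dotG_basisVec, hψ.pullback x hx]

include hG'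

/-- The second derivative of `ψ` is symmetric. -/
lemma symm_snd (hx : x ∈ U') (u v : E4) :
    fderiv ℝ (fderiv ℝ ψ) x u v = fderiv ℝ (fderiv ℝ ψ) x v u :=
  ((hψ.smooth.contDiffAt (hG'.isOpen.mem_nhds hx)).isSymmSndFDerivAt
    (by simpa using WithTop.coe_le_coe.mpr (le_top : (2 : ℕ∞) ≤ ⊤))) _ _

lemma symm_third (hx : x ∈ U') (u v : E4) :
    fderiv ℝ (fderiv ℝ (fderiv ℝ ψ)) x u v = fderiv ℝ (fderiv ℝ (fderiv ℝ ψ)) x v u :=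
  (((hψ.smooth.fderiv_of_isOpen hG'.isOpen (m := ∞) (by simp)).contDiffAt
    (hG'.isOpen.mem_nhds hx)).isSymmSndFDerivAt
    (by simpa using WithTop.coe_le_coe.mpr (le_top : (2 : ℕ∞) ≤ ⊤))) _ _

include hG

lemma fderiv_metricForm_eq (hx : x ∈ U') (w u v : E4) :
    fderiv ℝ (metricForm G') x w u v =
      fderiv ℝ (metricForm G) (ψ x) (fderiv ℝ ψ x w) (fderiv ℝ ψ x u) (fderiv ℝ ψ x v)
      + metricForm G (ψ x) (fderiv ℝ (fderiv ℝ ψ) x w u) (fderiv ℝ ψ x v)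
      + metricForm G (ψ x) (fderiv ℝ ψ x u) (fderiv ℝ (fderiv ℝ ψ) x w v) := by
  have hψd : HasFDerivAt ψ (fderiv ℝ ψ x) x :=
    (differentiableAt_of_contDiffOn hψ.smooth hG'.isOpen hx).hasFDerivAt
  have hJ : HasFDerivAt (fderiv ℝ ψ) (fderiv ℝ (fderiv ℝ ψ) x) x :=
    (differentiableAt_of_contDiffOn (hψ.smooth.fderiv_of_isOpen hG'.isOpen (by simp)) hG'.isOpen
      hx).hasFDerivAt
  have hg : HasFDerivAt (metricForm G) (fderiv ℝ (metricForm G) (ψ x)) (ψ x) :=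
    (differentiableAt_of_contDiffOn hG.contDiffOn_metricForm hG.isOpen
      (hψ.mapsTo hx)).hasFDerivAt
  have hg' : HasFDerivAt (metricForm G') (fderiv ℝ (metricForm G') x) x :=
    (differentiableAt_of_contDiffOn hG'.contDiffOn_metricForm hG'.isOpen hx).hasFDerivAt
  have hgc : HasFDerivAt (fun y => metricForm G (ψ y))
      ((fderiv ℝ (metricForm G) (ψ x)).comp (fderiv ℝ ψ x)) x :=
    hasFDerivAt_comp_of_differentiableAt (g := metricForm G)
        hg.differentiableAt hψd.differentiableAt
  have h1 := (hgc.clm_apply (hJ.clm_apply (hasFDerivAt_const u x))).clm_apply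
    (hJ.clm_apply (hasFDerivAt_const v x))
  have h2 := (hg'.clm_apply (hasFDerivAt_const u x)).clm_apply (hasFDerivAt_const v x)
  have h3 : (fun y => metricForm G' y u v) =ᶠ[𝓝 x]
      fun y => metricForm G (ψ y) (fderiv ℝ ψ y u) (fderiv ℝ ψ y v) := by
    filter_upwards [hG'.isOpen.mem_nhds hx] with y hy using hψ.metricForm_eq hy u v
  have h4 := congrArg (fun L : E4 →L[ℝ] ℝ => L w) (h2.unique (h1.congr_of_eventuallyEq h3))
  simp at h4
  rw [h4]
  ring

/-- The transformation law of the Christoffel symbols. -/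
lemma connForm_eq (hx : x ∈ U') (u v : E4) :
    fderiv ℝ ψ x (connForm G' x u v) =
      connForm G (ψ x) (fderiv ℝ ψ x u) (fderiv ℝ ψ x v) + fderiv ℝ (fderiv ℝ ψ) x u v := by
  have hy := hψ.mapsTo hx
  obtain ⟨L, hL⟩ := hψ.invertible x hx
  rw [← sub_eq_zero]
  refine hG.eq_zero_of_dotG hy fun w' => ?_
  obtain ⟨w, rfl⟩ : ∃ w, fderiv ℝ ψ x w = w' := ⟨L.symm w', by rw [← hL]; simp⟩
  have h1 := hG'.metricForm_connForm hx u v w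
  rw [hψ.metricForm_eq hx, hψ.fderiv_metricForm_eq hG' hG hx, hψ.fderiv_metricForm_eq hG' hG hx,
    hψ.fderiv_metricForm_eq hG' hG hx] at h1
  have h2 := hG.metricForm_connForm hy (fderiv ℝ ψ x u) (fderiv ℝ ψ x v) (fderiv ℝ ψ x w)
  have hs : ∀ a b, metricForm G (ψ x) a b = metricForm G (ψ x) b a := fun a b => by
    rw [metricForm_apply, metricForm_apply, hG.dotG_symm hy]
  rw [← metricForm_apply]
  simp only [map_sub, map_add, _root_.sub_apply, _root_.add_apply]
  rw [hψ.symm_snd hG' hx v u, hψ.symm_snd hG' hx w u, hψ.symm_snd hG' hx w v,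
    hs (fderiv ℝ ψ x v) (fderiv ℝ (fderiv ℝ ψ) x u w),
    hs (fderiv ℝ ψ x u) (fderiv ℝ (fderiv ℝ ψ) x v w)] at h1
  have h3 := hs (fderiv ℝ (fderiv ℝ ψ) x v w) (fderiv ℝ ψ x u)
  linarith

set_option maxRecDepth 2000 in
/-- The curvature operators correspond under pull-back. -/
lemma curvOp_eq (hx : x ∈ U') (X Y Z : E4) :
    fderiv ℝ ψ x (curvOp G' x X Y Z) =
      curvOp G (ψ x) (fderiv ℝ ψ x X) (fderiv ℝ ψ x Y) (fderiv ℝ ψ x Z) := by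
  have hψd : HasFDerivAt ψ (fderiv ℝ ψ x) x :=
    (differentiableAt_of_contDiffOn hψ.smooth hG'.isOpen hx).hasFDerivAt
  have hJs : ContDiffOn ℝ ∞ (fderiv ℝ ψ) U' := hψ.smooth.fderiv_of_isOpen hG'.isOpen (by simp)
  have hJ : HasFDerivAt (fderiv ℝ ψ) (fderiv ℝ (fderiv ℝ ψ) x) x :=
    (differentiableAt_of_contDiffOn hJs hG'.isOpen hx).hasFDerivAt
  have hJ2 : HasFDerivAt (fderiv ℝ (fderiv ℝ ψ)) (fderiv ℝ (fderiv ℝ (fderiv ℝ ψ)) x) x :=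
    (differentiableAt_of_contDiffOn (hJs.fderiv_of_isOpen hG'.isOpen (m := ∞) (by simp))
      hG'.isOpen hx).hasFDerivAt
  have hg : HasFDerivAt (connForm G) (fderiv ℝ (connForm G) (ψ x)) (ψ x) :=
    (differentiableAt_of_contDiffOn hG.contDiffOn_connForm hG.isOpen
      (hψ.mapsTo hx)).hasFDerivAt
  have hg' : HasFDerivAt (connForm G') (fderiv ℝ (connForm G') x) x :=
    (differentiableAt_of_contDiffOn hG'.contDiffOn_connForm hG'.isOpen hx).hasFDerivAt
  have hgc : HasFDerivAt (fun y => connForm G (ψ y))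
      ((fderiv ℝ (connForm G) (ψ x)).comp (fderiv ℝ ψ x)) x :=
    hasFDerivAt_comp_of_differentiableAt (g := connForm G) hg.differentiableAt hψd.differentiableAt
  -- the transformation law of the connection, differentiated once
  have key : ∀ X u v, fderiv ℝ ψ x (fderiv ℝ (connForm G') x X u v) =
      fderiv ℝ (connForm G) (ψ x) (fderiv ℝ ψ x X) (fderiv ℝ ψ x u) (fderiv ℝ ψ x v)
      + connForm G (ψ x) (fderiv ℝ (fderiv ℝ ψ) x X u) (fderiv ℝ ψ x v)
      + connForm G (ψ x) (fderiv ℝ ψ x u) (fderiv ℝ (fderiv ℝ ψ) x X v)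
      + fderiv ℝ (fderiv ℝ (fderiv ℝ ψ)) x X u v
      - fderiv ℝ (fderiv ℝ ψ) x X (connForm G' x u v) := by
    intro X u v
    have h3 := fderiv_transformation_law (J := fderiv ℝ ψ) (J₂ := fderiv ℝ (fderiv ℝ ψ))
      (C' := connForm G') hJ.differentiableAt hJ2.differentiableAt
      hg'.differentiableAt (C := fun y => connForm G (ψ y)) hgc.differentiableAt u v
      (by filter_upwards [hG'.isOpen.mem_nhds hx] with y hy using hψ.connForm_eq hG' hG hy u v) X
    rw [hgc.fderiv] at h3
    rw [eq_sub_iff_add_eq, add_comm, h3]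
    rfl
  simp only [curvOp, map_sub, map_add, key, hψ.connForm_eq hG' hG hx]
  rw [hψ.symm_snd hG' hx Y X, hψ.symm_third hG' hx Y X]
  abel

/-- The Ricci tensor is invariant under pull-back. -/
theorem ricciForm_eq (hx : x ∈ U') (u v : E4) :
    ricciForm G' x u v = ricciForm G (ψ x) (fderiv ℝ ψ x u) (fderiv ℝ ψ x v) := by
  obtain ⟨L, hL⟩ := hψ.invertible x hx
  set T : E4 →ₗ[ℝ] E4 :=
    { toFun := fun X => curvOp G (ψ x) X (fderiv ℝ ψ x v) (fderiv ℝ ψ x u)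
      map_add' := fun a b => by simp only [curvOp, map_add, _root_.add_apply]; abel
      map_smul' := fun c a => by
        simp only [curvOp, map_smul, _root_.smul_apply, RingHom.id_apply, smul_sub, smul_add] }
    with hT
  set e : E4 ≃ₗ[ℝ] E4 := L.toLinearEquiv
  rw [ricciForm_eq_trace hG (hψ.mapsTo hx) _ _ T fun _ => rfl,
    ricciForm_eq_trace hG' hx _ _ (e.symm.conj T) fun X => ?_, LinearMap.trace_conj']
  rw [LinearEquiv.conj_apply]
  change L.symm (T (L X)) = _
  rw [ContinuousLinearEquiv.symm_apply_eq]
  have h1 : ∀ y, L y = fderiv ℝ ψ x y := fun y => by rw [← hL]; rfl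
  rw [h1, h1, hψ.curvOp_eq hG' hG hx]
  rfl

end IsPullback

/-! ### Tensors on the manifold in charts -/

lemma bilin_comp_eq_sum {V : Type*} [AddCommGroup V] [Module ℝ V] [TopologicalSpace V]
    [IsTopologicalAddGroup V] [ContinuousSMul ℝ V]
    (B : V →L[ℝ] V →L[ℝ] ℝ) (L : E4 →L[ℝ] V) (u v : E4) :
    B (L u) (L v) = ∑ i, ∑ j, B (L (basisVec i)) (L (basisVec j)) * u i * v j := by
  conv_lhs => rw [eq_sum_basisVec u, eq_sum_basisVec v]
  simp only [map_sum, map_smul, _root_.sum_apply, _root_.smul_apply, smul_eq_mul, Finset.mul_sum]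
  rw [Finset.sum_comm]
  exact Finset.sum_congr rfl fun i _ => Finset.sum_congr rfl fun j _ => by ring

section Charts

variable {M : Type*} [TopologicalSpace M] [ChartedSpace (EuclideanSpace ℝ (Fin 4)) M]

lemma mdifferentiable_of_mem_maximalAtlas {φ : OpenPartialHomeomorph M E4}
    (hφ : φ ∈ IsManifold.maximalAtlas (𝓡 4) ∞ M) : φ.MDifferentiable (𝓡 4) (𝓡 4) :=
  ⟨(contMDiffOn_of_mem_maximalAtlas hφ).mdifferentiableOn (by simp),
    (contMDiffOn_symm_of_mem_maximalAtlas hφ).mdifferentiableOn (by simp)⟩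

/-- The points of the second chart lying in the domain of the first. -/
def overlap (φ' φ : OpenPartialHomeomorph M E4) : Set E4 := φ'.target ∩ φ'.symm ⁻¹' φ.source

omit [ChartedSpace (EuclideanSpace ℝ (Fin 4)) M] in
lemma isOpen_overlap (φ' φ : OpenPartialHomeomorph M E4) : IsOpen (overlap φ' φ) :=
  φ'.isOpen_inter_preimage_symm φ.open_source

lemma contDiffOn_transition {φ φ' : OpenPartialHomeomorph M E4}
    (hφ : φ ∈ IsManifold.maximalAtlas (𝓡 4) ∞ M) (hφ' : φ' ∈ IsManifold.maximalAtlas (𝓡 4) ∞ M) :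
    ContDiffOn ℝ ∞ (φ ∘ φ'.symm) (overlap φ' φ) := by
  rw [← contMDiffOn_iff_contDiffOn]
  exact (contMDiffOn_of_mem_maximalAtlas hφ).comp
    ((contMDiffOn_symm_of_mem_maximalAtlas hφ').mono inter_subset_left) fun x hx => hx.2

variable [IsManifold (𝓡 4) ∞ M]

lemma contMDiffOn_mfderiv_symm {φ : OpenPartialHomeomorph M E4}
    (hφ : φ ∈ IsManifold.maximalAtlas (𝓡 4) ∞ M) (v : E4) :
    ContMDiffOn (𝓡 4) (𝓡 4).tangent ∞
      (fun x => (⟨φ.symm x, mfderiv (𝓡 4) (𝓡 4) φ.symm x v⟩ : TangentBundle (𝓡 4) M)) φ.target := by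
  have h1 := (contMDiffOn_symm_of_mem_maximalAtlas hφ).contMDiffOn_tangentMapWithin (m := ∞)
    (by simp) φ.open_target.uniqueMDiffOn
  have h2 : ContMDiff (𝓡 4) (𝓡 4).tangent ∞
      (fun x : E4 => (⟨x, v⟩ : TangentBundle (𝓡 4) E4)) :=
    contMDiff_vectorSpace_iff_contDiff.mpr contDiff_const
  refine (h1.comp h2.contMDiffOn (fun x hx => hx)).congr fun x hx => ?_
  simp only [Function.comp, tangentMapWithin]
  rw [mfderivWithin_of_isOpen φ.open_target hx]

namespace NeutralMetric

variable (h : NeutralMetric M)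

lemma dotG_inChart (φ : OpenPartialHomeomorph M E4) (x u v : E4) :
    dotG (h.inChart φ) x u v = h.inner (φ.symm x) (mfderiv (𝓡 4) (𝓡 4) φ.symm x u)
      (mfderiv (𝓡 4) (𝓡 4) φ.symm x v) := by
  refine Eq.trans ?_ (bilin_comp_eq_sum (h.inner (φ.symm x))
    (mfderiv (𝓡 4) (𝓡 4) φ.symm x) u v).symm
  exact Finset.sum_congr rfl fun i _ => Finset.sum_congr rfl fun j _ => rfl

lemma inner_nondegenerate (p : M) {v : TangentSpace (𝓡 4) p} (hv : ∀ w, h.inner p v w = 0) :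
    v = 0 := by
  obtain ⟨b, hb⟩ := h.neutral p
  rw [← b.sum_repr v] at hv ⊢
  have h1 : ∀ i, b.repr v i = 0 := by
    intro i
    have h2 := hv (b i)
    simp only [map_sum, map_smul, _root_.sum_apply, _root_.smul_apply, hb, smul_eq_mul] at h2
    fin_cases i <;> simpa [Matrix.diagonal_apply, Fin.sum_univ_four] using h2
  simp [h1]

variable {φ : OpenPartialHomeomorph M E4}
  (hφ : φ ∈ IsManifold.maximalAtlas (𝓡 4) ∞ M)
include hφ

lemma contDiffOn_inChart (i j : Fin 4) :
    ContDiffOn ℝ ∞ (fun x => h.inChart φ x i j) φ.target := by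
  have h1 := h.contMDiff.comp_contMDiffOn (contMDiffOn_symm_of_mem_maximalAtlas hφ)
  have h2 := ContMDiffOn.clm_bundle_apply₂ (F₃ := ℝ) (E₃ := Bundle.Trivial M ℝ) h1
    (contMDiffOn_mfderiv_symm hφ (basisVec i)) (contMDiffOn_mfderiv_symm hφ (basisVec j))
  intro x hx
  have h3 := (Bundle.contMDiffWithinAt_totalSpace.mp (h2 x hx)).2
  exact h3.contDiffWithinAt

lemma isMetricOn_inChart : IsMetricOn (h.inChart φ) φ.target where
  isOpen := φ.open_target
  smooth := h.contDiffOn_inChart hφ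
  symm := fun x _ i j => h.symm _ _ _
  isUnit_det := fun x hx => by
    have hs := (mdifferentiable_of_mem_maximalAtlas hφ).symm
    rw [isUnit_iff_ne_zero]
    intro hdet
    obtain ⟨v, hv0, hv⟩ := Matrix.exists_mulVec_eq_zero_iff.mpr hdet
    set v' : E4 := WithLp.toLp 2 v
    have h1 : ∀ u, dotG (h.inChart φ) x u v' = 0 := by
      intro u
      have h2 : ∀ i, ∑ j, h.inChart φ x i j * v j = 0 := fun i => congrFun hv i
      have h3 : dotG (h.inChart φ) x u v' = ∑ i, u i * ∑ j, h.inChart φ x i j * v j := by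
        simp only [dotG, Finset.mul_sum]
        exact Finset.sum_congr rfl fun i _ => Finset.sum_congr rfl fun j _ => by
          change _ * _ * v j = _; ring
      rw [h3]; simp [h2]
    have h4 : mfderiv (𝓡 4) (𝓡 4) φ.symm x v' = 0 := by
      refine h.inner_nondegenerate _ fun w => ?_
      obtain ⟨u, rfl⟩ := hs.mfderiv_surjective hx w
      exact (h.symm _ _ _).trans ((h.dotG_inChart φ x u v').symm.trans (h1 u))
    have h5 : v' = 0 := hs.mfderiv_injective hx (h4.trans (map_zero _).symm)
    exact hv0 (by simpa [v'] using congrArg WithLp.ofLp h5)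

end NeutralMetric

variable {φ φ' : OpenPartialHomeomorph M E4}
  (hφ : φ ∈ IsManifold.maximalAtlas (𝓡 4) ∞ M) (hφ' : φ' ∈ IsManifold.maximalAtlas (𝓡 4) ∞ M)
include hφ hφ'

omit [IsManifold (𝓡 4) ∞ M] in
lemma mfderiv_symm_eq {x : E4} (hx : x ∈ overlap φ' φ) (v : E4) :
    (mfderiv (𝓡 4) (𝓡 4) φ'.symm x v : E4) =
      mfderiv (𝓡 4) (𝓡 4) φ.symm ((φ ∘ φ'.symm) x) (fderiv ℝ (φ ∘ φ'.symm) x v) := by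
  have hy : (φ ∘ φ'.symm) x ∈ φ.target := φ.map_source hx.2
  have h1 : HasMFDerivAt (𝓡 4) (𝓡 4) φ.symm ((φ ∘ φ'.symm) x)
      (mfderiv (𝓡 4) (𝓡 4) φ.symm ((φ ∘ φ'.symm) x)) :=
    ((mdifferentiable_of_mem_maximalAtlas hφ).mdifferentiableAt_symm hy).hasMFDerivAt
  have h2 : HasMFDerivAt (𝓡 4) (𝓡 4) (φ ∘ φ'.symm) x (fderiv ℝ (φ ∘ φ'.symm) x) :=
    (differentiableAt_of_contDiffOn (contDiffOn_transition hφ hφ') (isOpen_overlap φ' φ)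
      hx).hasFDerivAt.hasMFDerivAt
  have h3 : φ'.symm =ᶠ[𝓝 x] φ.symm ∘ (φ ∘ φ'.symm) := by
    filter_upwards [(isOpen_overlap φ' φ).mem_nhds hx] with y hy
    exact (φ.left_inv hy.2).symm
  rw [h3.mfderiv_eq, (h1.comp x h2).mfderiv]
  rfl

lemma isPullback_inChart (h : NeutralMetric M) :
    IsPullback (φ ∘ φ'.symm) (h.inChart φ') (h.inChart φ) (overlap φ' φ) φ.target where
  smooth := contDiffOn_transition hφ hφ'
  mapsTo := fun x hx => φ.map_source hx.2
  invertible := fun x hx => by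
    have h1 : ∀ v : E4, fderiv ℝ (φ ∘ φ'.symm) x v = 0 → v = 0 := by
      intro v hv
      have h2 := mfderiv_symm_eq hφ hφ' hx v
      rw [hv] at h2
      exact (mdifferentiable_of_mem_maximalAtlas hφ').symm.mfderiv_injective hx.1
        ((h2.trans (map_zero _)).trans (map_zero _).symm)
    have h3 : Function.Injective (fderiv ℝ (φ ∘ φ'.symm) x) :=
      (injective_iff_map_eq_zero _).mpr h1
    exact ⟨(LinearEquiv.ofInjectiveEndo (fderiv ℝ (φ ∘ φ'.symm) x).toLinearMap
      h3).toContinuousLinearEquiv, by ext v; rfl⟩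
  pullback := fun x hx i j => by
    rw [h.dotG_inChart]
    have h4 : φ.symm ((φ ∘ φ'.symm) x) = φ'.symm x := φ.left_inv hx.2
    have h5 : ∀ p q : M, p = q → ∀ u v : E4, h.inner p u v = h.inner q u v := by
      rintro p _ rfl u v; rfl
    refine Eq.trans ?_ (h5 _ _ h4.symm _ _)
    rw [← mfderiv_symm_eq hφ hφ' hx, ← mfderiv_symm_eq hφ hφ' hx]
    rfl

omit [IsManifold (𝓡 4) ∞ M] in
lemma mem_planeInChart_iff (Z : ∀ p : M, Submodule ℝ (TangentSpace (𝓡 4) p)) {x : E4}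
    (hx : x ∈ overlap φ' φ) (v : E4) :
    v ∈ planeInChart Z φ' x ↔
      fderiv ℝ (φ ∘ φ'.symm) x v ∈ planeInChart Z φ ((φ ∘ φ'.symm) x) := by
  have h4 : φ.symm ((φ ∘ φ'.symm) x) = φ'.symm x := φ.left_inv hx.2
  have h5 : ∀ p q : M, p = q → ∀ u : E4, u ∈ Z p ↔ u ∈ Z q := by
    rintro p _ rfl u; rfl
  change (mfderiv (𝓡 4) (𝓡 4) φ'.symm x v : E4) ∈ Z (φ'.symm x) ↔
    (mfderiv (𝓡 4) (𝓡 4) φ.symm _ (fderiv ℝ (φ ∘ φ'.symm) x v) : E4) ∈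
      Z (φ.symm ((φ ∘ φ'.symm) x))
  refine Iff.trans ?_ (h5 _ _ h4.symm _)
  rw [← mfderiv_symm_eq hφ hφ' hx]
  exact Iff.rfl

omit hφ' in
/-- Composition of a chart with a local diffeomorphism of the model space is a chart. -/
lemma trans_mem_maximalAtlas {e : OpenPartialHomeomorph E4 E4} (he : ContDiffOn ℝ ∞ e e.source)
    (he' : ContDiffOn ℝ ∞ e.symm e.target) :
    φ.trans e ∈ IsManifold.maximalAtlas (𝓡 4) ∞ M := by
  refine (φ.trans e).mem_maximalAtlas_of_contMDiffOn ?_ ?_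
  · exact (contMDiffOn_iff_contDiffOn.mpr he).comp
      ((contMDiffOn_of_mem_maximalAtlas hφ).mono fun p hp => hp.1) fun p hp => hp.2
  · exact (contMDiffOn_symm_of_mem_maximalAtlas hφ).comp
      ((contMDiffOn_iff_contDiffOn.mpr he').mono fun p hp => hp.1) fun p hp => hp.2

end Charts

/-! ### Spinor fields in a spin frame -/

/-- The vector fields `o_A π` spanning the `α`-planes of `π`, where `o_A` is the unprimed spin
frame. -/
noncomputable def alphaVec (e : Tetrad) (p : PrimedSpinor) (A : Fin 2) (x : E4) : E4 :=
  ∑ A', p A' x • e A A' x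

lemma mem_alphaPlane_iff {e : Tetrad} {p : PrimedSpinor} {x v : E4} :
    v ∈ alphaPlane e p x ↔ ∃ c : Fin 2 → ℝ, v = ∑ A, c A • alphaVec e p A x := by
  simp only [alphaPlane, alphaVec, Submodule.mem_span_range_iff_exists_fun, eq_comm]

lemma contDiffOn_apply {X : E4 → E4} {U : Set E4} (hX : ContDiffOn ℝ ∞ X U) (i : Fin 4) :
    ContDiffOn ℝ ∞ (fun y => X y i) U :=
  (coordCLM i).contDiff.comp_contDiffOn hX

lemma contDiffOn_of_apply {X : E4 → E4} {U : Set E4}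
    (hX : ∀ i, ContDiffOn ℝ ∞ (fun y => X y i) U) : ContDiffOn ℝ ∞ X U :=
  contDiffOn_euclidean.mpr hX

lemma covVec_apply (G : MetricField) (k : Fin 4) (V : E4 → E4) (x : E4) (i : Fin 4) :
    covVec G k V x i = pd k (fun y => V y i) x + ∑ j, christoffel G i k j x * V x j := rfl

section DotLinear

variable (G : MetricField) (x : E4)

lemma dotG_add_left (u u' v : E4) : dotG G x (u + u') v = dotG G x u v + dotG G x u' v := by
  simp only [← metricForm_apply, map_add, _root_.add_apply]

lemma dotG_add_right (u v v' : E4) : dotG G x u (v + v') = dotG G x u v + dotG G x u v' := by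
  simp only [← metricForm_apply, map_add]

lemma dotG_smul_left (c : ℝ) (u v : E4) : dotG G x (c • u) v = c * dotG G x u v := by
  simp only [← metricForm_apply, map_smul, _root_.smul_apply, smul_eq_mul]

lemma dotG_smul_right (c : ℝ) (u v : E4) : dotG G x u (c • v) = c * dotG G x u v := by
  simp only [← metricForm_apply, map_smul, smul_eq_mul]

lemma dotG_neg_left (u v : E4) : dotG G x (-u) v = -dotG G x u v := by
  simp only [← metricForm_apply, map_neg, _root_.neg_apply]

lemma dotG_neg_right (u v : E4) : dotG G x u (-v) = -dotG G x u v := by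
  simp only [← metricForm_apply, map_neg]

lemma dotG_sub_right (u v v' : E4) : dotG G x u (v - v') = dotG G x u v - dotG G x u v' := by
  simp only [← metricForm_apply, map_sub]

lemma dotG_sub_left (u u' v : E4) : dotG G x (u - u') v = dotG G x u v - dotG G x u' v := by
  simp only [← metricForm_apply, map_sub, _root_.sub_apply]

lemma dotG_sum_left {ι : Type*} [Fintype ι] (u : ι → E4) (v : E4) :
    dotG G x (∑ i, u i) v = ∑ i, dotG G x (u i) v := by
  simp only [← metricForm_apply, map_sum, _root_.sum_apply]

lemma dotG_sum_right {ι : Type*} [Fintype ι] (u : E4) (v : ι → E4) :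
    dotG G x u (∑ i, v i) = ∑ i, dotG G x u (v i) := by
  simp only [← metricForm_apply, map_sum]

end DotLinear

namespace IsMetricOn

variable {G : MetricField} {U : Set E4} (hG : IsMetricOn G U) {x : E4}
include hG

/-- Metric compatibility of the Levi-Civita connection. -/
lemma pd_dotG (hx : x ∈ U) {X Y : E4 → E4} (hX : ∀ i, DifferentiableAt ℝ (fun y => X y i) x)
    (hY : ∀ i, DifferentiableAt ℝ (fun y => Y y i) x) (k : Fin 4) :
    pd k (fun y => dotG G y (X y) (Y y)) x =
      dotG G x (covVec G k X x) (Y x) + dotG G x (X x) (covVec G k Y x) := by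
  have hGd := fun i j => differentiableAt_of_contDiffOn (hG.smooth i j) hG.isOpen hx
  simp only [dotG]
  rw [pd_sum k _ fun i _ => DifferentiableAt.fun_sum fun j _ =>
    ((hGd i j).fun_mul (hX i)).fun_mul (hY j)]
  have h1 : ∀ i, pd k (fun y => ∑ j, G y i j * X y i * Y y j) x = ∑ j,
      ((pd k (fun y => G y i j) x * X x i + G x i j * pd k (fun y => X y i) x) * Y x j
        + G x i j * X x i * pd k (fun y => Y y j) x) := by
    intro i
    rw [pd_sum k _ fun j _ => ((hGd i j).fun_mul (hX i)).fun_mul (hY j)]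
    refine Finset.sum_congr rfl fun j _ => ?_
    rw [pd_mul k ((hGd i j).fun_mul (hX i)) (hY j), pd_mul k (hGd i j) (hX i)]
  simp only [h1, covVec_apply, hG.pd_metric hx]
  have h2 : ∑ i, ∑ j, (∑ l, G x i l * christoffel G l k j x) * X x i * Y x j =
      ∑ i, ∑ j, G x i j * X x i * ∑ l, christoffel G j k l x * Y x l := by
    refine Finset.sum_congr rfl fun i _ => ?_
    simp only [Finset.sum_mul, Finset.mul_sum]
    rw [Finset.sum_comm]
    exact Finset.sum_congr rfl fun j _ => Finset.sum_congr rfl fun l _ => by ring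
  have h3 : ∑ i, ∑ j, (∑ l, G x j l * christoffel G l k i x) * X x i * Y x j =
      ∑ i, ∑ j, G x i j * (∑ l, christoffel G i k l x * X x l) * Y x j := by
    simp only [Finset.sum_mul, Finset.mul_sum]
    rw [sum_rotate, Finset.sum_comm]
    refine Finset.sum_congr rfl fun i _ => Finset.sum_congr rfl fun j _ =>
      Finset.sum_congr rfl fun l _ => ?_
    rw [hG.symm x hx j i]; ring
  simp only [add_mul, mul_add, Finset.sum_add_distrib, h2, h3]
  ring

end IsMetricOn

lemma eps_apply : eps 0 0 = 0 ∧ eps 0 1 = 1 ∧ eps 1 0 = -1 ∧ eps 1 1 = 0 := by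
  simp [eps]

lemma covVec_alphaVec {G : MetricField} {e : Tetrad} {p : PrimedSpinor} {x : E4}
    (hp : ∀ A', DifferentiableAt ℝ (p A') x)
    (he : ∀ A A' i, DifferentiableAt ℝ (fun y => e A A' y i) x) (k : Fin 4) (A : Fin 2) :
    covVec G k (alphaVec e p A) x =
      ∑ A', (pd k (p A') x • e A A' x + p A' x • covVec G k (e A A') x) := by
  ext i
  have h1 : (fun y => alphaVec e p A y i) = fun y => ∑ A', p A' y * e A A' y i := by
    funext y; simp [alphaVec]
  rw [covVec_apply, h1, pd_sum k _ fun A' _ => (hp A').fun_mul (he A A' i)]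
  simp only [pd_mul k (hp _) (he A _ i)]
  simp [alphaVec, covVec_apply, Finset.sum_add_distrib, Finset.mul_sum, mul_add]
  ring

namespace IsSpinFrame

variable {G : MetricField} {U : Set E4} {e : Tetrad} (he : IsSpinFrame G U e) {x : E4}
include he

lemma dotG_alphaVec (hx : x ∈ U) (p : PrimedSpinor) (A B : Fin 2) :
    dotG G x (alphaVec e p A x) (alphaVec e p B x) = 0 := by
  obtain ⟨h00, h01, h10, h11⟩ := eps_apply
  simp only [alphaVec, dotG_add_left, dotG_add_right, dotG_smul_left, dotG_smul_right,
    he.metric x hx, Fin.sum_univ_two, h00, h01, h10, h11]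
  ring

/-- The `α`-planes are totally null. -/
lemma dotG_eq_zero_of_mem (hx : x ∈ U) {p : PrimedSpinor} {u v : E4}
    (hu : u ∈ alphaPlane e p x) (hv : v ∈ alphaPlane e p x) : dotG G x u v = 0 := by
  obtain ⟨c, rfl⟩ := mem_alphaPlane_iff.mp hu
  obtain ⟨d, rfl⟩ := mem_alphaPlane_iff.mp hv
  simp [dotG_add_left, dotG_add_right, dotG_smul_left, dotG_smul_right, he.dotG_alphaVec hx]

lemma linearIndependent_alphaVec (hx : x ∈ U) {p : PrimedSpinor} (hp : ∃ A', p A' x ≠ 0) :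
    LinearIndependent ℝ fun A => alphaVec e p A x := by
  obtain ⟨h00, h01, h10, h11⟩ := eps_apply
  rw [Fintype.linearIndependent_iff]
  intro c hc
  have h1 : ∀ B B', ∑ A, ∑ A', c A * (p A' x * (eps A B * eps A' B')) = 0 := by
    intro B B'
    have h2 : dotG G x (∑ A, c A • alphaVec e p A x) (e B B' x) = 0 := by
      rw [hc, ← metricForm_apply]; simp
    simpa only [alphaVec, dotG_sum_left, dotG_smul_left, he.metric x hx, Finset.mul_sum] using h2
  have h3 := h1 0 0
  have h4 := h1 0 1
  have h5 := h1 1 0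
  have h6 := h1 1 1
  simp only [Fin.sum_univ_two, h00, h01, h10, h11] at h3 h4 h5 h6
  obtain ⟨A', hA'⟩ := hp
  intro A
  fin_cases A <;> fin_cases A' <;> simp_all

variable (hG : IsMetricOn G U)
include hG

/-- The one-form `π_{B'} ∇_a π^{B'}` measures the derivative of the `α`-plane of `π`. -/
lemma sForm_eq (hx : x ∈ U) {p : PrimedSpinor} (hp : ∀ A', ContDiffOn ℝ ∞ (p A') U) (k : Fin 4) :
    sForm G e p k x = -dotG G x (covVec G k (alphaVec e p 0) x) (alphaVec e p 1 x) := by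
  obtain ⟨h00, h01, h10, h11⟩ := eps_apply
  have hpd := fun A' => differentiableAt_of_contDiffOn (hp A') hG.isOpen hx
  have hed := fun A A' i =>
    differentiableAt_of_contDiffOn (contDiffOn_apply (he.smooth A A') i) hG.isOpen hx
  -- the scalar products of the tetrad are constant
  have hanti : ∀ A' B', dotG G x (covVec G k (e 1 A') x) (e 0 B' x) =
      -dotG G x (covVec G k (e 0 B') x) (e 1 A' x) := by
    intro A' B'
    have h1 := hG.pd_dotG hx (hed 1 A') (hed 0 B') k
    have h2 : pd k (fun y => dotG G y (e 1 A' y) (e 0 B' y)) x = 0 := by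
      rw [pd_congr k (g := fun _ => eps 1 0 * eps A' B') (by
        filter_upwards [hG.isOpen.mem_nhds hx] with y hy using he.metric y hy _ _ _ _), pd_const]
    rw [h2, hG.dotG_symm hx (e 1 A' x)] at h1
    linarith
  rw [covVec_alphaVec hpd hed]
  simp only [sForm, covSpinor, primedConn, spinComp, alphaVec, dotG_add_right,
    dotG_smul_left, dotG_smul_right, dotG_add_left, he.metric x hx, Fin.sum_univ_two, h00, h01,
        h10, h11,
    hanti]
  ring

omit hG in
/-- In terms of the tensor `Φ_{ab}`, the contraction `Φ_{ABA'B'} π^{A'} π^{B'}` is the restriction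
of the Ricci tensor to the `α`-plane of `π`. -/
lemma forall_ricciSpinor_eq_zero_iff (hx : x ∈ U) (p : PrimedSpinor) :
    (∀ A B, ∑ A', ∑ B', ricciSpinor G e A B A' B' x * p A' x * p B' x = 0) ↔
      ∀ u ∈ alphaPlane e p x, ∀ v ∈ alphaPlane e p x, ricciForm G x u v = 0 := by
  have h1 : ∀ A B, ∑ A', ∑ B', ricciSpinor G e A B A' B' x * p A' x * p B' x =
      (1 / 2) * ricciForm G x (alphaVec e p A x) (alphaVec e p B x) := by
    intro A B
    have h2 : ∑ A', ∑ B', ricciSpinor G e A B A' B' x * p A' x * p B' x =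
        ∑ i, ∑ j, phiTensor G i j x * alphaVec e p A x i * alphaVec e p B x j := by
      simp only [ricciSpinor, alphaVec, Fin.sum_univ_two, Finset.sum_mul, PiLp.add_apply,
        PiLp.smul_apply, smul_eq_mul, ← Finset.sum_add_distrib]
      exact Finset.sum_congr rfl fun i _ => Finset.sum_congr rfl fun j _ => by ring
    have h3 : ∑ i, ∑ j, phiTensor G i j x * alphaVec e p A x i * alphaVec e p B x j =
        (1 / 2) * ricciForm G x (alphaVec e p A x) (alphaVec e p B x)
          - (scalarCurv G x / 8) * dotG G x (alphaVec e p A x) (alphaVec e p B x) := by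
      simp only [phiTensor, ricciForm, dotG, Finset.mul_sum, ← Finset.sum_sub_distrib]
      exact Finset.sum_congr rfl fun i _ => Finset.sum_congr rfl fun j _ => by ring
    rw [h2, h3, he.dotG_alphaVec hx]; ring
  constructor
  · intro h u hu v hv
    obtain ⟨c, rfl⟩ := mem_alphaPlane_iff.mp hu
    obtain ⟨d, rfl⟩ := mem_alphaPlane_iff.mp hv
    have h4 : ∀ A B, ricciForm G x (alphaVec e p A x) (alphaVec e p B x) = 0 := fun A B => by
      have := h A B
      rw [h1] at this
      linarith
    have h5 : ricciForm G x (∑ A, c A • alphaVec e p A x) (∑ A, d A • alphaVec e p A x) =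
        ∑ A, ∑ B, c A * d B * ricciForm G x (alphaVec e p A x) (alphaVec e p B x) := by
      simp only [ricciForm, Fin.sum_univ_two, PiLp.add_apply, PiLp.smul_apply, smul_eq_mul,
        Finset.mul_sum, ← Finset.sum_add_distrib]
      exact Finset.sum_congr rfl fun i _ => Finset.sum_congr rfl fun j _ => by ring
    rw [h5]
    simp [h4]
  · intro h A B
    rw [h1, h _ (mem_alphaPlane_iff.mpr ⟨Pi.single A 1, by simp [Pi.single_apply]⟩) _
      (mem_alphaPlane_iff.mpr ⟨Pi.single B 1, by simp [Pi.single_apply]⟩), mul_zero]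

end IsSpinFrame

/-! ### Spin frames adapted to a null distribution -/

/-- The vector fields `X 0`, `X 1` span a totally null distribution over `U` which is a graph over
the plane of the first two coordinates. -/
structure IsNullGraph (G : MetricField) (U : Set E4) (X : Fin 2 → E4 → E4) : Prop where
  smooth : ∀ i, ContDiffOn ℝ ∞ (X i) U
  coord_zero : ∀ x ∈ U, ∀ i, X i x 0 = if i = 0 then 1 else 0
  coord_one : ∀ x ∈ U, ∀ i, X i x 1 = if i = 1 then 1 else 0
  null : ∀ x ∈ U, ∀ i j, dotG G x (X i x) (X j x) = 0

/-- The coordinate vector fields transverse to a graph over the first two coordinates. -/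
noncomputable def transVec : Fin 2 → E4 := ![basisVec 2, basisVec 3]

/-- The pairing of a null graph with the transverse coordinate directions. -/
noncomputable def transPairing (G : MetricField) (X : Fin 2 → E4 → E4) (x : E4) :
    Matrix (Fin 2) (Fin 2) ℝ := Matrix.of fun i j => dotG G x (X i x) (transVec j)

namespace IsNullGraph

variable {G : MetricField} {U : Set E4} {X : Fin 2 → E4 → E4} (hX : IsNullGraph G U X)
  (hG : IsMetricOn G U) {x : E4}
include hX

lemma decompose (hx : x ∈ U) (u : E4) : ∃ c : Fin 2 → ℝ,
    u = u 0 • X 0 x + u 1 • X 1 x + ∑ j, c j • transVec j := by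
  refine ⟨![u 2 - u 0 * X 0 x 2 - u 1 * X 1 x 2, u 3 - u 0 * X 0 x 3 - u 1 * X 1 x 3], ?_⟩
  have h0 := hX.coord_zero x hx
  have h1 := hX.coord_one x hx
  ext k
  fin_cases k <;>
    simp [h0, h1, transVec, basisVec_apply, Fin.sum_univ_two]

include hG

/-- A totally null plane is its own orthogonal complement, so the transverse directions pair
nondegenerately with it. -/
lemma isUnit_det_transPairing (hx : x ∈ U) : IsUnit (transPairing G X x).det := by
  rw [isUnit_iff_ne_zero]
  intro hdet
  obtain ⟨r, hr0, hr⟩ := Matrix.exists_vecMul_eq_zero_iff.mpr hdet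
  have h1 : ∀ j, dotG G x (∑ i, r i • X i x) (transVec j) = 0 := fun j => by
    have := congrFun hr j
    simpa [Matrix.vecMul, dotProduct, transPairing, dotG_add_left, dotG_smul_left] using this
  have h2 : ∀ j, dotG G x (∑ i, r i • X i x) (X j x) = 0 := fun j => by
    simp [dotG_add_left, dotG_smul_left, hX.null x hx]
  have h3 : ∑ i, r i • X i x = 0 := hG.eq_zero_of_dotG hx fun u => by
    obtain ⟨c, hc⟩ := hX.decompose hx u
    rw [hc]
    simp [dotG_add_right, dotG_smul_right, h1, h2, -Fin.sum_univ_two, dotG_sum_right]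
  refine hr0 (funext fun i => ?_)
  have h4 := congrArg (fun w : E4 => w 0) h3
  have h5 := congrArg (fun w : E4 => w 1) h3
  simp [hX.coord_zero x hx, hX.coord_one x hx] at h4 h5
  fin_cases i
  · exact h4
  · exact h5

/-- A vector with vanishing first two coordinates that is orthogonal to a null graph is zero. -/
lemma eq_zero_of_orthogonal (hx : x ∈ U) {w : E4} (hw0 : w 0 = 0) (hw1 : w 1 = 0)
    (hw : ∀ i, dotG G x w (X i x) = 0) : w = 0 := by
  obtain ⟨c, hc⟩ := hX.decompose hx w
  rw [hw0, hw1, zero_smul, zero_smul, zero_add, zero_add] at hc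
  have h1 : transPairing G X x *ᵥ c = 0 := by
    funext i
    have h2 := hw i
    rw [hG.dotG_symm hx, hc, dotG_sum_right] at h2
    simp only [dotG_smul_right] at h2
    rw [Pi.zero_apply, ← h2]
    simp only [Matrix.mulVec, dotProduct, transPairing, Matrix.of_apply, mul_comm]
  have h3 : c = 0 := by
    have h4 := congrArg (fun v => (transPairing G X x)⁻¹ *ᵥ v) h1
    beta_reduce at h4
    rwa [Matrix.mulVec_mulVec, Matrix.nonsing_inv_mul _ (hX.isUnit_det_transPairing hG hx),
      Matrix.one_mulVec, Matrix.mulVec_zero] at h4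
  rw [hc, h3]; simp

/-- A null graph is the distribution of the vectors `o_A o_{A'}` of a tetrad of spin frames. -/
theorem exists_isSpinFrame : ∃ e : Tetrad, IsSpinFrame G U e ∧ ∀ A, e A 0 = X A := by
  -- transverse vector fields dual to `X`
  set mi : E4 → Matrix (Fin 2) (Fin 2) ℝ := fun x => (transPairing G X x)⁻¹ with hmi
  set Y' : Fin 2 → E4 → E4 := fun j x => ∑ k, mi x k j • transVec k with hY'
  -- subtracting half of the scalar products makes the dual vectors null
  set Y : Fin 2 → E4 → E4 := fun j x =>
    Y' j x - ∑ i, ((1 / 2) * dotG G x (Y' i x) (Y' j x)) • X i x with hY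
  have hdotG : ∀ {V W : E4 → E4}, ContDiffOn ℝ ∞ V U → ContDiffOn ℝ ∞ W U →
      ContDiffOn ℝ ∞ (fun x => dotG G x (V x) (W x)) U := fun hV hW =>
    ContDiffOn.sum fun i _ => ContDiffOn.sum fun j _ =>
      ((hG.smooth i j).mul (contDiffOn_apply hV i)).mul (contDiffOn_apply hW j)
  have hmis : ∀ i j, ContDiffOn ℝ ∞ (fun x => mi x i j) U :=
    contDiffOn_inv_apply (fun i j => hdotG (hX.smooth i) contDiffOn_const)
      fun x hx => hX.isUnit_det_transPairing hG hx
  have hY's : ∀ j, ContDiffOn ℝ ∞ (Y' j) U := fun j =>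
    ContDiffOn.sum fun k _ => (hmis k j).smul contDiffOn_const
  have hYs : ∀ j, ContDiffOn ℝ ∞ (Y j) U := fun j => (hY's j).sub <|
    ContDiffOn.sum fun i _ => (contDiffOn_const.mul (hdotG (hY's i) (hY's j))).smul (hX.smooth i)
  have hXY' : ∀ x ∈ U, ∀ i j, dotG G x (X i x) (Y' j x) = if i = j then 1 else 0 := by
    intro x hx i j
    have h1 : (transPairing G X x * mi x) i j = (1 : Matrix (Fin 2) (Fin 2) ℝ) i j := by
      rw [Matrix.mul_nonsing_inv _ (hX.isUnit_det_transPairing hG hx)]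
    rw [Matrix.mul_apply, Matrix.one_apply] at h1
    rw [← h1]
    simp only [hY', dotG_sum_right, dotG_smul_right]
    exact Finset.sum_congr rfl fun k _ => mul_comm _ _
  have hXY : ∀ x ∈ U, ∀ i j, dotG G x (X i x) (Y j x) = if i = j then 1 else 0 := by
    intro x hx i j
    simp only [hY, dotG_sub_right, dotG_sum_right, dotG_smul_right, hX.null x hx, hXY' x hx]
    simp
  have hYY : ∀ x ∈ U, ∀ i j, dotG G x (Y i x) (Y j x) = 0 := by
    intro x hx i j
    have h1 : dotG G x (Y i x) (Y' j x) = (1 / 2) * dotG G x (Y' i x) (Y' j x) := by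
      simp only [hY, dotG_sub_left, dotG_sum_left, dotG_smul_left, hXY' x hx]
      simp only [mul_ite, mul_one, mul_zero, Finset.sum_ite_eq', Finset.mem_univ, if_true]
      rw [hG.dotG_symm hx (Y' j x) (Y' i x)]
      ring
    have h2 : ∀ k, dotG G x (Y i x) (X k x) = if k = i then 1 else 0 := fun k => by
      rw [hG.dotG_symm hx, hXY x hx]
    have h3 : dotG G x (Y i x) (Y j x) = dotG G x (Y i x) (Y' j x) -
        ∑ k, ((1 / 2) * dotG G x (Y' k x) (Y' j x)) * dotG G x (Y i x) (X k x) := by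
      conv_lhs => rw [hY]
      simp only [dotG_sub_right, dotG_sum_right, dotG_smul_right]
      rfl
    rw [h3, h1]
    simp [h2]
  have hYX : ∀ x ∈ U, ∀ i j, dotG G x (Y i x) (X j x) = if j = i then 1 else 0 :=
    fun x hx i j => by rw [hG.dotG_symm hx, hXY x hx]
  refine ⟨![![X 0, fun x => -Y 1 x], ![X 1, Y 0]], ⟨?_, ?_⟩, ?_⟩
  · intro A A'
    fin_cases A <;> fin_cases A'
    · exact hX.smooth 0
    · exact (hYs 1).neg
    · exact hX.smooth 1
    · exact hYs 0
  · intro x hx A A' B B'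
    obtain ⟨h00, h01, h10, h11⟩ := eps_apply
    fin_cases A <;> fin_cases A' <;> fin_cases B <;> fin_cases B' <;>
      simp [h00, h01, h10, h11, hX.null x hx, hXY x hx, hYX x hx, hYY x hx, dotG_neg_left,
        dotG_neg_right]
  · intro A
    fin_cases A <;> rfl

end IsNullGraph

section

variable {M : Type*} [TopologicalSpace M] [ChartedSpace (EuclideanSpace ℝ (Fin 4)) M]
  [IsManifold (𝓡 4) ∞ M] {h : NeutralMetric M}

/-- In a chart in which the `α`-planes form a null graph there is a local scaled representative
whose tetrad is adapted to the given vector fields. -/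
theorem exists_adapted_lsr {Z : ∀ p : M, Submodule ℝ (TangentSpace (𝓡 4) p)}
    {φ : OpenPartialHomeomorph M E4} (hφ : φ ∈ IsManifold.maximalAtlas (𝓡 4) ∞ M)
    {X : Fin 2 → E4 → E4} (hX : IsNullGraph (h.inChart φ) φ.target X)
    (hZ : ∀ x ∈ φ.target, planeInChart Z φ x = Submodule.span ℝ (range fun A => X A x)) :
    ∃ c : LSR h Z, c.chart = φ ∧ (∀ A, c.frame A 0 = X A) ∧
        c.spinor = ![fun _ => 1, fun _ => 0] := by
  obtain ⟨e, he, heX⟩ := hX.exists_isSpinFrame (h.isMetricOn_inChart hφ)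
  refine ⟨⟨φ, hφ, e, he, ![fun _ => 1, fun _ => 0], ⟨?_, ?_, ?_⟩⟩, rfl, heX, rfl⟩
  · intro A'
    fin_cases A'
    · exact contDiffOn_const
    · exact contDiffOn_const
  · exact fun x _ => ⟨0, by simp⟩
  · intro x hx
    rw [hZ x hx, alphaPlane]
    congr 2
    funext A
    simp [heX]

end

/-! ### Involutivity and the Weyl condition in components -/

lemma IsNullGraph.pd_coord_eq_zero {G : MetricField} {U : Set E4} {X : Fin 2 → E4 → E4}
    (hX : IsNullGraph G U X) (hU : IsOpen U) {x : E4} (hx : x ∈ U) (k : Fin 4) (i : Fin 2) :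
    pd k (fun y => X i y 0) x = 0 ∧ pd k (fun y => X i y 1) x = 0 := by
  constructor
  · exact pd_eq_zero_of_isOpen hU hx (fun y hy => hX.coord_zero y hy i) k
  · exact pd_eq_zero_of_isOpen hU hx (fun y hy => hX.coord_one y hy i) k

/-- The spinor field equation `π_{B'} π^{A'} ∇_{AA'} π^{B'} = 0` makes the distribution of
`α`-planes involutive; for a graph over a coordinate plane the spanning fields then commute. -/
theorem IsNullGraph.bracket_eq_zero {G : MetricField} {U : Set E4} {X : Fin 2 → E4 → E4}
    (hX : IsNullGraph G U X) (hG : IsMetricOn G U) {e : Tetrad} (he : IsSpinFrame G U e)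
    (heX : ∀ A, e A 0 = X A) {x : E4} (hx : x ∈ U)
    (hint : ∀ A, integrabilitySpinor G e ![fun _ => 1, fun _ => 0] A x = 0) (i : Fin 4) :
    ∑ k, X 0 x k * pd k (fun y => X 1 y i) x = ∑ k, X 1 x k * pd k (fun y => X 0 y i) x := by
  have hα : ∀ A, alphaVec e ![fun _ => 1, fun _ => 0] A = X A := fun A => by
    funext y
    simp [alphaVec, heX]
  have hXd := fun A i => differentiableAt_of_contDiffOn (contDiffOn_apply (hX.smooth A) i)
    hG.isOpen hx
  set D : Fin 4 → Fin 2 → Fin 2 → ℝ := fun k i j => dotG G x (covVec G k (X i) x) (X j x) with hD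
  have hanti : ∀ k i j, D k i j = -D k j i := by
    intro k i j
    have h1 := hG.pd_dotG hx (hXd i) (hXd j) k
    rw [pd_eq_zero_of_isOpen hG.isOpen hx (fun y hy => hX.null y hy i j),
      hG.dotG_symm hx (X i x)] at h1
    simp only [hD]
    linarith
  -- the spinor equation says that `g(∇_{X_a} X_0, X_1) = 0`
  have h01 : ∀ a, ∑ k, X a x k * D k 0 1 = 0 := by
    intro a
    have h1 := hint a
    have hs : ∀ k, sForm G e ![fun _ => 1, fun _ => 0] k x = -D k 0 1 := fun k => by
      rw [he.sForm_eq hG hx (fun A' => by fin_cases A' <;> exact contDiffOn_const) k, hα, hα]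
    simp only [integrabilitySpinor, hs, heX, Fin.sum_univ_two, cons_val_zero, cons_val_one,
        one_mul, zero_mul,
      add_zero, mul_neg, Finset.sum_neg_distrib, neg_eq_zero] at h1
    exact h1
  have hall : ∀ a i j, ∑ k, X a x k * D k i j = 0 := by
    intro a i j
    have hdiag : ∀ k i, D k i i = 0 := fun k i => by have := hanti k i i; linarith
    fin_cases i <;> fin_cases j
    · simp [hdiag]
    · exact h01 a
    · have : ∀ k, D k 1 0 = -D k 0 1 := fun k => hanti k 1 0
      simpa [this, Finset.sum_neg_distrib] using h01 a
    · simp [hdiag]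
  -- `w` is the commutator `[X_0, X_1]`, the connection being torsion free
  set w : E4 := ∑ k, X 0 x k • covVec G k (X 1) x - ∑ k, X 1 x k • covVec G k (X 0) x with hw
  have hwi : ∀ i, w i = ∑ k, X 0 x k * pd k (fun y => X 1 y i) x -
      ∑ k, X 1 x k * pd k (fun y => X 0 y i) x := by
    intro i
    have h1 : ∑ k, X 0 x k * ∑ j, christoffel G i k j x * X 1 x j =
        ∑ k, X 1 x k * ∑ j, christoffel G i k j x * X 0 x j := by
      simp only [Finset.mul_sum]
      rw [Finset.sum_comm]
      refine Finset.sum_congr rfl fun k _ => Finset.sum_congr rfl fun j _ => ?_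
      rw [hG.christoffel_symm hx i j k]; ring
    simp only [hw, PiLp.sub_apply, WithLp.ofLp_sum, Finset.sum_apply, PiLp.smul_apply, smul_eq_mul,
        covVec_apply,
      mul_add, Finset.sum_add_distrib, h1]
    ring
  have hw0 : w = 0 := by
    refine hX.eq_zero_of_orthogonal hG hx ?_ ?_ fun j => ?_
    · rw [hwi]; simp [(hX.pd_coord_eq_zero hG.isOpen hx _ _).1]
    · rw [hwi]; simp [(hX.pd_coord_eq_zero hG.isOpen hx _ _).2]
    · simp only [hw, dotG_sub_left, dotG_sum_left, dotG_smul_left]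
      exact sub_eq_zero.mpr ((hall 0 1 j).trans (hall 1 0 j).symm)
  have h2 := hwi i
  rw [hw0] at h2
  exact (sub_eq_zero.mp h2.symm)

/-- The plane of the first two coordinate directions is totally null for `G` over `U`. -/
def IsLeafNull (G : MetricField) (U : Set E4) : Prop :=
  ∀ x ∈ U, ∀ i j : Fin 4, i < 2 → j < 2 → G x i j = 0

/-- The determinant of the off-diagonal block of a metric with null leaves. -/
def blockDet (G : MetricField) (x : E4) : ℝ := G x 0 2 * G x 1 3 - G x 0 3 * G x 1 2

/-- The trace of the connection induced on the leaves of the first two coordinates. -/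
noncomputable def leafTrace (G : MetricField) (k : Fin 4) (x : E4) : ℝ :=
  christoffel G 0 k 0 x + christoffel G 1 k 1 x

namespace IsLeafNull

variable {G : MetricField} {U : Set E4} (hN : IsLeafNull G U) (hG : IsMetricOn G U) {x : E4}
include hN hG

lemma blockDet_ne_zero (hx : x ∈ U) : blockDet G x ≠ 0 := by
  intro h0
  have h1 := hG.isUnit_det x hx
  have hs := hG.symm x hx
  have hn := hN x hx
  rw [isUnit_iff_ne_zero] at h1
  refine h1 ?_
  have : (G x).det = blockDet G x ^ 2 := by
    rw [Matrix.det_succ_row_zero]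
    simp [Fin.sum_univ_four, Matrix.det_fin_three, Fin.succAbove, hn, blockDet, hs 2 0, hs 2 1,
        hs 3 0,
      hs 3 1]
    ring
  rw [this, h0]; ring

lemma pd_eq_zero (hx : x ∈ U) (k : Fin 4) {i j : Fin 4} (hi : i < 2) (hj : j < 2) :
    pd k (fun y => G y i j) x = 0 :=
  pd_eq_zero_of_isOpen hG.isOpen hx (fun y hy => hN y hy i j hi hj) k

/-- Null leaves of a torsion-free metric connection are totally geodesic. -/
lemma christoffel_leaf (hx : x ∈ U) {i j : Fin 4} (hi : i < 2) (hj : j < 2) :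
    christoffel G 2 i j x = 0 ∧ christoffel G 3 i j x = 0 := by
  have h0 := hG.lower_christoffel hx 0 i j
  have h1 := hG.lower_christoffel hx 1 i j
  have h00 := hN x hx 0 0 (by decide) (by decide)
  have h01 := hN x hx 0 1 (by decide) (by decide)
  have h10 := hN x hx 1 0 (by decide) (by decide)
  have h11 := hN x hx 1 1 (by decide) (by decide)
  rw [Fin.sum_univ_four, hN.pd_eq_zero hG hx _ hi hj, hN.pd_eq_zero hG hx _ hi (by decide),
    hN.pd_eq_zero hG hx _ hj (by decide)] at h0 h1
  rw [h00, h01] at h0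
  rw [h10, h11] at h1
  have hD := hN.blockDet_ne_zero hG hx
  constructor
  · refine (mul_eq_zero.mp ?_).resolve_left hD
    simp only [blockDet]
    linear_combination G x 1 3 * h0 - G x 0 3 * h1
  · refine (mul_eq_zero.mp ?_).resolve_left hD
    simp only [blockDet]
    linear_combination G x 0 2 * h1 - G x 1 2 * h0

/-- The Christoffel symbols along the leaves, which are determined by the off-diagonal block. -/
lemma leaf_christoffel_eq (hx : x ∈ U) (a : Fin 4) {i j : Fin 4} (hi : i < 2) (hj : j < 2) :
    G x 0 a * christoffel G 0 i j x + G x 1 a * christoffel G 1 i j x =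
      (1 / 2) * (pd i (fun y => G y j a) x + pd j (fun y => G y i a) x) := by
  have h0 := hG.lower_christoffel hx a i j
  obtain ⟨h2, h3⟩ := hN.christoffel_leaf hG hx hi hj
  rw [Fin.sum_univ_four, h2, h3, hN.pd_eq_zero hG hx _ hi hj, hG.symm x hx a 0,
    hG.symm x hx a 1] at h0
  linear_combination h0

/-- The trace of the leaf connection measures the failure of the one-forms `G_{k2}`, `G_{k3}`
(`k = 0, 1`) to be closed along the leaves. -/
lemma blockDet_mul_leafTrace (hx : x ∈ U) {k : Fin 4} (hk : k < 2) :
    blockDet G x * leafTrace G k x = pd k (blockDet G) x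
      - (1 / 2) * (G x k 2 * (pd 0 (fun y => G y 1 3) x - pd 1 (fun y => G y 0 3) x)
        - G x k 3 * (pd 0 (fun y => G y 1 2) x - pd 1 (fun y => G y 0 2) x)) := by
  have hd := fun i j => differentiableAt_of_contDiffOn (hG.smooth i j) hG.isOpen hx
  have h1 : pd k (blockDet G) x = pd k (fun y => G y 0 2) x * G x 1 3
      + G x 0 2 * pd k (fun y => G y 1 3) x - (pd k (fun y => G y 0 3) x * G x 1 2
      + G x 0 3 * pd k (fun y => G y 1 2) x) := by
    unfold blockDet
    rw [pd_sub k ((hd _ _).fun_mul (hd _ _)) ((hd _ _).fun_mul (hd _ _)),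
        pd_mul k (hd _ _) (hd _ _),
      pd_mul k (hd _ _) (hd _ _)]
  have e2 := fun i j hi hj => hN.leaf_christoffel_eq hG hx 2 (i := i) (j := j) hi hj
  have e3 := fun i j hi hj => hN.leaf_christoffel_eq hG hx 3 (i := i) (j := j) hi hj
  rw [h1, leafTrace, blockDet]
  have hk' := eq_zero_or_eq_one_of_lt_two hk
  have hc := hG.christoffel_symm hx
  rcases hk' with rfl | rfl
  · linear_combination G x 1 3 * e2 0 0 hk hk - G x 1 2 * e3 0 0 hk hk +
      G x 0 2 * e3 0 1 hk (by decide) - G x 0 3 * e2 0 1 hk (by decide)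
  · linear_combination G x 1 3 * e2 1 0 hk (by decide) - G x 1 2 * e3 1 0 hk (by decide) +
      G x 0 2 * e3 1 1 hk hk - G x 0 3 * e2 1 1 hk hk

/-- The trace of the leafwise curvature is the exterior derivative of `leafTrace`. -/
lemma riemann_leaf_trace (hx : x ∈ U) :
    riemann G 0 0 0 1 x + riemann G 1 1 0 1 x
        = pd 0 (leafTrace G 1) x - pd 1 (leafTrace G 0) x := by
  have hd := fun k i j => differentiableAt_of_contDiffOn
      (hG.contDiffOn_christoffel k i j) hG.isOpen hx
  unfold leafTrace riemann
  rw [pd_add _ (hd _ _ _) (hd _ _ _), pd_add _ (hd _ _ _) (hd _ _ _)]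
  simp only [Fin.sum_univ_four]
  have h : ∀ i j : Fin 4, i < 2 → j < 2 →
    christoffel G 2 i j x = 0 ∧ christoffel G 3 i j x = 0 := fun i j hi hj =>
      hN.christoffel_leaf hG hx hi hj
  rw [(h 1 0 (by decide) (by decide)).1, (h 1 0 (by decide) (by decide)).2,
    (h 0 0 (by decide) (by decide)).1, (h 0 0 (by decide) (by decide)).2,
    (h 1 1 (by decide) (by decide)).1, (h 1 1 (by decide) (by decide)).2,
    (h 0 1 (by decide) (by decide)).1, (h 0 1 (by decide) (by decide)).2]
  ring

/-- The curvature of the leaves maps tangent vectors to tangent vectors. -/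
lemma riemann_leaf (hx : x ∈ U) {k : Fin 4} (hk : k < 2) :
    riemann G 2 k 0 1 x = 0 ∧ riemann G 3 k 0 1 x = 0 := by
  have h : ∀ i j : Fin 4, i < 2 → j < 2 →
    christoffel G 2 i j x = 0 ∧ christoffel G 3 i j x = 0 := fun i j hi hj =>
      hN.christoffel_leaf hG hx hi hj
  have hz : ∀ c i j : Fin 4, i < 2 → j < 2 → pd c (christoffel G 2 i j) x = 0 ∧
      pd c (christoffel G 3 i j) x = 0 := by
    intro c i j hi hj
    constructor
    · exact pd_eq_zero_of_isOpen hG.isOpen hx (fun y hy => (hN.christoffel_leaf hG hy hi hj).1) c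
    · exact pd_eq_zero_of_isOpen hG.isOpen hx (fun y hy => (hN.christoffel_leaf hG hy hi hj).2) c
  have d0 : (0 : Fin 4) < 2 := by decide
  have d1 : (1 : Fin 4) < 2 := by decide
  simp only [riemann, Fin.sum_univ_four, (hz _ _ _ d0 hk).1, (hz _ _ _ d1 hk).1, (hz _ _ _ d0 hk).2,
    (hz _ _ _ d1 hk).2, (h _ _ d0 hk).1, (h _ _ d0 hk).2, (h _ _ d1 hk).1, (h _ _ d1 hk).2,
    (h _ _ d0 d0).1, (h _ _ d0 d0).2, (h _ _ d1 d1).1, (h _ _ d1 d1).2, (h _ _ d0 d1).1,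
    (h _ _ d0 d1).2, (h _ _ d1 d0).1, (h _ _ d1 d0).2]
  simp

/-- If the coordinate leaves are `α`-surfaces and the primed Weyl spinor satisfies
`Ψ̃_{A'B'C'D'} π^{A'} π^{B'} π^{C'} = 0`, the trace of the leaf connection is closed along
the leaves. -/
theorem pd_leafTrace_comm {e : Tetrad} (he : IsSpinFrame G U e)
    (h0 : ∀ x ∈ U, e 0 0 x = basisVec 0) (h1 : ∀ x ∈ U, e 1 0 x = basisVec 1) (hx : x ∈ U)
    (hW : weylSpinor G e 0 0 0 1 x = 0) :
    pd 0 (leafTrace G 1) x = pd 1 (leafTrace G 0) x := by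
  obtain ⟨e00, e01, e10, e11⟩ := eps_apply
  have g00 := hN x hx 0 0 (by decide) (by decide)
  have g01 := hN x hx 0 1 (by decide) (by decide)
  have g10 := hN x hx 1 0 (by decide) (by decide)
  have g11 := hN x hx 1 1 (by decide) (by decide)
  set m := e 1 1 x with hm
  set n := e 0 1 x with hn
  have f : ∀ (A B : Fin 2), dotG G x (e A 0 x) (e B 1 x) = eps A B := fun A B => by
    rw [he.metric x hx, e01, mul_one]
  have f0m : ∑ d, G x 0 d * m d = 1 := by
    have := f 0 1
    rw [h0 x hx, e01] at this
    rw [← this]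
    simp only [dotG, basisVec_apply]; simp
    rfl
  have f1m : ∑ d, G x 1 d * m d = 0 := by
    have := f 1 1
    rw [h1 x hx, e11] at this
    rw [← this]
    simp only [dotG, basisVec_apply]; simp
    rfl
  have f0n : ∑ d, G x 0 d * n d = 0 := by
    have := f 0 0
    rw [h0 x hx, e00] at this
    rw [← this]
    simp only [dotG, basisVec_apply]; simp
    rfl
  have f1n : ∑ d, G x 1 d * n d = -1 := by
    have := f 1 0
    rw [h1 x hx, e10] at this
    rw [← this]
    simp only [dotG, basisVec_apply]; simp
    rfl
  -- only two Weyl components survive, paired with the transverse vectors `m` and `n`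
  have k1 : weylSpinor G e 0 0 0 1 x = (1 / 4) *
      (∑ d, (weyl G 0 1 0 d x - weyl G 1 0 0 d x) * m d
        - ∑ d, (weyl G 0 1 1 d x - weyl G 1 0 1 d x) * n d) := by
    simp only [weylSpinor, Fin.sum_univ_two, e00, e01, e10, e11, h0 x hx, h1 x hx, basisVec_apply,
      zero_mul, zero_add, add_zero, mul_zero, one_mul, mul_one]
    simp [Fin.sum_univ_four, ← hm, ← hn]
    ring
  have ha : ∀ c d, riemannLower G 1 0 c d x = -riemannLower G 0 1 c d x := fun c d =>
    hG.riemannLower_antisymm hx 1 0 c d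
  have r := hG.ricci_symm hx 1 0
  -- the Ricci terms of the two components are equal and cancel in the difference
  have k2 : ∑ d, (weyl G 0 1 0 d x - weyl G 1 0 0 d x) * m d =
      2 * ∑ d, riemannLower G 0 1 0 d x * m d + ricci G 0 1 x := by
    have : ∀ d, (weyl G 0 1 0 d x - weyl G 1 0 0 d x) * m d =
        2 * (riemannLower G 0 1 0 d x * m d) + ricci G 0 1 x * (G x 0 d * m d)
        - ricci G 0 0 x * (G x 1 d * m d) := fun d => by
      simp only [weyl, ha, g00, g10, r]; ring
    simp only [this, Finset.sum_add_distrib, Finset.sum_sub_distrib, ← Finset.mul_sum, f0m, f1m]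
    ring
  have k3 : ∑ d, (weyl G 0 1 1 d x - weyl G 1 0 1 d x) * n d =
      2 * ∑ d, riemannLower G 0 1 1 d x * n d + ricci G 0 1 x := by
    have : ∀ d, (weyl G 0 1 1 d x - weyl G 1 0 1 d x) * n d =
        2 * (riemannLower G 0 1 1 d x * n d) + ricci G 1 1 x * (G x 0 d * n d)
        - ricci G 0 1 x * (G x 1 d * n d) := fun d => by
      simp only [weyl, ha, g11, g01]; ring
    simp only [this, Finset.sum_add_distrib, Finset.sum_sub_distrib, ← Finset.mul_sum, f0n, f1n]
    ring
  have hlow : ∀ (b : Fin 4) (w : E4), b < 2 → ∑ d, riemannLower G 0 1 b d x * w d =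
      -(riemann G 0 b 0 1 x * (∑ d, G x 0 d * w d) + riemann G 1 b 0 1 x * ∑ d, G x 1 d * w d) := by
    intro b w hb
    obtain ⟨z2, z3⟩ := hN.riemann_leaf hG hx hb
    have : ∀ d, riemannLower G 0 1 b d x * w d =
        -(riemann G 0 b 0 1 x * (G x 0 d * w d) + riemann G 1 b 0 1 x * (G x 1 d * w d)) := by
      intro d
      rw [hG.riemannLower_pair hx, hG.riemannLower_antisymm hx, riemannLower, Fin.sum_univ_four,
          z2, z3,
        hG.symm x hx d 0, hG.symm x hx d 1]
      ring
    simp only [this, Finset.sum_neg_distrib, Finset.sum_add_distrib, ← Finset.mul_sum]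
  rw [k1, k2, k3, hlow 0 m (by decide), hlow 1 n (by decide), f0m, f1m, f0n, f1n] at hW
  have h2 := hN.riemann_leaf_trace hG hx
  linarith

end IsLeafNull

/-! ### The Ricci condition in a chart -/

section RicciPrincipal

variable {M : Type*} [TopologicalSpace M] [ChartedSpace (EuclideanSpace ℝ (Fin 4)) M]
  [IsManifold (𝓡 4) ∞ M] {h : NeutralMetric M} (π : ProjectiveSpinorField h)

/-- The Ricci principal spinor condition says that the Ricci tensor, computed in any chart,
vanishes on the `α`-planes. -/
theorem isRPSOn_source_iff {φ : OpenPartialHomeomorph M E4}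
    (hφ : φ ∈ IsManifold.maximalAtlas (𝓡 4) ∞ M) :
    π.IsRPSOn φ.source ↔ ∀ x ∈ φ.target, ∀ u ∈ planeInChart π.plane φ x,
      ∀ v ∈ planeInChart π.plane φ x, ricciForm (h.inChart φ) x u v = 0 := by
  constructor
  · intro hR x hx u hu v hv
    obtain ⟨c, hc⟩ := π.exists_lsr (φ.symm x)
    have ho : x ∈ overlap φ c.chart := ⟨hx, hc⟩
    have hy : (c.chart ∘ φ.symm) x ∈ c.chart.target := c.chart.map_source hc
    have hback : c.chart.symm ((c.chart ∘ φ.symm) x) = φ.symm x := c.chart.left_inv hc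
    have h1 := (c.isSpinFrame.forall_ricciSpinor_eq_zero_iff hy c.spinor).mp
      (hR c _ hy (by rw [hback]; exact φ.map_target hx))
    rw [(isPullback_inChart c.mem_atlas hφ h).ricciForm_eq
      ((h.isMetricOn_inChart hφ).mono (isOpen_overlap _ _) inter_subset_left)
      (h.isMetricOn_inChart c.mem_atlas) ho]
    rw [← c.isScaledRep.plane _ hy] at h1
    exact h1 _ ((mem_planeInChart_iff c.mem_atlas hφ π.plane ho u).mp hu) _
      ((mem_planeInChart_iff c.mem_atlas hφ π.plane ho v).mp hv)
  · intro hR c x hx hxφ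
    have ho : x ∈ overlap c.chart φ := ⟨hx, hxφ⟩
    refine (c.isSpinFrame.forall_ricciSpinor_eq_zero_iff hx c.spinor).mpr fun u hu v hv => ?_
    rw [← c.isScaledRep.plane _ hx] at hu hv
    rw [(isPullback_inChart hφ c.mem_atlas h).ricciForm_eq
      ((h.isMetricOn_inChart c.mem_atlas).mono (isOpen_overlap _ _) inter_subset_left)
      (h.isMetricOn_inChart hφ) ho]
    exact hR _ (φ.map_source hxφ) _ ((mem_planeInChart_iff hφ c.mem_atlas π.plane ho u).mp hu) _
      ((mem_planeInChart_iff hφ c.mem_atlas π.plane ho v).mp hv)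

/-- The Ricci tensor restricted to the leaf directions vanishes when its components do. -/
lemma forall_ricciForm_eq_zero_iff (G : MetricField) (x : E4) :
    (∀ u ∈ Submodule.span ℝ {basisVec 0, basisVec 1},
      ∀ v ∈ Submodule.span ℝ {basisVec 0, basisVec 1}, ricciForm G x u v = 0) ↔
      ∀ b d : Fin 4, b < 2 → d < 2 → ricci G b d x = 0 := by
  constructor
  · intro hR b d hb hd
    have hmem : ∀ b : Fin 4, b < 2 → basisVec b ∈ Submodule.span ℝ {basisVec 0, basisVec 1} := by
      intro b hb
      refine Submodule.subset_span ?_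
      rcases eq_zero_or_eq_one_of_lt_two hb with rfl | rfl <;> simp
    have := hR _ (hmem b hb) _ (hmem d hd)
    simpa [ricciForm, basisVec_apply] using this
  · intro hR u hu v hv
    obtain ⟨a, b, rfl⟩ := Submodule.mem_span_pair.mp hu
    obtain ⟨c, d, rfl⟩ := Submodule.mem_span_pair.mp hv
    have h00 := hR 0 0 (by decide) (by decide)
    have h01 := hR 0 1 (by decide) (by decide)
    have h10 := hR 1 0 (by decide) (by decide)
    have h11 := hR 1 1 (by decide) (by decide)
    simp [ricciForm, basisVec_apply, Fin.sum_univ_four, h00, h01, h10, h11]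

end RicciPrincipal

/-! ### The Ricci tensor of a conformal Walker metric along the leaves -/

/-- In the first two (leaf) indices and their pairing with the last two, `G` is `w⁻²` times
Walker's form. -/
structure IsConformalWalkerForm (G : MetricField) (w : E4 → ℝ) (U : Set E4) : Prop where
  isMetricOn : IsMetricOn G U
  leafNull : IsLeafNull G U
  smooth : ContDiffOn ℝ ∞ w U
  pos : ∀ x ∈ U, 0 < w x
  eq_02 : ∀ x ∈ U, G x 0 2 = (w x ^ 2)⁻¹
  eq_13 : ∀ x ∈ U, G x 1 3 = (w x ^ 2)⁻¹
  eq_03 : ∀ x ∈ U, G x 0 3 = 0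
  eq_12 : ∀ x ∈ U, G x 1 2 = 0

namespace IsConformalWalkerForm

variable {G : MetricField} {w : E4 → ℝ} {U : Set E4} (hW : IsConformalWalkerForm G w U) {x : E4}
include hW

lemma pd_eq_zero {f : E4 → ℝ} (hf : ∀ y ∈ U, f y = 0) (hx : x ∈ U) (k : Fin 4) : pd k f x = 0 :=
  pd_eq_zero_of_isOpen hW.isMetricOn.isOpen hx hf k

/-- The derivative of the conformal factor `w⁻²`. -/
lemma pd_eq {f : E4 → ℝ} (hf : ∀ y ∈ U, f y = (w y ^ 2)⁻¹) (hx : x ∈ U) (k : Fin 4) :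
    pd k f x = -2 * (w x ^ 2)⁻¹ * (pd k w x / w x) := by
  have hw := (hW.pos x hx).ne'
  have h1 : HasDerivAt (fun t : ℝ => (t ^ 2)⁻¹) (-(2 * w x) / (w x ^ 2) ^ 2) (w x) := by
    simpa using (hasDerivAt_pow 2 (w x)).fun_inv (pow_ne_zero 2 hw)
  rw [pd_congr_of_isOpen hW.isMetricOn.isOpen hx hf,
    pd_comp k h1 (differentiableAt_of_contDiffOn hW.smooth hW.isMetricOn.isOpen hx)]
  field_simp

/-- The Christoffel symbols of the leaves. -/
lemma christoffel_leaf (hx : x ∈ U) {i j : Fin 4} (hi : i < 2) (hj : j < 2) :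
    christoffel G 0 i j x = -((if j = 0 then pd i w x / w x else 0) +
      (if i = 0 then pd j w x / w x else 0)) ∧
    christoffel G 1 i j x = -((if j = 1 then pd i w x / w x else 0) +
      (if i = 1 then pd j w x / w x else 0)) := by
  have hp : (w x ^ 2)⁻¹ ≠ 0 := inv_ne_zero (pow_ne_zero 2 (hW.pos x hx).ne')
  have h2 := hW.leafNull.leaf_christoffel_eq hW.isMetricOn hx 2 hi hj
  have h3 := hW.leafNull.leaf_christoffel_eq hW.isMetricOn hx 3 hi hj
  have hi' := eq_zero_or_eq_one_of_lt_two hi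
  have hj' := eq_zero_or_eq_one_of_lt_two hj
  have q2 := hW.pd_eq hW.eq_02 hx
  have q3 := hW.pd_eq hW.eq_13 hx
  have z2 := hW.pd_eq_zero hW.eq_12 hx
  have z3 := hW.pd_eq_zero hW.eq_03 hx
  rw [hW.eq_02 x hx, hW.eq_12 x hx, zero_mul, add_zero] at h2
  rw [hW.eq_13 x hx, hW.eq_03 x hx, zero_mul, zero_add] at h3
  constructor <;> refine mul_left_cancel₀ hp ?_
  · rw [h2]
    rcases hi' with rfl | rfl <;> rcases hj' with rfl | rfl <;> simp only [q2, z2] <;> simp <;> ring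
  · rw [h3]
    rcases hi' with rfl | rfl <;> rcases hj' with rfl | rfl <;> simp only [q3, z3] <;> simp <;> ring

/-- The Christoffel symbols of the connection induced on the normal bundle of the leaves. -/
lemma christoffel_normal (hx : x ∈ U) {b : Fin 4} (hb : b < 2) :
    christoffel G 2 2 b x = (if b = 0 then 0 else -(pd 1 w x / w x)) ∧
    christoffel G 2 3 b x = (if b = 0 then 0 else pd 0 w x / w x) ∧
    christoffel G 3 2 b x = (if b = 0 then pd 1 w x / w x else 0) ∧
    christoffel G 3 3 b x = (if b = 0 then -(pd 0 w x / w x) else 0) := by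
  have hp : (w x ^ 2)⁻¹ ≠ 0 := inv_ne_zero (pow_ne_zero 2 (hW.pos x hx).ne')
  have hG := hW.isMetricOn
  have n00 := hW.leafNull x hx 0 0 (by decide) (by decide)
  have n01 := hW.leafNull x hx 0 1 (by decide) (by decide)
  have n10 := hW.leafNull x hx 1 0 (by decide) (by decide)
  have n11 := hW.leafNull x hx 1 1 (by decide) (by decide)
  have q2 := hW.pd_eq hW.eq_02 hx
  have q3 := hW.pd_eq hW.eq_13 hx
  have z2 := hW.pd_eq_zero hW.eq_12 hx
  have z3 := hW.pd_eq_zero hW.eq_03 hx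
  have hn := fun k {i j : Fin 4} (hi : i < 2) (hj : j < 2) =>
    hW.leafNull.pd_eq_zero hG hx k hi hj
  have hb' := eq_zero_or_eq_one_of_lt_two hb
  have h0 : ∀ d, (w x ^ 2)⁻¹ * christoffel G 2 d b x = (1 / 2) * (pd b (fun y => G y 0 d) x
      - pd 0 (fun y => G y b d) x) := fun d => by
    have := hG.lower_christoffel hx 0 d b
    rw [Fin.sum_univ_four, n00, n01, hW.eq_02 x hx, hW.eq_03 x hx, hn d hb (by decide),
      hG.pd_symm hx b d 0, hG.pd_symm hx 0 d b] at this
    linear_combination this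
  have h1 : ∀ d, (w x ^ 2)⁻¹ * christoffel G 3 d b x = (1 / 2) * (pd b (fun y => G y 1 d) x
      - pd 1 (fun y => G y b d) x) := fun d => by
    have := hG.lower_christoffel hx 1 d b
    rw [Fin.sum_univ_four, n10, n11, hW.eq_12 x hx, hW.eq_13 x hx, hn d hb (by decide),
      hG.pd_symm hx b d 1, hG.pd_symm hx 1 d b] at this
    linear_combination this
  refine ⟨?_, ?_, ?_, ?_⟩ <;> refine mul_left_cancel₀ hp ?_
  · rw [h0]; rcases hb' with rfl | rfl <;> simp only [q2, z2] <;> simp <;> ring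
  · rw [h0]; rcases hb' with rfl | rfl <;> simp only [q3, z3] <;> simp <;> ring
  · rw [h1]; rcases hb' with rfl | rfl <;> simp only [q2, z2] <;> simp <;> ring
  · rw [h1]; rcases hb' with rfl | rfl <;> simp only [q3, z3] <;> simp <;> ring

/-- The second logarithmic derivatives of `w`. -/
lemma pd_logDeriv (hx : x ∈ U) (k i : Fin 4) :
    pd k (fun y => pd i w y / w y) x =
      pd k (pd i w) x / w x - (pd k w x / w x) * (pd i w x / w x) := by
  have hU := hW.isMetricOn.isOpen
  have hw := (hW.pos x hx).ne'
  have hd := differentiableAt_of_contDiffOn hW.smooth hU hx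
  have hd' := differentiableAt_of_contDiffOn (contDiffOn_pd hU hW.smooth i) hU hx
  simp only [div_eq_mul_inv]
  rw [pd_mul k hd' (hd.fun_inv hw), pd_comp k (hasDerivAt_inv hw) hd]
  field_simp
  ring

/-- Along the leaves, the Ricci tensor of a conformal Walker metric `w⁻² g` is `2 w⁻¹` times the
Hessian of `w`. -/
theorem ricci_leaf (hx : x ∈ U) {b d : Fin 4} (hb : b < 2) (hd : d < 2) :
    ricci G b d x = 2 * (pd b (pd d w) x / w x) := by
  have hG := hW.isMetricOn
  have hU := hG.isOpen
  have l0 : (0 : Fin 4) < 2 := by decide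
  have l1 : (1 : Fin 4) < 2 := by decide
  have hc : ∀ {f : E4 → ℝ} (g : E4 → ℝ), (∀ y ∈ U, f y = g y) → ∀ k, pd k f x = pd k g x :=
    fun g hfg k => pd_congr_of_isOpen hU hx hfg k
  have hneg : ∀ k i, pd k (fun y => -(pd i w y / w y)) x =
      -(pd k (pd i w) x / w x - (pd k w x / w x) * (pd i w x / w x)) := fun k i => by
    rw [pd_neg, hW.pd_logDeriv hx]
  have hneg2 : ∀ k i, pd k (fun y => -(pd i w y / w y + pd i w y / w y)) x =
      -2 * (pd k (pd i w) x / w x - (pd k w x / w x) * (pd i w x / w x)) := fun k i => by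
    have hd' := differentiableAt_of_contDiffOn (contDiffOn_pd hU hW.smooth i) hU hx
    have hd := differentiableAt_of_contDiffOn hW.smooth hU hx
    have hq : DifferentiableAt ℝ (fun y => pd i w y / w y) x := by
      simp only [div_eq_mul_inv]
      exact hd'.fun_mul (hd.fun_inv (hW.pos x hx).ne')
    rw [pd_neg, pd_add k hq hq, hW.pd_logDeriv hx]; ring
  -- values of the Christoffel symbols over `U`
  have v : ∀ y ∈ U, (christoffel G 0 0 0 y = -(pd 0 w y / w y + pd 0 w y / w y) ∧
      christoffel G 0 0 1 y = -(pd 1 w y / w y) ∧ christoffel G 0 1 0 y = -(pd 1 w y / w y) ∧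
      christoffel G 0 1 1 y = 0) ∧ (christoffel G 1 0 0 y = 0 ∧
      christoffel G 1 0 1 y = -(pd 0 w y / w y) ∧ christoffel G 1 1 0 y = -(pd 0 w y / w y) ∧
      christoffel G 1 1 1 y = -(pd 1 w y / w y + pd 1 w y / w y)) ∧
      (∀ i j : Fin 4, i < 2 → j < 2 → christoffel G 2 i j y = 0 ∧ christoffel G 3 i j y = 0) ∧
      (christoffel G 2 2 0 y = 0 ∧ christoffel G 2 2 1 y = -(pd 1 w y / w y) ∧
      christoffel G 2 3 0 y = 0 ∧ christoffel G 2 3 1 y = pd 0 w y / w y) ∧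
      (christoffel G 3 2 0 y = pd 1 w y / w y ∧ christoffel G 3 2 1 y = 0 ∧
      christoffel G 3 3 0 y = -(pd 0 w y / w y) ∧ christoffel G 3 3 1 y = 0) := by
    intro y hy
    have a00 := hW.christoffel_leaf hy l0 l0
    have a01 := hW.christoffel_leaf hy l0 l1
    have a10 := hW.christoffel_leaf hy l1 l0
    have a11 := hW.christoffel_leaf hy l1 l1
    have n0 := hW.christoffel_normal hy l0
    have n1 := hW.christoffel_normal hy l1
    simp at a00 a01 a10 a11 n0 n1
    refine ⟨⟨?_, a01.1, a10.1, a11.1⟩, ⟨a00.2, a01.2, a10.2, ?_⟩,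
      fun i j hi hj => hW.leafNull.christoffel_leaf hG hy hi hj, ⟨n0.1, n1.1, n0.2.1, n1.2.1⟩,
      n0.2.2.1, n1.2.2.1, n0.2.2.2, n1.2.2.2⟩
    · rw [a00.1]; ring
    · rw [a11.2]; ring
  have vx := v x hx
  obtain ⟨⟨v000, v001, v010, v011⟩, ⟨v100, v101, v110, v111⟩, vl, ⟨v220, v221, v230, v231⟩,
    v320, v321, v330, v331⟩ := vx
  have hs := hG.christoffel_symm hx
  have d000 := hc (f := christoffel G 0 0 0) _ fun y hy => (v y hy).1.1
  have d001 := hc (f := christoffel G 0 0 1) _ fun y hy => (v y hy).1.2.1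
  have d010 := hc (f := christoffel G 0 1 0) _ fun y hy => (v y hy).1.2.2.1
  have d011 := hc (f := christoffel G 0 1 1) (fun _ => 0) fun y hy => (v y hy).1.2.2.2
  have d100 := hc (f := christoffel G 1 0 0) (fun _ => 0) fun y hy => (v y hy).2.1.1
  have d101 := hc (f := christoffel G 1 0 1) _ fun y hy => (v y hy).2.1.2.1
  have d110 := hc (f := christoffel G 1 1 0) _ fun y hy => (v y hy).2.1.2.2.1
  have d111 := hc (f := christoffel G 1 1 1) _ fun y hy => (v y hy).2.1.2.2.2
  have d2 := fun (i j : Fin 4) (hi : i < 2) (hj : j < 2) =>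
    hc (f := christoffel G 2 i j) (fun _ => 0) fun y hy => ((v y hy).2.2.1 i j hi hj).1
  have d3 := fun (i j : Fin 4) (hi : i < 2) (hj : j < 2) =>
    hc (f := christoffel G 3 i j) (fun _ => 0) fun y hy => ((v y hy).2.2.1 i j hi hj).2
  have d220 := hc (f := christoffel G 2 2 0) (fun _ => 0) fun y hy => (v y hy).2.2.2.1.1
  have d221 := hc (f := christoffel G 2 2 1) _ fun y hy => (v y hy).2.2.2.1.2.1
  have d330 := hc (f := christoffel G 3 3 0) _ fun y hy => (v y hy).2.2.2.2.2.2.1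
  have d331 := hc (f := christoffel G 3 3 1) (fun _ => 0) fun y hy => (v y hy).2.2.2.2.2.2.2
  have l00 := vl 0 0 l0 l0
  have l01 := vl 0 1 l0 l1
  have l10 := vl 1 0 l1 l0
  have l11 := vl 1 1 l1 l1
  have hcomm := pd_comm hU hW.smooth hx 0 1
  have hb' := eq_zero_or_eq_one_of_lt_two hb
  have hd' := eq_zero_or_eq_one_of_lt_two hd
  rcases hb' with rfl | rfl <;> rcases hd' with rfl | rfl <;>
  · simp only [ricci, riemann, Fin.sum_univ_four, d000, d001, d010, d011, d100, d101, d110, d111,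
      d2 0 0 l0 l0, d2 0 1 l0 l1, d2 1 0 l1 l0, d2 1 1 l1 l1, d3 0 0 l0 l0, d3 0 1 l0 l1,
      d3 1 0 l1 l0, d3 1 1 l1 l1, d220, d221, d330, d331, hneg, hneg2, pd_const, v000, v001, v010,
      v011, v100, v101, v110, v111, v220, v221, v230, v231, v320, v321, v330, v331, l00.1, l00.2,
      l01.1, l01.2, l10.1, l10.2, l11.1, l11.2, hs 2 0 2, hs 2 0 3, hs 2 1 2, hs 2 1 3, hs 3 0 2,
      hs 3 0 3, hs 3 1 2, hs 3 1 3, hcomm]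
    ring

end IsConformalWalkerForm

lemma isMetricOn_walkerMatrix {a b c : E4 → ℝ} {U : Set E4} (hU : IsOpen U)
    (ha : ContDiffOn ℝ ∞ a U) (hb : ContDiffOn ℝ ∞ b U) (hc : ContDiffOn ℝ ∞ c U) :
    IsMetricOn (walkerMatrix a b c) U where
  isOpen := hU
  smooth := fun i j => by
    fin_cases i <;> fin_cases j <;> first | exact contDiffOn_const | assumption
  symm := fun x _ i j => by fin_cases i <;> fin_cases j <;> rfl
  isUnit_det := fun x _ => by
    rw [isUnit_iff_ne_zero, walkerMatrix, Matrix.det_succ_row_zero]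
    simp [Fin.sum_univ_four, Matrix.det_fin_three, Fin.succAbove]

/-- The leaves of Walker coordinates carry a parallel distribution. -/
theorem isWalkerOn_walkerMatrix {a b c : E4 → ℝ} {U : Set E4} {Z : E4 → Submodule ℝ E4}
    (hU : IsOpen U) (ha : ContDiffOn ℝ ∞ a U) (hb : ContDiffOn ℝ ∞ b U) (hc : ContDiffOn ℝ ∞ c U)
    (hZ : ∀ q ∈ U, Z q = Submodule.span ℝ {basisVec 0, basisVec 1}) :
    IsWalkerOn (walkerMatrix a b c) Z U := by
  intro W e p hWo hWU he hp x hx k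
  have hG := (isMetricOn_walkerMatrix hU ha hb hc).mono hWo hWU
  rw [he.sForm_eq hG hx hp.smooth, neg_eq_zero]
  have hmem : ∀ A, ∀ y ∈ W, alphaVec e p A y 2 = 0 ∧ alphaVec e p A y 3 = 0 := by
    intro A y hy
    have h1 : alphaVec e p A y ∈ Submodule.span ℝ {basisVec 0, basisVec 1} := by
      rw [← hZ y (hWU hy), hp.plane y hy]
      exact Submodule.subset_span ⟨A, rfl⟩
    obtain ⟨r, s, hrs⟩ := Submodule.mem_span_pair.mp h1
    rw [← hrs]
    simp [basisVec_apply]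
  have hΓ : ∀ j : Fin 4, j < 2 → christoffel (walkerMatrix a b c) 2 k j x = 0 ∧
      christoffel (walkerMatrix a b c) 3 k j x = 0 := by
    intro j hj
    have hj' := eq_zero_or_eq_one_of_lt_two hj
    have h0 := hG.lower_christoffel hx 0 k j
    have h1 := hG.lower_christoffel hx 1 k j
    have hconst : ∀ i l m, l < 2 → pd i (fun y => walkerMatrix a b c y m l) x = 0 := by
      intro i l m hl
      have hl' := eq_zero_or_eq_one_of_lt_two hl
      rcases hl' with rfl | rfl <;> fin_cases m <;> exact pd_const i _
    rw [hconst _ _ _ hj, hconst _ _ _ (by decide), hconst _ _ _ (by decide)] at h0 h1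
    simp [walkerMatrix, Fin.sum_univ_four] at h0 h1
    exact ⟨h0, h1⟩
  have hcov : covVec (walkerMatrix a b c) k (alphaVec e p 0) x 2 = 0 ∧
      covVec (walkerMatrix a b c) k (alphaVec e p 0) x 3 = 0 := by
    have hz : ∀ i : Fin 4, (∀ y ∈ W, alphaVec e p 0 y i = 0) →
        pd k (fun y => alphaVec e p 0 y i) x = 0 := fun i hi =>
      pd_eq_zero_of_isOpen hWo hx hi k
    constructor
    · rw [covVec_apply, hz 2 fun y hy => (hmem 0 y hy).1, Fin.sum_univ_four, (hmem 0 x hx).1,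
        (hmem 0 x hx).2, (hΓ 0 (by decide)).1, (hΓ 1 (by decide)).1]
      ring
    · rw [covVec_apply, hz 3 fun y hy => (hmem 0 y hy).2, Fin.sum_univ_four, (hmem 0 x hx).1,
        (hmem 0 x hx).2, (hΓ 0 (by decide)).2, (hΓ 1 (by decide)).2]
      ring
  simp [dotG, Fin.sum_univ_four, hcov, hmem 1 x hx, walkerMatrix]

/-! ### Functions affine along the leaves -/

/-- The part of `U` in the common level set of the last two coordinates. -/
def slice (U : Set E4) (s t : ℝ) : Set E4 := {q | q ∈ U ∧ q 2 = s ∧ q 3 = t}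

section Slices

variable {U : Set E4} {f : E4 → ℝ}

/-- A function with vanishing leafwise derivatives is constant on the connected leaves. -/
lemma eq_of_pd_eq_zero_of_slice (hU : IsOpen U) (hf : ContDiffOn ℝ ∞ f U)
    (h0 : ∀ x ∈ U, pd 0 f x = 0) (h1 : ∀ x ∈ U, pd 1 f x = 0) {s t : ℝ}
    (hc : IsPreconnected (slice U s t)) {p q : E4} (hp : p ∈ slice U s t) (hq : q ∈ slice U s t) :
    f p = f q := by
  have hloc : IsLocallyConstant fun z : slice U s t => f z := by
    rw [IsLocallyConstant.iff_eventually_eq]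
    rintro ⟨z, hzU, hzs, hzt⟩
    obtain ⟨r, hr, hball⟩ := Metric.isOpen_iff.mp hU z hzU
    have h2 : ∀ᶠ y : slice U s t in 𝓝 ⟨z, hzU, hzs, hzt⟩, (y : E4) ∈ Metric.ball z r :=
      continuousAt_subtype_val.eventually (Metric.ball_mem_nhds z hr)
    filter_upwards [h2] with y hy
    have hseg : ∀ τ ∈ Icc (0 : ℝ) 1, z + τ • ((y : E4) - z) ∈ U := by
      intro τ hτ
      refine hball ?_
      have := (convex_ball z r).add_smul_sub_mem (Metric.mem_ball_self hr) hy hτ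
      exact this
    have hd : ∀ τ ∈ Icc (0 : ℝ) 1, HasDerivAt (fun τ => f (z + τ • ((y : E4) - z))) 0 τ := by
      intro τ hτ
      have h3 := (differentiableAt_of_contDiffOn hf hU (hseg τ hτ)).hasFDerivAt.comp_hasDerivAt τ
        (((hasDerivAt_id τ).smul_const ((y : E4) - z)).const_add z)
      have h4 : fderiv ℝ f (z + τ • ((y : E4) - z)) ((1 : ℝ) • ((y : E4) - z)) = 0 := by
        rw [one_smul, fderiv_apply_eq_sum, Fin.sum_univ_four, h0 _ (hseg τ hτ), h1 _ (hseg τ hτ)]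
        simp [y.2.2.1, y.2.2.2, hzs, hzt]
      have h5 : HasDerivAt (fun τ => f (z + τ • ((y : E4) - z)))
        (fderiv ℝ f (z + τ • ((y : E4) - z)) ((1 : ℝ) • ((y : E4) - z))) τ := h3
      rwa [h4] at h5
    have h6 := constant_of_has_deriv_right_zero
      (fun τ hτ => (hd τ hτ).continuousAt.continuousWithinAt)
      (fun τ hτ => (hd τ (Ico_subset_Icc_self hτ)).hasDerivWithinAt) 1 ⟨zero_le_one, le_rfl⟩
    simpa using h6
  have := isPreconnected_iff_preconnectedSpace.mp hc
  exact hloc.apply_eq_of_preconnectedSpace ⟨p, hp⟩ ⟨q, hq⟩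

/-- The last two coordinates as a pair. -/
def leafCoord (q : E4) : ℝ × ℝ := (q 2, q 3)

/-- A function which is constant along the connected leaves is a smooth function of the
coordinates that label them. -/
lemma exists_eq_comp_leafCoord (hU : IsOpen U) (hf : ContDiffOn ℝ ∞ f U)
    (h0 : ∀ x ∈ U, pd 0 f x = 0) (h1 : ∀ x ∈ U, pd 1 f x = 0)
    (hc : ∀ s t, IsPreconnected (slice U s t)) :
    ∃ F : ℝ × ℝ → ℝ, ContDiffOn ℝ ∞ F (leafCoord '' U) ∧ ∀ q ∈ U, F (leafCoord q) = f q := by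
  classical
  have hch : ∀ z : ℝ × ℝ, ∃ a : ℝ, ∀ q ∈ U, leafCoord q = z → f q = a := by
    intro z
    by_cases hz : ∃ q ∈ U, leafCoord q = z
    · obtain ⟨q, hq, rfl⟩ := hz
      refine ⟨f q, fun p hp hpq => ?_⟩
      simp only [leafCoord, Prod.mk.injEq] at hpq
      exact eq_of_pd_eq_zero_of_slice hU hf h0 h1 (hc (q 2) (q 3)) ⟨hp, hpq.1, hpq.2⟩ ⟨hq, rfl, rfl⟩
    · exact ⟨0, fun q hq hqz => (hz ⟨q, hq, hqz⟩).elim⟩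
  choose F hF using hch
  refine ⟨F, ?_, fun q hq => (hF _ q hq rfl).symm⟩
  rintro _ ⟨q, hq, rfl⟩
  -- a local section of the projection through `q`
  set σ' : ℝ × ℝ → E4 := fun z => !₂[q 0, q 1, z.1, z.2] with hσ
  have hσs : ContDiff ℝ ∞ σ' := by
    rw [contDiff_euclidean]
    intro i
    fin_cases i
    · exact contDiff_const
    · exact contDiff_const
    · exact contDiff_fst
    · exact contDiff_snd
  have hσq : σ' (leafCoord q) = q := by
    ext i; fin_cases i <;> rfl
  have hnear : ∀ᶠ z in 𝓝 (leafCoord q), σ' z ∈ U := by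
    refine hσs.continuous.continuousAt.eventually ?_
    rw [hσq]
    exact hU.mem_nhds hq
  have hsm : ContDiffAt ℝ ∞ (fun z => f (σ' z)) (leafCoord q) := by
    refine ContDiffAt.comp (leafCoord q) (g := f) (f := σ') ?_ hσs.contDiffAt
    rw [hσq]
    exact hf.contDiffAt (hU.mem_nhds hq)
  refine (hsm.congr_of_eventuallyEq ?_).contDiffWithinAt
  filter_upwards [hnear] with z hz
  exact (hF z (σ' z) hz rfl).symm

/-- The partial derivative as a derivative along the coordinate line. -/
lemma pd_of_line {x : E4} (hf : DifferentiableAt ℝ f x) (i : Fin 4) :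
    HasDerivAt (fun τ : ℝ => f (x + τ • basisVec i)) (pd i f x) 0 := by
  have h1 : HasDerivAt (fun τ : ℝ => x + τ • basisVec i) ((1 : ℝ) • basisVec i) 0 :=
    ((hasDerivAt_id (0 : ℝ)).smul_const (basisVec i)).const_add x
  have h2 : HasFDerivAt f (fderiv ℝ f x) (x + (0 : ℝ) • basisVec i) := by simpa using hf.hasFDerivAt
  have h3 := h2.comp_hasDerivAt (0 : ℝ) h1
  rw [one_smul] at h3
  exact h3

/-- Being affine along the connected leaves, having vanishing leafwise Hessian, and being affine
with coefficients smooth in the transverse coordinates are the same. -/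
theorem affine_tfae (hU : IsOpen U) (hf : ContDiffOn ℝ ∞ f U)
    (hc : ∀ s t, IsPreconnected (slice U s t)) :
    List.TFAE [
      ∀ x ∈ U, ∀ i j : Fin 4, i < 2 → j < 2 → pd i (pd j f) x = 0,
      ∃ m n k : ℝ × ℝ → ℝ, (ContDiffOn ℝ ∞ m (leafCoord '' U) ∧ ContDiffOn ℝ ∞ n (leafCoord '' U) ∧
        ContDiffOn ℝ ∞ k (leafCoord '' U)) ∧
        ∀ q ∈ U, f q = m (leafCoord q) * q 0 + n (leafCoord q) * q 1 + k (leafCoord q),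
      ∀ s t : ℝ, ∃ m n k : ℝ, ∀ q ∈ U, q 2 = s → q 3 = t → f q = m * q 0 + n * q 1 + k] := by
  tfae_have 1 → 2 := by
    intro hH
    have hd := fun i => contDiffOn_pd hU hf i
    obtain ⟨m, hm, hm'⟩ := exists_eq_comp_leafCoord hU (hd 0)
      (fun x hx => hH x hx 0 0 (by decide) (by decide))
      (fun x hx => hH x hx 1 0 (by decide) (by decide)) hc
    obtain ⟨n, hn, hn'⟩ := exists_eq_comp_leafCoord hU (hd 1)
      (fun x hx => hH x hx 0 1 (by decide) (by decide))
      (fun x hx => hH x hx 1 1 (by decide) (by decide)) hc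
    have hco : ∀ i : Fin 4, ContDiffOn ℝ ∞ (fun q : E4 => q i) U := fun i =>
      (coordCLM i).contDiff.contDiffOn
    have hrem : ∀ i : Fin 4, i < 2 → ∀ x ∈ U,
        pd i (fun q => f q - (pd 0 f q * q 0 + pd 1 f q * q 1)) x = 0 := by
      intro i hi x hx
      have d0 := differentiableAt_of_contDiffOn (hd 0) hU hx
      have d1 := differentiableAt_of_contDiffOn (hd 1) hU hx
      have c := fun i => differentiableAt_of_contDiffOn (hco i) hU hx
      rw [pd_sub i (differentiableAt_of_contDiffOn hf hU hx)
        ((d0.fun_mul (c 0)).fun_add (d1.fun_mul (c 1))),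
            pd_add i (d0.fun_mul (c 0)) (d1.fun_mul (c 1)),
        pd_mul i d0 (c 0), pd_mul i d1 (c 1), hH x hx i 0 hi (by decide),
            hH x hx i 1 hi (by decide),
        pd_coord, pd_coord]
      have hi' := eq_zero_or_eq_one_of_lt_two hi
      rcases hi' with rfl | rfl <;> simp
    obtain ⟨k, hk, hk'⟩ := exists_eq_comp_leafCoord hU
      (hf.sub (((hd 0).mul (hco 0)).add ((hd 1).mul (hco 1))))
      (hrem 0 (by decide)) (hrem 1 (by decide)) hc
    refine ⟨m, n, k, ⟨hm, hn, hk⟩, fun q hq => ?_⟩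
    rw [hm' q hq, hn' q hq, hk' q hq]; ring
  tfae_have 2 → 3 := by
    rintro ⟨m, n, k, -, hq⟩ s t
    refine ⟨m (s, t), n (s, t), k (s, t), fun q hqU hs ht => ?_⟩
    rw [hq q hqU, leafCoord, hs, ht]
  tfae_have 3 → 1 := by
    intro hA x hx i j hi hj
    obtain ⟨m, n, k, hmn⟩ := hA (x 2) (x 3)
    have hi' : (i = 0 ∨ i = 1) ∧ (basisVec i 2 = 0 ∧ basisVec i 3 = 0) := by
      have := eq_zero_or_eq_one_of_lt_two hi
      refine ⟨this, ?_⟩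
      rcases this with rfl | rfl <;> simp [basisVec_apply]
    have hj' : (j = 0 ∨ j = 1) ∧ (basisVec j 2 = 0 ∧ basisVec j 3 = 0) := by
      have := eq_zero_or_eq_one_of_lt_two hj
      refine ⟨this, ?_⟩
      rcases this with rfl | rfl <;> simp [basisVec_apply]
    have hline : ∀ (y : E4) (l : Fin 4), y ∈ U → ∀ᶠ τ : ℝ in 𝓝 0, y + τ • basisVec l ∈ U := by
      intro y l hy
      have hcont : ContinuousAt (fun τ : ℝ => y + τ • basisVec l) 0 := by fun_prop
      refine hcont.eventually ?_
      simpa using hU.mem_nhds hy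
    -- along the leaf through `x` the derivative of `f` is constant
    have hder : ∀ y ∈ U, y 2 = x 2 → y 3 = x 3 →
        pd j f y = m * basisVec j 0 + n * basisVec j 1 := by
      intro y hy h2 h3
      have e1 := pd_of_line (differentiableAt_of_contDiffOn hf hU hy) j
      have e2 : HasDerivAt (fun τ : ℝ => (m * y 0 + n * y 1 + k) +
          τ * (m * basisVec j 0 + n * basisVec j 1))
              (1 * (m * basisVec j 0 + n * basisVec j 1)) 0 :=
        ((hasDerivAt_id (0 : ℝ)).mul_const _).const_add _
      rw [one_mul] at e2
      refine e1.unique (e2.congr_of_eventuallyEq ?_)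
      filter_upwards [hline y j hy] with τ hτ
      rw [hmn _ hτ (by simp [hj', h2]) (by simp [hj', h3])]
      simp only [PiLp.add_apply, PiLp.smul_apply, smul_eq_mul]; ring
    have e1 := pd_of_line (differentiableAt_of_contDiffOn (contDiffOn_pd hU hf j) hU hx) i
    refine e1.unique ((hasDerivAt_const (0 : ℝ)
      (m * basisVec j 0 + n * basisVec j 1)).congr_of_eventuallyEq ?_)
    filter_upwards [hline x i hx] with τ hτ
    exact hder _ hτ (by simp [hi']) (by simp [hi'])
  tfae_finish

end Slices

section ConformalWalker

variable {M : Type*} [TopologicalSpace M] [ChartedSpace (EuclideanSpace ℝ (Fin 4)) M]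
  [IsManifold (𝓡 4) ∞ M] {h : NeutralMetric M} {π : ProjectiveSpinorField h}
  {φ : OpenPartialHomeomorph M E4} {Ω : M → ℝ} (hW : IsConformalWalkerChart h π φ Ω)
include hW

namespace IsConformalWalkerChart

lemma contDiffOn_factor_inv : ContDiffOn ℝ ∞ (fun q => (Ω (φ.symm q))⁻¹) φ.target := by
  have h1 : ContDiffOn ℝ ∞ (fun q => Ω (φ.symm q)) φ.target := by
    rw [← contMDiffOn_iff_contDiffOn]
    exact hW.factor_smooth.comp (contMDiffOn_symm_of_mem_maximalAtlas hW.mem_atlas)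
      fun q hq => φ.map_target hq
  exact h1.inv fun q hq => (hW.factor_pos _ (φ.map_target hq)).ne'

/-- With `w = Ω⁻¹`, Walker's form `h = Ω² g` is `h = w⁻² g`. -/
lemma isConformalWalkerForm :
    IsConformalWalkerForm (h.inChart φ) (fun q => (Ω (φ.symm q))⁻¹) φ.target := by
  obtain ⟨a, b, c, ha, hb, hc, hG, -⟩ := hW.walker
  refine ⟨h.isMetricOn_inChart hW.mem_atlas, ?_, hW.contDiffOn_factor_inv,
    fun q hq => inv_pos.mpr (hW.factor_pos _ (φ.map_target hq)), ?_, ?_, ?_, ?_⟩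
  · intro x hx i j hi hj
    have hi' := eq_zero_or_eq_one_of_lt_two hi
    have hj' := eq_zero_or_eq_one_of_lt_two hj
    rw [hG x hx]
    rcases hi' with rfl | rfl <;> rcases hj' with rfl | rfl <;> simp [walkerMatrix]
  all_goals
    intro x hx
    rw [hG x hx]
    simp [walkerMatrix]

/-- The Ricci tensor along the leaves is `2 w⁻¹ ∂ᵢ∂ⱼ w` with `w = Ω⁻¹`, so it vanishes exactly when
`Ω⁻¹` is affine along them. -/
theorem isRPSOn_iff_affine : π.IsRPSOn φ.source ↔ IsAffineInUV φ fun p => (Ω p)⁻¹ := by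
  have hF := hW.isConformalWalkerForm
  have h3 := (affine_tfae φ.open_target hW.contDiffOn_factor_inv hW.connected_slices).out 0 2
  refine Iff.trans ?_ h3
  rw [isRPSOn_source_iff π hW.mem_atlas]
  refine forall₂_congr fun x hx => ?_
  rw [hW.plane_eq x hx, forall_ricciForm_eq_zero_iff]
  refine forall₂_congr fun i j => forall₂_congr fun hi hj => ?_
  rw [hF.ricci_leaf hx hi hj]
  simp [(hF.pos x hx).ne', -inv_eq_zero, -div_inv_eq_mul]

theorem affine_iff_reciprocal :
    IsAffineInUV φ (fun p => (Ω p)⁻¹) ↔ HasReciprocalAffineForm φ Ω := by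
  have h3 := (affine_tfae φ.open_target hW.contDiffOn_factor_inv hW.connected_slices).out 2 1
  refine Iff.trans h3 ?_
  refine exists₃_congr fun m n k => and_congr ?_ (forall₂_congr fun q hq => ?_)
  · simp [leafCoord]
    rfl
  · exact inv_eq_iff_eq_inv

end IsConformalWalkerChart

end ConformalWalker

/-! ### Completely integrable systems along the leaves -/

/-- Coordinate space as the product of the leaf coordinates and the transverse coordinates. -/
noncomputable def joinCLM : (ℝ × ℝ) × (ℝ × ℝ) →L[ℝ] E4 :=
  ((ContinuousLinearMap.fst ℝ ℝ ℝ).comp (ContinuousLinearMap.fst ℝ _ _)).smulRight (basisVec 0) +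
  ((ContinuousLinearMap.snd ℝ ℝ ℝ).comp (ContinuousLinearMap.fst ℝ _ _)).smulRight (basisVec 1) +
  ((ContinuousLinearMap.fst ℝ ℝ ℝ).comp (ContinuousLinearMap.snd ℝ _ _)).smulRight (basisVec 2) +
  ((ContinuousLinearMap.snd ℝ ℝ ℝ).comp (ContinuousLinearMap.snd ℝ _ _)).smulRight (basisVec 3)

/-- The inverse of `joinCLM`. -/
noncomputable def splitCLM : E4 →L[ℝ] (ℝ × ℝ) × (ℝ × ℝ) :=
  ((coordCLM 0).prod (coordCLM 1)).prod ((coordCLM 2).prod (coordCLM 3))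

lemma splitCLM_apply (x : E4) : splitCLM x = ((x 0, x 1), (x 2, x 3)) := rfl

lemma joinCLM_apply (p : (ℝ × ℝ) × (ℝ × ℝ)) : joinCLM p = p.1.1 • basisVec 0 +
    p.1.2 • basisVec 1 + p.2.1 • basisVec 2 + p.2.2 • basisVec 3 := rfl

lemma joinCLM_splitCLM (x : E4) : joinCLM (splitCLM x) = x := by
  conv_rhs => rw [eq_sum_basisVec x]
  rw [joinCLM_apply, splitCLM_apply, Fin.sum_univ_four]

/-- The system `∂₀ w = a(x, w)`, `∂₁ w = b(x, w)`, with vanishing initial values on the transversal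
through `x₀`, is solvable near `x₀` when it is compatible. -/
theorem exists_leaf_solution {F : Type} [NormedAddCommGroup F] [NormedSpace ℝ F]
    [FiniteDimensional ℝ F] {a b : E4 × F → F} {O : Set (E4 × F)} (hO : IsOpen O) {x₀ : E4}
    (hx₀ : (x₀, 0) ∈ O) (ha : ContDiffOn ℝ ∞ a O) (hb : ContDiffOn ℝ ∞ b O)
    (hint : ∀ p ∈ O, fderiv ℝ b p (basisVec 0, a p) = fderiv ℝ a p (basisVec 1, b p)) :
    ∃ (w : E4 → F) (V : Set E4), IsOpen V ∧ x₀ ∈ V ∧ ContDiffOn ℝ ∞ w V ∧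
      (∀ x ∈ V, x 0 = x₀ 0 → x 1 = x₀ 1 → w x = 0) ∧
      ∀ x ∈ V, (x, w x) ∈ O ∧ fderiv ℝ w x (basisVec 0) = a (x, w x) ∧
        fderiv ℝ w x (basisVec 1) = b (x, w x) := by
  set c : E4 := joinCLM ((x₀ 0, x₀ 1), 0) with hc
  -- the affine change of variables into leaf, transverse and unknown variables
  set L' : ((ℝ × ℝ) × (ℝ × ℝ)) × F →L[ℝ] E4 × F :=
    joinCLM.prodMap (ContinuousLinearMap.id ℝ F) with hL'
  set L : ((ℝ × ℝ) × (ℝ × ℝ)) × F → E4 × F := fun p => L' p + (c, 0) with hL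
  have hLs : ContDiff ℝ ∞ L := L'.contDiff.add contDiff_const
  have hLd : ∀ p, HasFDerivAt L L' p := fun p => L'.hasFDerivAt.add_const _
  set P : ((ℝ × ℝ) × (ℝ × ℝ)) × F → (ℝ × ℝ) →L[ℝ] F := fun p =>
    (ContinuousLinearMap.fst ℝ ℝ ℝ).smulRight (a (L p)) +
    (ContinuousLinearMap.snd ℝ ℝ ℝ).smulRight (b (L p)) with hP
  have hsmul : ∀ (l : (ℝ × ℝ) →L[ℝ] ℝ), ∃ T : F →L[ℝ] (ℝ × ℝ) →L[ℝ] F, ∀ f, T f = l.smulRight f :=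
    fun l => ⟨ContinuousLinearMap.smulRightL ℝ (ℝ × ℝ) F l, fun f => rfl⟩
  obtain ⟨T1, hT1⟩ := hsmul (ContinuousLinearMap.fst ℝ ℝ ℝ)
  obtain ⟨T2, hT2⟩ := hsmul (ContinuousLinearMap.snd ℝ ℝ ℝ)
  have hPT : P = fun p => T1 (a (L p)) + T2 (b (L p)) := by
    funext p; rw [hT1, hT2]
  have hmaps : MapsTo L (L ⁻¹' O) O := fun p hp => hp
  have hPs : ContDiffOn ℝ ∞ P (L ⁻¹' O) := by
    rw [hPT]
    exact (T1.contDiff.comp_contDiffOn (ha.comp hLs.contDiffOn hmaps)).add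
      (T2.contDiff.comp_contDiffOn (hb.comp hLs.contDiffOn hmaps))
  have hPd : ∀ p ∈ L ⁻¹' O, ∀ v z, fderiv ℝ P p v z =
      z.1 • fderiv ℝ a (L p) (L' v) + z.2 • fderiv ℝ b (L p) (L' v) := by
    intro p hp v z
    have da := (differentiableAt_of_contDiffOn ha hO hp).hasFDerivAt.comp p (hLd p)
    have db := (differentiableAt_of_contDiffOn hb hO hp).hasFDerivAt.comp p (hLd p)
    have dP : HasFDerivAt P (T1.comp ((fderiv ℝ a (L p)).comp L') +
        T2.comp ((fderiv ℝ b (L p)).comp L')) p := by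
      rw [hPT]
      exact (T1.hasFDerivAt.comp p da).add (T2.hasFDerivAt.comp p db)
    rw [dP.fderiv]
    simp [hT1, hT2]
  have hL'v : ∀ p ζ, L' ((ζ, 0), P p ζ) =
      ζ.1 • (basisVec 0, a (L p)) + ζ.2 • (basisVec 1, b (L p)) := by
    intro p ζ
    simp [hL', hP, joinCLM_apply]
  have hx₀' : L ((0, (x₀ 2, x₀ 3)), 0) = (x₀, 0) := by
    have h1 : joinCLM (0, (x₀ 2, x₀ 3)) + c = x₀ := by
      rw [hc, ← map_add, ← joinCLM_splitCLM x₀]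
      simp [splitCLM_apply, joinCLM_apply, basisVec_apply]
    simp [hL, hL', h1]
  obtain ⟨w, V, hV, hmem, hw, hw0, hwd⟩ := exists_totalDifferential (P := P)
    (y₀ := (x₀ 2, x₀ 3)) (U := L ⁻¹' O) (hO.preimage hLs.continuous)
    (by rw [mem_preimage, hx₀']; exact hx₀) hPs (by
      intro p hp ζ z
      rw [hPd p hp, hPd p hp, hL'v, hL'v]
      simp only [map_add, map_smul, smul_add, smul_smul, hint (L p) hp, mul_comm]
      abel)
  set S : E4 → (ℝ × ℝ) × (ℝ × ℝ) := fun x => splitCLM x - ((x₀ 0, x₀ 1), 0) with hS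
  have hSd : ∀ x, HasFDerivAt S splitCLM x := fun x => splitCLM.hasFDerivAt.sub_const _
  have hSs : ContDiff ℝ ∞ S := splitCLM.contDiff.sub contDiff_const
  have hLS : ∀ x f, L (S x, f) = (x, f) := by
    intro x f
    have : joinCLM (S x) + c = x := by
      rw [hc, ← map_add, hS]
      simp [joinCLM_splitCLM]
    simp [hL, hL', this]
  refine ⟨fun x => w (S x), S ⁻¹' V, hV.preimage hSs.continuous, ?_,
      hw.comp hSs.contDiffOn fun x hx => hx,
    ?_, ?_⟩
  · have : S x₀ = (0, (x₀ 2, x₀ 3)) := by simp [hS, splitCLM_apply]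
    rw [mem_preimage, this]; exact hmem
  · intro x hx h0 h1
    have : S x = (0, (x 2, x 3)) := by simp [hS, splitCLM_apply, h0, h1]
    rw [mem_preimage, this] at hx
    beta_reduce
    rw [this]; exact hw0 _ hx
  · intro x hx
    obtain ⟨hmemO, hder⟩ := hwd (S x) hx
    have hd : ∀ v, fderiv ℝ (fun x => w (S x)) x v = fderiv ℝ w (S x) (splitCLM v) := fun v => by
      have h1 : HasFDerivAt (fun x => w (S x)) ((fderiv ℝ w (S x)).comp splitCLM) x :=
        (differentiableAt_of_contDiffOn hw hV hx).hasFDerivAt.comp x (hSd x)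
      rw [h1.fderiv]; rfl
    refine ⟨?_, ?_, ?_⟩
    · have := hLS x (w (S x))
      rw [mem_preimage, this] at hmemO
      exact hmemO
    · have h2 : splitCLM (basisVec 0) = ((1, 0), 0) := by
        simp [splitCLM_apply, basisVec_apply]
      rw [hd, h2, hder (1, 0)]
      simp [hP, hLS]
    · have h2 : splitCLM (basisVec 1) = ((0, 1), 0) := by
        simp [splitCLM_apply, basisVec_apply]
      rw [hd, h2, hder (0, 1)]
      simp [hP, hLS]

/-- Poincaré's lemma along the leaves, with the transverse coordinates as parameters. -/
theorem exists_leaf_potential {a b : E4 → ℝ} {U : Set E4} (hU : IsOpen U) {x₀ : E4} (hx₀ : x₀ ∈ U)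
    (ha : ContDiffOn ℝ ∞ a U) (hb : ContDiffOn ℝ ∞ b U) (hint : ∀ x ∈ U, pd 0 b x = pd 1 a x) :
    ∃ (w : E4 → ℝ) (V : Set E4), IsOpen V ∧ x₀ ∈ V ∧ V ⊆ U ∧ ContDiffOn ℝ ∞ w V ∧
      ∀ x ∈ V, pd 0 w x = a x ∧ pd 1 w x = b x := by
  have hfst : ∀ {f : E4 → ℝ}, ContDiffOn ℝ ∞ f U → ∀ p : E4 × ℝ,
      p ∈ (Prod.fst ⁻¹' U : Set (E4 × ℝ)) →
      ∀ v, fderiv ℝ (fun p : E4 × ℝ => f p.1) p v = fderiv ℝ f p.1 v.1 := by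
    intro f hf p hp v
    have h1 : HasFDerivAt (fun p : E4 × ℝ => f p.1) ((fderiv ℝ f p.1).comp
        (ContinuousLinearMap.fst ℝ E4 ℝ)) p :=
      (differentiableAt_of_contDiffOn hf hU hp).hasFDerivAt.comp p hasFDerivAt_fst
    rw [h1.fderiv]; rfl
  obtain ⟨w, V, hV, hmem, hw, -, hd⟩ := exists_leaf_solution (a := fun p : E4 × ℝ => a p.1)
    (b := fun p => b p.1) (O := Prod.fst ⁻¹' U) (hU.preimage continuous_fst) (x₀ := x₀) hx₀
    (ha.comp contDiff_fst.contDiffOn fun p hp => hp)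
        (hb.comp contDiff_fst.contDiffOn fun p hp => hp)
    (fun p hp => by rw [hfst hb p hp, hfst ha p hp]; exact hint _ hp)
  exact ⟨w, V, hV, hmem, fun x hx => (hd x hx).1, hw, fun x hx => (hd x hx).2⟩

/-! ### Charts adapted to the `α`-surfaces -/

section ChartChange

variable {M : Type*} [TopologicalSpace M] [ChartedSpace (EuclideanSpace ℝ (Fin 4)) M]
  [IsManifold (𝓡 4) ∞ M] {φ : OpenPartialHomeomorph M E4}
  (hφ : φ ∈ IsManifold.maximalAtlas (𝓡 4) ∞ M) {e : OpenPartialHomeomorph E4 E4}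
  (he : ContDiffOn ℝ ∞ e e.source) (he' : ContDiffOn ℝ ∞ e.symm e.target) {x : E4}

include hφ he he' in
lemma trans_symm_mem_maximalAtlas : φ.trans e.symm ∈ IsManifold.maximalAtlas (𝓡 4) ∞ M :=
  trans_mem_maximalAtlas hφ (e := e.symm) he' he

omit [ChartedSpace (EuclideanSpace ℝ (Fin 4)) M] [IsManifold (𝓡 4) ∞ M] in
lemma mem_overlap_trans_symm (hx : x ∈ (φ.trans e.symm).target) : x ∈ overlap (φ.trans e.symm) φ :=
  ⟨hx, φ.map_target hx.2⟩

omit [ChartedSpace (EuclideanSpace ℝ (Fin 4)) M] [IsManifold (𝓡 4) ∞ M] in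
/-- The transition from `φ.trans e.symm` to `φ` is `e`. -/
lemma transition_trans_symm (hx : x ∈ (φ.trans e.symm).target) :
    (φ ∘ (φ.trans e.symm).symm) x = e x ∧
      fderiv ℝ (φ ∘ (φ.trans e.symm).symm) x = fderiv ℝ e x := by
  have h1 : ∀ y ∈ (φ.trans e.symm).target, (φ ∘ (φ.trans e.symm).symm) y = e y := fun y hy =>
    φ.right_inv hy.2
  refine ⟨h1 x hx, Filter.EventuallyEq.fderiv_eq ?_⟩
  filter_upwards [(φ.trans e.symm).open_target.mem_nhds hx] with y hy using h1 y hy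

include hφ he he'

lemma mem_planeInChart_trans_symm (Z : ∀ p : M, Submodule ℝ (TangentSpace (𝓡 4) p))
    (hx : x ∈ (φ.trans e.symm).target) (v : E4) :
    v ∈ planeInChart Z (φ.trans e.symm) x ↔ fderiv ℝ e x v ∈ planeInChart Z φ (e x) := by
  rw [mem_planeInChart_iff hφ (trans_symm_mem_maximalAtlas hφ he he') Z (mem_overlap_trans_symm hx),
    (transition_trans_symm hx).1, (transition_trans_symm hx).2]

lemma isPullback_trans_symm (h : NeutralMetric M) :
    IsPullback (φ ∘ (φ.trans e.symm).symm) (h.inChart (φ.trans e.symm)) (h.inChart φ)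
      (overlap (φ.trans e.symm) φ) φ.target :=
  isPullback_inChart hφ (trans_symm_mem_maximalAtlas hφ he he') h

lemma dotG_trans_symm (h : NeutralMetric M) (hx : x ∈ (φ.trans e.symm).target) (u v : E4) :
    dotG (h.inChart (φ.trans e.symm)) x u v =
      dotG (h.inChart φ) (e x) (fderiv ℝ e x u) (fderiv ℝ e x v) := by
  rw [← metricForm_apply, ← metricForm_apply,
    (isPullback_trans_symm hφ he he' h).metricForm_eq (mem_overlap_trans_symm hx),
    (transition_trans_symm hx).1, (transition_trans_symm hx).2]

end ChartChange

/-- The derivative of a diffeomorphism is invertible, with inverse the derivative of the inverse. -/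
lemma exists_equiv_fderiv {e : OpenPartialHomeomorph E4 E4} (he : ContDiffOn ℝ ∞ e e.source)
    (he' : ContDiffOn ℝ ∞ e.symm e.target) {x : E4} (hx : x ∈ e.source) :
    ∃ L : E4 ≃L[ℝ] E4, (L : E4 →L[ℝ] E4) = fderiv ℝ e x ∧
      (L.symm : E4 →L[ℝ] E4) = fderiv ℝ e.symm (e x) := by
  have h1 := (differentiableAt_of_contDiffOn he e.open_source hx).hasFDerivAt
  have h2 := (differentiableAt_of_contDiffOn he' e.open_target (e.map_source hx)).hasFDerivAt
  have h3 : (fderiv ℝ e.symm (e x)).comp (fderiv ℝ e x) = ContinuousLinearMap.id ℝ E4 := by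
    refine HasFDerivAt.unique (h2.comp x h1) ((hasFDerivAt_id x).congr_of_eventuallyEq ?_)
    filter_upwards [e.open_source.mem_nhds hx] with y hy using e.left_inv hy
  have h4 : (fderiv ℝ e x).comp (fderiv ℝ e.symm (e x)) = ContinuousLinearMap.id ℝ E4 := by
    have h1' : HasFDerivAt e (fderiv ℝ e x) (e.symm (e x)) := by rwa [e.left_inv hx]
    refine HasFDerivAt.unique (h1'.comp (e x) h2) ((hasFDerivAt_id (e x)).congr_of_eventuallyEq ?_)
    filter_upwards [e.open_target.mem_nhds (e.map_source hx)] with y hy using e.right_inv hy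
  exact ⟨ContinuousLinearEquiv.equivOfInverse _ _ (fun v => DFunLike.congr_fun h3 v)
    (fun v => DFunLike.congr_fun h4 v), rfl, rfl⟩

/-- Two linearly independent vectors are the images of the first two coordinate vectors under a
linear automorphism. -/
lemma exists_equiv_basisVec {v : Fin 2 → E4} (hv : LinearIndependent ℝ v) :
    ∃ A : E4 ≃L[ℝ] E4, A (basisVec 0) = v 0 ∧ A (basisVec 1) = v 1 := by
  have hb : LinearIndependent ℝ (![basisVec 0, basisVec 1] : Fin 2 → E4) := by
    rw [LinearIndependent.pair_iff]
    intro s t hst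
    have h0 := congrArg (fun w : E4 => w 0) hst
    have h1 := congrArg (fun w : E4 => w 1) hst
    simp [basisVec_apply] at h0 h1
    exact ⟨h0, h1⟩
  set B := Module.Basis.sumExtend hv
  set C := Module.Basis.sumExtend hb
  have := Module.Finite.finite_basis B
  have := Module.Finite.finite_basis C
  have : Finite (Module.Basis.sumExtendIndex hv) := Finite.sum_right (Fin 2)
  have : Finite (Module.Basis.sumExtendIndex hb) := Finite.sum_right (Fin 2)
  have hcard : Nat.card (Module.Basis.sumExtendIndex hb)
      = Nat.card (Module.Basis.sumExtendIndex hv) := by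
    have h1 := Module.finrank_eq_nat_card_basis B
    have h2 := Module.finrank_eq_nat_card_basis C
    rw [Nat.card_sum] at h1 h2
    exact Nat.add_left_cancel (h2.symm.trans h1)
  obtain ⟨σ'⟩ : Nonempty (Module.Basis.sumExtendIndex hb ≃ Module.Basis.sumExtendIndex hv) :=
    Finite.card_eq.mp hcard
  set A := C.equiv B (Equiv.sumCongr (Equiv.refl (Fin 2)) σ')
  have hA : ∀ i : Fin 2, A (![basisVec 0, basisVec 1] i) = v i := by
    intro i
    have h1 : C (Sum.inl i) = ![basisVec 0, basisVec 1] i := by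
      simp [C, Module.Basis.sumExtend]
      rfl
    have h2 : B (Sum.inl i) = v i := by
      simp [B, Module.Basis.sumExtend]
      rfl
    rw [← h1, Module.Basis.equiv_apply]
    exact h2
  exact ⟨A.toContinuousLinearEquiv, hA 0, hA 1⟩

/-- The index of the `B`-th leaf coordinate. -/
def leafIndex : Fin 2 → Fin 4 := ![0, 1]

section LeafChart

variable {M : Type*} [TopologicalSpace M] [ChartedSpace (EuclideanSpace ℝ (Fin 4)) M]
  [IsManifold (𝓡 4) ∞ M] {h : NeutralMetric M} {π : ProjectiveSpinorField h}

/-- Around each point there is a chart in which the `α`-planes are a graph over the first two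
coordinate directions. -/
theorem exists_graph_chart (π : ProjectiveSpinorField h) (p : M) :
    ∃ φ : OpenPartialHomeomorph M E4, φ ∈ IsManifold.maximalAtlas (𝓡 4) ∞ M ∧ p ∈ φ.source ∧
      ∃ X : Fin 2 → E4 → E4, IsNullGraph (h.inChart φ) φ.target X ∧
        ∀ x ∈ φ.target, planeInChart π.plane φ x = Submodule.span ℝ (range fun A => X A x) := by
  obtain ⟨c, hc⟩ := π.exists_lsr p
  set x₀ := c.chart p with hx₀
  have hx₀t : x₀ ∈ c.chart.target := c.chart.map_source hc
  set V : Fin 2 → E4 → E4 := alphaVec c.frame c.spinor with hV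
  have hVs : ∀ A, ContDiffOn ℝ ∞ (V A) c.chart.target := fun A =>
    ContDiffOn.sum fun A' _ => (c.isScaledRep.smooth A').smul (c.isSpinFrame.smooth A A')
  have hli := c.isSpinFrame.linearIndependent_alphaVec hx₀t (c.isScaledRep.ne_zero x₀ hx₀t)
  obtain ⟨L, hL0, hL1⟩ := exists_equiv_basisVec hli
  -- in the linear coordinates `L` the spanning vectors at `x₀` are the first two coordinate vectors
  set V' : Fin 2 → E4 → E4 := fun A x => L.symm (V A (L x)) with hV'
  set U₀ : Set E4 := L ⁻¹' c.chart.target with hU₀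
  have hU₀o : IsOpen U₀ := c.chart.open_target.preimage L.continuous
  have hV's : ∀ A, ContDiffOn ℝ ∞ (V' A) U₀ := fun A =>
    L.symm.contDiff.comp_contDiffOn ((hVs A).comp L.contDiff.contDiffOn fun x hx => hx)
  set m : E4 → Matrix (Fin 2) (Fin 2) ℝ := fun x => Matrix.of fun A B => V' A x
      (leafIndex B) with hm
  have hms : ∀ A B, ContDiffOn ℝ ∞ (fun x => m x A B) U₀ := fun A B =>
    contDiffOn_apply (hV's A) (leafIndex B)
  have hdet : ContDiffOn ℝ ∞ (fun x => (m x).det) U₀ := contDiffOn_det hms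
  -- near `x₀` the spanning fields can be normalised to a graph by inverting `m`
  set U : Set E4 := U₀ ∩ (fun x => (m x).det) ⁻¹' {0}ᶜ with hU
  have hUo : IsOpen U := hdet.continuousOn.isOpen_inter_preimage hU₀o isOpen_compl_singleton
  have hbase : L.symm x₀ ∈ U := by
    have hmem : L.symm x₀ ∈ U₀ := by simpa [hU₀] using hx₀t
    refine ⟨hmem, ?_⟩
    have h0 : V' 0 (L.symm x₀) = basisVec 0 := by
      simp only [hV', L.apply_symm_apply]
      exact L.symm_apply_eq.mpr hL0.symm
    have h1 : V' 1 (L.symm x₀) = basisVec 1 := by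
      simp only [hV', L.apply_symm_apply]
      exact L.symm_apply_eq.mpr hL1.symm
    simp [hm, Matrix.det_fin_two, h0, h1, leafIndex, basisVec_apply]
  have hUdet : ∀ x ∈ U, IsUnit (m x).det := fun x hx => isUnit_iff_ne_zero.mpr hx.2
  set e : OpenPartialHomeomorph E4 E4 :=
    L.toHomeomorph.toOpenPartialHomeomorph.restrOpen U hUo with he
  have hes : e.source = U := by simp [he]
  have heL : ∀ x, e x = L x := fun x => rfl
  have he1 : ContDiffOn ℝ ∞ e e.source := L.contDiff.contDiffOn
  have he2 : ContDiffOn ℝ ∞ e.symm e.target := L.symm.contDiff.contDiffOn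
  have hfd : ∀ x, fderiv ℝ e x = (L : E4 →L[ℝ] E4) := fun x => L.hasFDerivAt.fderiv
  have hφ := trans_symm_mem_maximalAtlas c.mem_atlas he1 he2
  set φ := c.chart.trans e.symm with hφdef
  set X : Fin 2 → E4 → E4 := fun i x => ∑ A, (m x)⁻¹ i A • V' A x with hX
  have htU : ∀ x ∈ φ.target, x ∈ U := fun x hx => hes ▸ hx.1
  have hV'm : ∀ x ∈ U, ∀ A, V' A x = ∑ i, m x A i • X i x := by
    intro x hx A
    have h1 : ∀ B, ∑ i, m x A i * (m x)⁻¹ i B = if A = B then 1 else 0 := fun B => by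
      rw [← Matrix.mul_apply, Matrix.mul_nonsing_inv _ (hUdet x hx), Matrix.one_apply]
    simp only [hX, Finset.smul_sum, smul_smul]
    rw [Finset.sum_comm]
    simp only [← Finset.sum_smul, h1]
    simp
  have hcoord : ∀ x ∈ U, ∀ i B, X i x (leafIndex B) = if i = B then 1 else 0 := by
    intro x hx i B
    have h1 : ((m x)⁻¹ * m x) i B = if i = B then 1 else 0 := by
      rw [Matrix.nonsing_inv_mul _ (hUdet x hx), Matrix.one_apply]
    rw [Matrix.mul_apply] at h1
    rw [← h1]
    simp [hX, hm]
  have hplane : ∀ x ∈ φ.target, planeInChart π.plane φ x =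
      Submodule.span ℝ (range fun A => X A x) := by
    intro x hx
    have hpl := c.isScaledRep.plane (e x) hx.2
    have h1 : ∀ A, X A x ∈ planeInChart π.plane φ x := fun A => by
      refine Submodule.sum_mem _ fun B _ => Submodule.smul_mem _ _ ?_
      rw [mem_planeInChart_trans_symm c.mem_atlas he1 he2 π.plane hx, hpl, hfd]
      have : (L : E4 →L[ℝ] E4) (V' B x) = V B (e x) := L.apply_symm_apply _
      rw [this]
      exact Submodule.subset_span ⟨B, rfl⟩
    refine le_antisymm (fun v hv => ?_) (Submodule.span_le.mpr ?_)
    · rw [mem_planeInChart_trans_symm c.mem_atlas he1 he2 π.plane hx, hpl, hfd] at hv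
      obtain ⟨r, hr⟩ := mem_alphaPlane_iff.mp hv
      have hv' : v = ∑ A, r A • V' A x := by
        apply L.injective
        rw [map_sum]
        simp only [map_smul, hV', L.apply_symm_apply]
        exact hr
      rw [hv']
      refine Submodule.sum_mem _ fun A _ => Submodule.smul_mem _ _ ?_
      rw [hV'm x (htU x hx)]
      exact Submodule.sum_mem _ fun i _ => Submodule.smul_mem _ _ (Submodule.subset_span ⟨i, rfl⟩)
    · rintro _ ⟨A, rfl⟩
      exact h1 A
  refine ⟨φ, hφ, ⟨hc, ?_⟩, X, ⟨fun i => ?_, fun x hx i => hcoord x (htU x hx) i 0,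
    fun x hx i => hcoord x (htU x hx) i 1, fun x hx i j => ?_⟩, hplane⟩
  · change c.chart p ∈ e.target
    have h1 : e (L.symm x₀) ∈ e.target := e.map_source (hes ▸ hbase)
    rwa [heL, L.apply_symm_apply] at h1
  · exact (ContDiffOn.sum fun A _ => ((contDiffOn_inv_apply (fun A B => (hms A B).mono
      inter_subset_left) hUdet i A).smul ((hV's A).mono inter_subset_left))).mono htU
  · have h1 : ∀ A, fderiv ℝ e x (X A x) ∈ alphaPlane c.frame c.spinor (e x) := fun A => by
      rw [← c.isScaledRep.plane (e x) hx.2,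
        ← mem_planeInChart_trans_symm c.mem_atlas he1 he2 π.plane hx]
      change X A x ∈ planeInChart π.plane φ x
      rw [hplane x hx]
      exact Submodule.subset_span ⟨A, rfl⟩
    rw [dotG_trans_symm c.mem_atlas he1 he2 h hx]
    exact c.isSpinFrame.dotG_eq_zero_of_mem hx.2 (h1 i) (h1 j)

end LeafChart

lemma exists_equiv_of_injective {T : E4 →L[ℝ] E4} (hT : ∀ v, T v = 0 → v = 0) :
    ∃ L : E4 ≃L[ℝ] E4, (L : E4 →L[ℝ] E4) = T := by
  refine ⟨(LinearEquiv.ofInjectiveEndo T.toLinearMap ?_).toContinuousLinearEquiv, ?_⟩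
  · exact (injective_iff_map_eq_zero _).mpr hT
  · ext v; rfl

/-- The transverse coordinates as a linear map. -/
noncomputable def leafCoordCLM : E4 →L[ℝ] ℝ × ℝ := (coordCLM 2).prod (coordCLM 3)

lemma leafCoordCLM_apply (v : E4) : leafCoordCLM v = (v 2, v 3) := rfl

/-- The translations in the transverse directions. -/
noncomputable def transCLM : ℝ × ℝ →L[ℝ] E4 :=
  (ContinuousLinearMap.fst ℝ ℝ ℝ).smulRight (basisVec 2) +
    (ContinuousLinearMap.snd ℝ ℝ ℝ).smulRight (basisVec 3)

lemma transCLM_apply (f : ℝ × ℝ) : transCLM f = f.1 • basisVec 2 + f.2 • basisVec 3 := rfl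

section Frobenius

variable {G : MetricField} {U : Set E4} {X : Fin 2 → E4 → E4}

/-- A graph field is the sum of a coordinate vector and its transverse part. -/
lemma IsNullGraph.basisVec_add (hX : IsNullGraph G U X) {x : E4} (hx : x ∈ U) :
    basisVec 0 + transCLM (leafCoordCLM (X 0 x)) = X 0 x ∧
      basisVec 1 + transCLM (leafCoordCLM (X 1 x)) = X 1 x := by
  have h0 := hX.coord_zero x hx
  have h1 := hX.coord_one x hx
  constructor <;> ext k <;> fin_cases k <;>
    simp [transCLM_apply, leafCoordCLM_apply, basisVec_apply, h0, h1]

/-- Frobenius' theorem for a commuting pair of vector fields in graph form: they are the first two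
coordinate vector fields of a coordinate system. -/
theorem IsNullGraph.exists_straightening (hX : IsNullGraph G U X) (hU : IsOpen U)
    (hbr : ∀ x ∈ U, fderiv ℝ (X 1) x (X 0 x) = fderiv ℝ (X 0) x (X 1 x)) {x₀ : E4} (hx₀ : x₀ ∈ U) :
    ∃ e : OpenPartialHomeomorph E4 E4, ContDiffOn ℝ ∞ e e.source ∧ ContDiffOn ℝ ∞ e.symm e.target ∧
      x₀ ∈ e.target ∧ ∀ x ∈ e.source, e x ∈ U ∧ fderiv ℝ e x (basisVec 0) = X 0 (e x) ∧
        fderiv ℝ e x (basisVec 1) = X 1 (e x) := by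
  set T : E4 × (ℝ × ℝ) →L[ℝ] E4 := ContinuousLinearMap.fst ℝ _ _ +
    transCLM.comp (ContinuousLinearMap.snd ℝ _ _) with hT
  have hTa : ∀ p, T p = p.1 + transCLM p.2 := fun p => rfl
  -- the leaves are sought as graphs `x + transCLM (w x)`, tangent to `X 0` and `X 1`
  set a : Fin 2 → E4 × (ℝ × ℝ) → ℝ × ℝ := fun i p => leafCoordCLM (X i (T p)) with ha
  have has : ∀ i, ContDiffOn ℝ ∞ (a i) (T ⁻¹' U) := fun i =>
    leafCoordCLM.contDiff.comp_contDiffOn ((hX.smooth i).comp T.contDiff.contDiffOn fun p hp => hp)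
  have had : ∀ i, ∀ p ∈ T ⁻¹' U, ∀ v, fderiv ℝ (a i) p v
      = leafCoordCLM (fderiv ℝ (X i) (T p) (T v)) := by
    intro i p hp v
    have h1 : HasFDerivAt (a i) (leafCoordCLM.comp ((fderiv ℝ (X i) (T p)).comp T)) p :=
      leafCoordCLM.hasFDerivAt.comp p
        ((differentiableAt_of_contDiffOn (hX.smooth i) hU hp).hasFDerivAt.comp p T.hasFDerivAt)
    rw [h1.fderiv]; rfl
  obtain ⟨w, V, hV, hmem, hws, hw0, hwd⟩ := exists_leaf_solution (a := a 0) (b := a 1)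
    (O := T ⁻¹' U) (hU.preimage T.continuous) (x₀ := x₀)
    (by rw [mem_preimage, hTa]; simpa using hx₀) (has 0) (has 1) (by
      intro p hp
      have h1 := hX.basisVec_add (x := T p) hp
      have k0 : T (basisVec 0, a 0 p) = X 0 (T p) := h1.1
      have k1 : T (basisVec 1, a 1 p) = X 1 (T p) := h1.2
      rw [had 1 p hp, had 0 p hp, k0, k1, hbr _ hp])
  set Ψ : E4 → E4 := fun x => x + transCLM (w x) with hΨ
  have hΨs : ContDiffOn ℝ ∞ Ψ V := contDiffOn_id.add (transCLM.contDiff.comp_contDiffOn hws)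
  have hΨd : ∀ x ∈ V, HasFDerivAt Ψ (ContinuousLinearMap.id ℝ E4 +
      transCLM.comp (fderiv ℝ w x)) x := fun x hx =>
    (hasFDerivAt_id x).add
      (transCLM.hasFDerivAt.comp x (differentiableAt_of_contDiffOn hws hV hx).hasFDerivAt)
  have hinj : ∀ v, fderiv ℝ Ψ x₀ v = 0 → v = 0 := by
    intro v hv
    rw [(hΨd x₀ hmem).fderiv] at hv
    replace hv : v + transCLM (fderiv ℝ w x₀ v) = 0 := hv
    have h0 : v 0 = 0 := by
      have := congrArg (fun u : E4 => u 0) hv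
      simpa [transCLM_apply, basisVec_apply] using this
    have h1 : v 1 = 0 := by
      have := congrArg (fun u : E4 => u 1) hv
      simpa [transCLM_apply, basisVec_apply] using this
    -- `w` vanishes on the transversal through `x₀`
    have h2 : fderiv ℝ w x₀ v = 0 := by
      have e1 : HasDerivAt (fun τ : ℝ => x₀ + τ • v) ((1 : ℝ) • v) 0 :=
        ((hasDerivAt_id (0 : ℝ)).smul_const v).const_add x₀
      have e2 : HasFDerivAt w (fderiv ℝ w x₀) (x₀ + (0 : ℝ) • v) := by
        simpa using (differentiableAt_of_contDiffOn hws hV hmem).hasFDerivAt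
      have e3 := e2.comp_hasDerivAt (0 : ℝ) e1
      rw [one_smul] at e3
      refine e3.unique ((hasDerivAt_const (0 : ℝ) (0 : ℝ × ℝ)).congr_of_eventuallyEq ?_)
      have hcont : ContinuousAt (fun τ : ℝ => x₀ + τ • v) 0 := by fun_prop
      have : ∀ᶠ τ : ℝ in 𝓝 0, x₀ + τ • v ∈ V :=
        hcont.eventually (by simpa using hV.mem_nhds hmem)
      filter_upwards [this] with τ hτ
      exact hw0 _ hτ (by simp [h0]) (by simp [h1])
    rw [h2, map_zero, add_zero] at hv
    exact hv
  obtain ⟨L, hL⟩ := exists_equiv_of_injective hinj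
  obtain ⟨e, hxe, heV, heΨ, he, he'⟩ := exists_openPartialHomeomorph_contDiffOn hV hΨs hmem
    (f' := L) (by rw [hL]; exact (hΨd x₀ hmem).differentiableAt.hasFDerivAt)
  refine ⟨e, he, he', ?_, fun x hx => ?_⟩
  · have h1 : e x₀ = x₀ := by
      rw [heΨ, hΨ]
      simp [hw0 x₀ hmem rfl rfl]
    have h2 := e.map_source hxe
    rwa [h1] at h2
  · obtain ⟨hO, hd0, hd1⟩ := hwd x (heV hx)
    have h1 := hX.basisVec_add (x := T (x, w x)) hO
    have hTΨ : T (x, w x) = e x := by rw [heΨ]; rfl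
    rw [hTΨ] at h1
    refine ⟨hTΨ ▸ hO, ?_, ?_⟩
    · rw [← h1.1, heΨ, (hΨd x (heV hx)).fderiv]
      change basisVec 0 + transCLM (fderiv ℝ w x (basisVec 0)) = _
      rw [hd0, ← heΨ, ← hTΨ]
    · rw [← h1.2, heΨ, (hΨd x (heV hx)).fderiv]
      change basisVec 1 + transCLM (fderiv ℝ w x (basisVec 1)) = _
      rw [hd1, ← heΨ, ← hTΨ]

end Frobenius

section LeafChart

variable {M : Type*} [TopologicalSpace M] [ChartedSpace (EuclideanSpace ℝ (Fin 4)) M]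
  [IsManifold (𝓡 4) ∞ M] {h : NeutralMetric M} {π : ProjectiveSpinorField h}

/-- The first two coordinate vector fields form a null graph when they span the `α`-planes. -/
lemma isNullGraph_basisVec {φ : OpenPartialHomeomorph M E4}
    (hN : IsLeafNull (h.inChart φ) φ.target) :
    IsNullGraph (h.inChart φ) φ.target fun i _ => basisVec (leafIndex i) where
  smooth := fun _ => contDiffOn_const
  coord_zero := fun x _ i => by fin_cases i <;> simp [basisVec_apply, leafIndex]
  coord_one := fun x _ i => by fin_cases i <;> simp [basisVec_apply, leafIndex]
  null := fun x hx i j => by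
    rw [dotG_basisVec]
    refine hN x hx _ _ ?_ ?_
    · fin_cases i <;> simp [leafIndex]
    · fin_cases j <;> simp [leafIndex]

/-- Around each point of an `α`-geometry there is a chart whose first two coordinate vector
fields span the `α`-planes. -/
theorem exists_leaf_chart (hα : π.IsAlphaGeometry) (p : M) :
    ∃ φ : OpenPartialHomeomorph M E4, φ ∈ IsManifold.maximalAtlas (𝓡 4) ∞ M ∧ p ∈ φ.source ∧
      IsLeafNull (h.inChart φ) φ.target ∧
      ∀ x ∈ φ.target, planeInChart π.plane φ x = Submodule.span ℝ {basisVec 0, basisVec 1} := by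
  obtain ⟨φ, hφ, hp, X, hX, hZ⟩ := exists_graph_chart π p
  have hG := h.isMetricOn_inChart hφ
  obtain ⟨c, rfl, hcX, hcs⟩ := exists_adapted_lsr hφ hX hZ
  have hbr : ∀ x ∈ c.chart.target, fderiv ℝ (X 1) x (X 0 x) = fderiv ℝ (X 0) x (X 1 x) := by
    intro x hx
    have hint := hα c x hx
    rw [hcs] at hint
    have h1 := hX.bracket_eq_zero hG c.isSpinFrame hcX hx hint
    have h2 : ∀ A v i, fderiv ℝ (X A) x v i = ∑ k, v k * pd k (fun y => X A y i) x := by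
      intro A v i
      have h3 : HasFDerivAt (fun y => X A y i) ((coordCLM i).comp (fderiv ℝ (X A) x)) x :=
        (coordCLM i).hasFDerivAt.comp x
          (differentiableAt_of_contDiffOn (hX.smooth A) hG.isOpen hx).hasFDerivAt
      rw [← fderiv_apply_eq_sum, h3.fderiv]; rfl
    ext i
    rw [h2, h2, h1]
  obtain ⟨e, he, he', hxe, hed⟩ := hX.exists_straightening hG.isOpen hbr (c.chart.map_source hp)
  have hsub : ∀ x ∈ (c.chart.trans e.symm).target, x ∈ e.source := fun x hx => hx.1
  refine ⟨c.chart.trans e.symm, trans_symm_mem_maximalAtlas hφ he he', ⟨hp, hxe⟩, ?_, ?_⟩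
  · intro x hx i j hi hj
    obtain ⟨-, h0, h1⟩ := hed x (hsub x hx)
    have hn := hX.null (e x) hx.2
    refine (dotG_basisVec _ x i j).symm.trans ?_
    rw [dotG_trans_symm hφ he he' h hx]
    have hi' := eq_zero_or_eq_one_of_lt_two hi
    have hj' := eq_zero_or_eq_one_of_lt_two hj
    rcases hi' with rfl | rfl <;> rcases hj' with rfl | rfl <;> simp only [h0, h1, hn]
  · intro x hx
    obtain ⟨-, h0, h1⟩ := hed x (hsub x hx)
    obtain ⟨L, hL, -⟩ := exists_equiv_fderiv he he' (hsub x hx)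
    ext v
    rw [mem_planeInChart_trans_symm hφ he he' π.plane hx, hZ (e x) hx.2,
      Submodule.mem_span_range_iff_exists_fun, Submodule.mem_span_pair]
    constructor
    · rintro ⟨r, hr⟩
      refine ⟨r 0, r 1, L.injective ?_⟩
      have h2 : ∀ u, L u = fderiv ℝ e x u := fun u => by rw [← hL]; rfl
      rw [h2, h2, ← hr, map_add, map_smul, map_smul, h0, h1, Fin.sum_univ_two]
    · rintro ⟨r, s, rfl⟩
      refine ⟨![r, s], ?_⟩
      rw [map_add, map_smul, map_smul, h0, h1, Fin.sum_univ_two]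
      rfl

/-- On a chart adapted to the `α`-surfaces of an algebraically special `α`-geometry the trace of
the leaf connection is closed along the leaves. -/
theorem pd_leafTrace_comm_of_isMultipleWPS (hW : π.IsMultipleWPS) {φ : OpenPartialHomeomorph M E4}
    (hφ : φ ∈ IsManifold.maximalAtlas (𝓡 4) ∞ M) (hN : IsLeafNull (h.inChart φ) φ.target)
    (hZ : ∀ x ∈ φ.target, planeInChart π.plane φ x = Submodule.span ℝ {basisVec 0, basisVec 1})
    {x : E4} (hx : x ∈ φ.target) :
    pd 0 (leafTrace (h.inChart φ) 1) x = pd 1 (leafTrace (h.inChart φ) 0) x := by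
  obtain ⟨c, rfl, hcX, hcs⟩ := exists_adapted_lsr (Z := π.plane) hφ (isNullGraph_basisVec hN)
    fun x hx => by
      rw [hZ x hx]
      congr 1
      ext v
      simp [leafIndex, eq_comm]
  refine hN.pd_leafTrace_comm (h.isMetricOn_inChart hφ) c.isSpinFrame ?_ ?_ hx ?_
  · intro x _; rw [hcX]; rfl
  · intro x _; rw [hcX]; rfl
  · have := hW c x hx 1
    rw [hcs] at this
    simpa using this

end LeafChart

/-! ### Existence of conformal Walker coordinates -/

namespace IsLeafNull

variable {G : MetricField} {U : Set E4} (hN : IsLeafNull G U) (hG : IsMetricOn G U)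
include hN hG

omit hN in
lemma contDiffOn_blockDet : ContDiffOn ℝ ∞ (blockDet G) U :=
  ((hG.smooth 0 2).mul (hG.smooth 1 3)).sub ((hG.smooth 0 3).mul (hG.smooth 1 2))

omit hN in
lemma contDiffOn_leafTrace (k : Fin 4) : ContDiffOn ℝ ∞ (leafTrace G k) U :=
  (hG.contDiffOn_christoffel 0 k 0).add (hG.contDiffOn_christoffel 1 k 1)

omit hG in
/-- The scalar product with a vector tangent to the leaves. -/
lemma dotG_leaf {x : E4} (hx : x ∈ U) {a : E4} (h2 : a 2 = 0) (h3 : a 3 = 0) (b : E4) :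
    dotG G x a b = (a 0 * G x 0 2 + a 1 * G x 1 2) * b 2 +
      (a 0 * G x 0 3 + a 1 * G x 1 3) * b 3 := by
  have h00 := hN x hx 0 0 (by decide) (by decide)
  have h01 := hN x hx 0 1 (by decide) (by decide)
  have h10 := hN x hx 1 0 (by decide) (by decide)
  have h11 := hN x hx 1 1 (by decide) (by decide)
  simp only [dotG, Fin.sum_univ_four, h2, h3, h00, h01, h10, h11]
  ring

/-- If the trace of the leaf connection is closed along the leaves, rescaling by `exp μ / D ^ 2`,
where `∂ₖ μ = 2 τₖ` and `D` is the block determinant, makes both `G_{k2}` and `G_{k3}` closed. -/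
theorem exists_integrating_factor
    (hτ : ∀ x ∈ U, pd 0 (leafTrace G 1) x = pd 1 (leafTrace G 0) x) {x₀ : E4} (hx₀ : x₀ ∈ U) :
    ∃ (E : E4 → ℝ) (V : Set E4), IsOpen V ∧ x₀ ∈ V ∧ V ⊆ U ∧ ContDiffOn ℝ ∞ E V ∧
      (∀ x ∈ V, 0 < E x) ∧
      ∀ x ∈ V, ∀ a : Fin 4, (a = 2 ∨ a = 3) →
        pd 0 (fun y => E y * G y 1 a) x = pd 1 (fun y => E y * G y 0 a) x := by
  have hU := hG.isOpen
  obtain ⟨μ, V, hV, hmem, hVU, hμ, hd⟩ := exists_leaf_potential hU hx₀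
    (contDiffOn_const.mul (contDiffOn_leafTrace hG 0) : ContDiffOn ℝ ∞
        (fun x => 2 * leafTrace G 0 x) U)
    (contDiffOn_const.mul (contDiffOn_leafTrace hG 1) : ContDiffOn ℝ ∞
        (fun x => 2 * leafTrace G 1 x) U)
    (fun x hx => by
      have h1 := fun k => differentiableAt_of_contDiffOn (contDiffOn_leafTrace hG k) hU hx
      rw [pd_const_mul 0 2 (h1 1), pd_const_mul 1 2 (h1 0), hτ x hx])
  have hDs := (contDiffOn_blockDet hG).mono hVU
  have hD := fun x (hx : x ∈ V) => hN.blockDet_ne_zero hG (hVU hx)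
  set E : E4 → ℝ := fun x => Real.exp (μ x) * (blockDet G x ^ 2)⁻¹ with hE
  have hEs : ContDiffOn ℝ ∞ E V :=
    (Real.contDiff_exp.comp_contDiffOn hμ).mul ((hDs.pow 2).inv fun x hx => pow_ne_zero 2 (hD x hx))
  refine ⟨E, V, hV, hmem, hVU, hEs, fun x hx => mul_pos (Real.exp_pos _)
    (inv_pos.mpr (by have := hD x hx; positivity)), fun x hx a ha => ?_⟩
  have dμ := differentiableAt_of_contDiffOn hμ hV hx
  have dD := differentiableAt_of_contDiffOn hDs hV hx
  have dE := differentiableAt_of_contDiffOn hEs hV hx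
  have dG := fun i j => differentiableAt_of_contDiffOn (hG.smooth i j) hU (hVU hx)
  have hDx := hD x hx
  have hpow : HasDerivAt (fun t : ℝ => (t ^ 2)⁻¹) (-(2 * blockDet G x) / (blockDet G x ^ 2) ^ 2)
      (blockDet G x) := by
    simpa using (hasDerivAt_pow 2 (blockDet G x)).fun_inv (pow_ne_zero 2 hDx)
  have dpow : DifferentiableAt ℝ (fun y => (blockDet G y ^ 2)⁻¹) x :=
    (dD.fun_pow 2).fun_inv (pow_ne_zero 2 hDx)
  have hEk : ∀ k : Fin 4, k < 2 → pd k μ x = 2 * leafTrace G k x →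
      blockDet G x * pd k E x = -E x *
        (G x k 2 * (pd 0 (fun y => G y 1 3) x - pd 1 (fun y => G y 0 3) x)
          - G x k 3 * (pd 0 (fun y => G y 1 2) x - pd 1 (fun y => G y 0 2) x)) := by
    intro k hk hμk
    have h1 := hN.blockDet_mul_leafTrace hG (hVU hx) hk
    rw [hE, pd_mul k (Real.differentiable_exp.differentiableAt.fun_comp' x dμ) dpow,
      pd_comp k (Real.hasDerivAt_exp _) dμ, pd_comp k hpow dD, hμk]
    have h2 : blockDet G x * (Real.exp (μ x) * (2 * leafTrace G k x) * (blockDet G x ^ 2)⁻¹ +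
        Real.exp (μ x) * (-(2 * blockDet G x) / (blockDet G x ^ 2) ^ 2 * pd k (blockDet G) x)) =
        (Real.exp (μ x) * (blockDet G x ^ 2)⁻¹) *
          (2 * (blockDet G x * leafTrace G k x) - 2 * pd k (blockDet G) x) := by
      field_simp
      ring
    rw [h2, h1]; ring
  have hE0 := hEk 0 (by decide) (hd x hx).1
  have hE1 := hEk 1 (by decide) (hd x hx).2
  rw [pd_mul 0 dE (dG _ _), pd_mul 1 dE (dG _ _)]
  refine mul_left_cancel₀ hDx ?_
  rcases ha with rfl | rfl
  · have hDdef : blockDet G x = G x 0 2 * G x 1 3 - G x 0 3 * G x 1 2 := rfl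
    linear_combination G x 1 2 * hE0 - G x 0 2 * hE1 +
      E x * (pd 0 (fun y => G y 1 2) x - pd 1 (fun y => G y 0 2) x) * hDdef
  · have hDdef : blockDet G x = G x 0 2 * G x 1 3 - G x 0 3 * G x 1 2 := rfl
    linear_combination G x 1 3 * hE0 - G x 0 3 * hE1 +
      E x * (pd 0 (fun y => G y 1 3) x - pd 1 (fun y => G y 0 3) x) * hDdef

/-- New leaf coordinates, potentials of the rescaled one-forms `G_{k2}` and `G_{k3}`, bring the
metric to the conformal Walker form. -/
theorem exists_walker_coordinates
    (hτ : ∀ x ∈ U, pd 0 (leafTrace G 1) x = pd 1 (leafTrace G 0) x) {x₀ : E4} (hx₀ : x₀ ∈ U) :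
    ∃ e : OpenPartialHomeomorph E4 E4, ContDiffOn ℝ ∞ e e.source ∧ ContDiffOn ℝ ∞ e.symm e.target ∧
      x₀ ∈ e.target ∧ (∃ c r, e.source = Metric.ball c r) ∧ ∀ x ∈ e.source, e x ∈ U ∧
        (∀ v, fderiv ℝ e x v 2 = v 2 ∧ fderiv ℝ e x v 3 = v 3) ∧
        ∃ t : ℝ, 0 < t ∧ ∀ v : E4, v 2 = 0 → v 3 = 0 → ∀ w : E4,
          dotG G (e x) (fderiv ℝ e x v) (fderiv ℝ e x w) = t * (v 0 * w 2 + v 1 * w 3) := by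
  have hU := hG.isOpen
  obtain ⟨E, V, hV, hmem, hVU, hEs, hEpos, hcl⟩ := hN.exists_integrating_factor hG hτ hx₀
  have hGs := fun i j => (hG.smooth i j).mono hVU
  obtain ⟨u, V₁, hV₁, hm₁, hs₁, hu, hud⟩ := exists_leaf_potential hV hmem (hEs.mul (hGs 0 2))
    (hEs.mul (hGs 1 2)) fun x hx => hcl x hx 2 (Or.inl rfl)
  obtain ⟨v, V₂, hV₂, hm₂, hs₂, hv, hvd⟩ := exists_leaf_potential hV hmem (hEs.mul (hGs 0 3))
    (hEs.mul (hGs 1 3)) fun x hx => hcl x hx 3 (Or.inr rfl)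
  set O : Set E4 := V₁ ∩ V₂ with hO
  have hOo : IsOpen O := hV₁.inter hV₂
  -- new leaf coordinates `u`, `v`; the transverse coordinates are kept
  set F : E4 → E4 := fun q => !₂[u q, v q, q 2, q 3] with hF
  have hFs : ContDiffOn ℝ ∞ F O := by
    refine contDiffOn_of_apply fun i => ?_
    fin_cases i
    · exact hu.mono inter_subset_left
    · exact hv.mono inter_subset_right
    · exact (coordCLM 2).contDiff.contDiffOn
    · exact (coordCLM 3).contDiff.contDiffOn
  have hFd : ∀ x ∈ O, ∀ w i, fderiv ℝ F x w i = fderiv ℝ (fun y => F y i) x w := by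
    intro x hx w i
    have h3 : HasFDerivAt (fun y => F y i) ((coordCLM i).comp (fderiv ℝ F x)) x :=
      (coordCLM i).hasFDerivAt.comp x (differentiableAt_of_contDiffOn hFs hOo hx).hasFDerivAt
    rw [h3.fderiv]; rfl
  have hF2 : ∀ x ∈ O, ∀ w, fderiv ℝ F x w 2 = w 2 ∧ fderiv ℝ F x w 3 = w 3 := by
    intro x hx w
    constructor
    · rw [hFd x hx]
      exact DFunLike.congr_fun (coordCLM 2).hasFDerivAt.fderiv w
    · rw [hFd x hx]
      exact DFunLike.congr_fun (coordCLM 3).hasFDerivAt.fderiv w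
  have hF0 : ∀ x ∈ O, ∀ w : E4, w 2 = 0 → w 3 = 0 →
      fderiv ℝ F x w 0 = E x * (w 0 * G x 0 2 + w 1 * G x 1 2) ∧
      fderiv ℝ F x w 1 = E x * (w 0 * G x 0 3 + w 1 * G x 1 3) := by
    intro x hx w h2 h3
    have e0 : (fun y => F y 0) = u := rfl
    have e1 : (fun y => F y 1) = v := rfl
    constructor
    · rw [hFd x hx, e0, fderiv_apply_eq_sum, Fin.sum_univ_four, (hud x hx.1).1, (hud x hx.1).2, h2,
        h3]
      ring
    · rw [hFd x hx, e1, fderiv_apply_eq_sum, Fin.sum_univ_four, (hvd x hx.2).1, (hvd x hx.2).2, h2,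
        h3]
      ring
  have hx₀O : x₀ ∈ O := ⟨hm₁, hm₂⟩
  have hinj : ∀ w, fderiv ℝ F x₀ w = 0 → w = 0 := by
    intro w hw
    have h2 : w 2 = 0 := by rw [← (hF2 x₀ hx₀O w).1, hw]; rfl
    have h3 : w 3 = 0 := by rw [← (hF2 x₀ hx₀O w).2, hw]; rfl
    have hEne := (hEpos x₀ hmem).ne'
    obtain ⟨k0, k1⟩ := hF0 x₀ hx₀O w h2 h3
    rw [hw] at k0 k1
    have k0' := (mul_eq_zero.mp k0.symm).resolve_left hEne
    have k1' := (mul_eq_zero.mp k1.symm).resolve_left hEne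
    have hD := hN.blockDet_ne_zero hG hx₀
    have h0 : w 0 = 0 := by
      refine (mul_eq_zero.mp ?_).resolve_left hD
      simp only [blockDet]
      linear_combination G x₀ 1 3 * k0' - G x₀ 1 2 * k1'
    have h1 : w 1 = 0 := by
      refine (mul_eq_zero.mp ?_).resolve_left hD
      simp only [blockDet]
      linear_combination G x₀ 0 2 * k1' - G x₀ 0 3 * k0'
    ext i
    fin_cases i
    · exact h0
    · exact h1
    · exact h2
    · exact h3
  obtain ⟨L, hL⟩ := exists_equiv_of_injective hinj
  obtain ⟨e, hxe, heO, heF, he, he'⟩ := exists_openPartialHomeomorph_contDiffOn hOo hFs hx₀O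
    (f' := L) (by rw [hL]; exact (differentiableAt_of_contDiffOn hFs hOo hx₀O).hasFDerivAt)
  obtain ⟨r, hr, hball⟩ := Metric.isOpen_iff.mp e.open_target (e x₀) (e.map_source hxe)
  -- the new coordinates are restricted to a ball, so that the leaves in them are connected
  set e' := e.symm.restrOpen (Metric.ball (e x₀) r) Metric.isOpen_ball with he'def
  have hsrc : e'.source = Metric.ball (e x₀) r := by
    rw [he'def, OpenPartialHomeomorph.restrOpen_source]
    exact inter_eq_right.mpr hball
  have hcoe : (e' : E4 → E4) = e.symm := rfl
  have hcoe' : (e'.symm : E4 → E4) = e := rfl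
  refine ⟨e', ?_, ?_, ?_, ⟨_, _, hsrc⟩, fun x hx => ?_⟩
  · rw [hsrc]; exact he'.mono hball
  · rw [hcoe']
    refine he.mono fun y hy => ?_
    have h1 := e'.map_target hy
    rw [hsrc, hcoe'] at h1
    have h2 : e.symm (e y) = y := by
      have := e'.right_inv hy
      rwa [hcoe, hcoe'] at this
    rw [← h2]
    exact e.map_target (hball h1)
  · have h1 : e x₀ ∈ e'.source := by rw [hsrc]; exact Metric.mem_ball_self hr
    have h2 := e'.map_source h1
    rwa [hcoe, e.left_inv hxe] at h2
  · rw [hsrc] at hx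
    have hxt := hball hx
    set y := e.symm x with hy
    have hys : y ∈ e.source := e.map_target hxt
    have hyO := heO hys
    have hyx : e y = x := e.right_inv hxt
    obtain ⟨T, hT, hT'⟩ := exists_equiv_fderiv he he' hys
    rw [hyx] at hT'
    have hTF : ∀ w, T w = fderiv ℝ F y w := fun w => by rw [← heF, ← hT]; rfl
    have hfd : ∀ w, fderiv ℝ e' x w = T.symm w := fun w => by rw [hcoe, ← hT']; rfl
    have hFT : ∀ w, fderiv ℝ F y (T.symm w) = w := fun w => by rw [← hTF, T.apply_symm_apply]
    have h23 : ∀ w : E4, (T.symm w) 2 = w 2 ∧ (T.symm w) 3 = w 3 := fun w => by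
      rw [← (hF2 y hyO (T.symm w)).1, ← (hF2 y hyO (T.symm w)).2, hFT]
      exact ⟨rfl, rfl⟩
    have hyV : y ∈ V := hs₁ hyO.1
    refine ⟨hVU hyV, fun w => by rw [hfd]; exact h23 w, (E y)⁻¹, inv_pos.mpr (hEpos y hyV),
      fun a h2 h3 w => ?_⟩
    have k2 : (T.symm a) 2 = 0 := (h23 a).1.trans h2
    have k3 : (T.symm a) 3 = 0 := (h23 a).2.trans h3
    obtain ⟨k0, k1⟩ := hF0 y hyO _ k2 k3
    rw [hFT] at k0 k1
    rw [hfd, hfd]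
    change dotG G y _ _ = _
    rw [hN.dotG_leaf (hVU hyV) k2 k3, (h23 w).1, (h23 w).2, k0, k1]
    have := (hEpos y hyV).ne'
    field_simp

end IsLeafNull

section

variable {M : Type*} [TopologicalSpace M] [ChartedSpace (EuclideanSpace ℝ (Fin 4)) M]
  [IsManifold (𝓡 4) ∞ M] {h : NeutralMetric M} {π : ProjectiveSpinorField h}

/-- A chart with `α`-surfaces as leaves is a system of conformal Walker coordinates as soon as
`h_{i2}` and `h_{i3}` (`i = 0, 1`) have Walker's form up to a positive factor. -/
theorem isConformalWalkerChart_of_components {φ : OpenPartialHomeomorph M E4}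
    (hφ : φ ∈ IsManifold.maximalAtlas (𝓡 4) ∞ M)
    (hZ : ∀ q ∈ φ.target, planeInChart π.plane φ q = Submodule.span ℝ {basisVec 0, basisVec 1})
    (hc : ∀ s t : ℝ, IsPreconnected {q : E4 | q ∈ φ.target ∧ q 2 = s ∧ q 3 = t})
    (hN : IsLeafNull (h.inChart φ) φ.target) (hpos : ∀ q ∈ φ.target, 0 < h.inChart φ q 0 2)
    (h13 : ∀ q ∈ φ.target, h.inChart φ q 1 3 = h.inChart φ q 0 2)
    (h03 : ∀ q ∈ φ.target, h.inChart φ q 0 3 = 0) (h12 : ∀ q ∈ φ.target, h.inChart φ q 1 2 = 0) :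
    IsConformalWalkerChart h π φ fun p => Real.sqrt (h.inChart φ (φ p) 0 2) := by
  have hG := h.isMetricOn_inChart hφ
  have hne : ∀ q ∈ φ.target, h.inChart φ q 0 2 ≠ 0 := fun q hq => (hpos q hq).ne'
  have hdiv : ∀ i j, ContDiffOn ℝ ∞ (fun q => h.inChart φ q i j / h.inChart φ q 0 2) φ.target :=
    fun i j => (hG.smooth i j).div (hG.smooth 0 2) hne
  refine ⟨hφ, ?_, fun p hp => Real.sqrt_pos.mpr (hpos _ (φ.map_source hp)), hZ, hc,
    fun q => h.inChart φ q 2 2 / h.inChart φ q 0 2, fun q => h.inChart φ q 3 3 / h.inChart φ q 0 2,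
    fun q => h.inChart φ q 2 3 / h.inChart φ q 0 2, hdiv 2 2, hdiv 3 3, hdiv 2 3, fun q hq => ?_,
    isWalkerOn_walkerMatrix φ.open_target (hdiv 2 2) (hdiv 3 3) (hdiv 2 3) hZ⟩
  · have h1 : ContDiffOn ℝ ∞ (fun q => Real.sqrt (h.inChart φ q 0 2)) φ.target :=
      (hG.smooth 0 2).sqrt hne
    exact (contMDiffOn_iff_contDiffOn.mpr h1).comp (contMDiffOn_of_mem_maximalAtlas hφ)
      fun p hp => φ.map_source hp
  · rw [φ.right_inv hq, Real.sq_sqrt (hpos q hq).le]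
    have hs := hG.symm q hq
    have n00 := hN q hq 0 0 (by decide) (by decide)
    have n01 := hN q hq 0 1 (by decide) (by decide)
    have n11 := hN q hq 1 1 (by decide) (by decide)
    have hq2 := hne q hq
    ext i j
    fin_cases i <;> fin_cases j <;>
      simp [walkerMatrix, n00, n01, n11, hs 1 0, hs 2 0, hs 2 1, hs 3 0, hs 3 1, hs 3 2, h13 q hq,
        h03 q hq, h12 q hq, mul_div_cancel₀, hq2]

/-- An algebraically special `α`-geometry has conformal Walker coordinates around each point. -/
theorem exists_isConformalWalkerChart (hAS : π.IsASAlphaGeometry) (p : M) :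
    ∃ (φ : OpenPartialHomeomorph M E4) (Ω : M → ℝ),
        IsConformalWalkerChart h π φ Ω ∧ p ∈ φ.source := by
  obtain ⟨φ, hφ, hp, hN, hZ⟩ := exists_leaf_chart hAS.isAlphaGeometry p
  have hG := h.isMetricOn_inChart hφ
  obtain ⟨e, he, he', hpe, ⟨c, r, hball⟩, hed⟩ := hN.exists_walker_coordinates hG
    (fun x hx => pd_leafTrace_comm_of_isMultipleWPS hAS.isMultipleWPS hφ hN hZ hx)
    (φ.map_source hp)
  set φ' := φ.trans e.symm with hφ'
  have htgt : φ'.target = Metric.ball c r := by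
    rw [← hball]
    ext x
    exact ⟨fun hx => hx.1, fun hx => ⟨hx, (hed x hx).1⟩⟩
  have hcomp : ∀ x ∈ φ'.target, ∃ t : ℝ, 0 < t ∧ ∀ i j : Fin 4, i < 2 →
      h.inChart φ' x i j = t * ((basisVec i : E4) 0 * (basisVec j : E4) 2 +
        (basisVec i : E4) 1 * (basisVec j : E4) 3) := by
    intro x hx
    obtain ⟨-, -, t, ht, hdot⟩ := hed x hx.1
    refine ⟨t, ht, fun i j hi => ?_⟩
    refine (dotG_basisVec _ x i j).symm.trans ?_
    rw [dotG_trans_symm hφ he he' h hx]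
    have hi' := eq_zero_or_eq_one_of_lt_two hi
    exact hdot _ (by rcases hi' with rfl | rfl <;> simp [basisVec_apply])
      (by rcases hi' with rfl | rfl <;> simp [basisVec_apply]) _
  have hspan : ∀ v : E4, v ∈ Submodule.span ℝ {basisVec 0, basisVec 1} ↔ v 2 = 0 ∧ v 3 = 0 := by
    intro v
    rw [Submodule.mem_span_pair]
    constructor
    · rintro ⟨a, b, rfl⟩
      simp [basisVec_apply]
    · rintro ⟨h2, h3⟩
      refine ⟨v 0, v 1, ?_⟩
      conv_rhs => rw [eq_sum_basisVec v, Fin.sum_univ_four, h2, h3]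
      simp
  refine ⟨φ', _, isConformalWalkerChart_of_components (trans_symm_mem_maximalAtlas hφ he he')
    (fun q hq => ?_) (fun s t => ?_) (fun x hx i j hi hj => ?_) (fun x hx => ?_) (fun x hx => ?_)
    (fun x hx => ?_) (fun x hx => ?_), hp, hpe⟩
  · ext v
    obtain ⟨h2, h3⟩ := (hed q hq.1).2.1 v
    rw [mem_planeInChart_trans_symm hφ he he' π.plane hq, hZ (e q) hq.2, hspan, hspan, h2, h3]
  · rw [htgt]
    refine Convex.isPreconnected ?_
    rintro x ⟨hx, hxs, hxt⟩ y ⟨hy, hys, hyt⟩ a b ha hb hab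
    refine ⟨convex_ball c r hx hy ha hb hab, ?_, ?_⟩
    · simp [hxs, hys, ← add_mul, hab]
    · simp [hxt, hyt, ← add_mul, hab]
  · obtain ⟨t, -, hc⟩ := hcomp x hx
    rw [hc i j hi]
    have hj' := eq_zero_or_eq_one_of_lt_two hj
    rcases hj' with rfl | rfl <;> simp [basisVec_apply]
  · obtain ⟨t, ht, hc⟩ := hcomp x hx
    rw [hc 0 2 (by decide)]
    simpa [basisVec_apply] using ht
  · obtain ⟨t, ht, hc⟩ := hcomp x hx
    rw [hc 0 2 (by decide), hc 1 3 (by decide)]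
    simp [basisVec_apply]
  · obtain ⟨t, ht, hc⟩ := hcomp x hx
    rw [hc 0 3 (by decide)]
    simp [basisVec_apply]
  · obtain ⟨t, ht, hc⟩ := hcomp x hx
    rw [hc 1 2 (by decide)]
    simp [basisVec_apply]

end

end AlphaGeometry

theorem mainTheorem4 {M : Type*} [TopologicalSpace M]
    [ChartedSpace (EuclideanSpace ℝ (Fin 4)) M] [IsManifold (𝓡 4) ∞ M]
    (h : AlphaGeometry.NeutralMetric M) (π : AlphaGeometry.ProjectiveSpinorField h)
    (hAS : π.IsASAlphaGeometry) :
    (π.IsRPS ↔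
      ∀ (φ : OpenPartialHomeomorph M AlphaGeometry.E4) (Ω : M → ℝ),
        AlphaGeometry.IsConformalWalkerChart h π φ Ω →
          AlphaGeometry.IsAffineInUV φ (fun p => (Ω p)⁻¹)) ∧
    (∀ (φ : OpenPartialHomeomorph M AlphaGeometry.E4) (Ω : M → ℝ),
      AlphaGeometry.IsConformalWalkerChart h π φ Ω →
        (π.IsRPSOn φ.source ↔ AlphaGeometry.IsAffineInUV φ (fun p => (Ω p)⁻¹)) ∧
        (AlphaGeometry.IsAffineInUV φ (fun p => (Ω p)⁻¹) ↔
          AlphaGeometry.HasReciprocalAffineForm φ Ω)) := by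
  refine ⟨⟨fun hR φ Ω hW => ?_, fun hA c x hx _ => ?_⟩, fun φ Ω hW =>
    ⟨hW.isRPSOn_iff_affine, hW.affine_iff_reciprocal⟩⟩
  · exact hW.isRPSOn_iff_affine.mp fun c x hx _ => hR c x hx (mem_univ _)
  · obtain ⟨φ, Ω, hW, hp⟩ := AlphaGeometry.exists_isConformalWalkerChart hAS (c.chart.symm x)
    exact hW.isRPSOn_iff_affine.mpr (hA φ Ω hW) c x hx hp
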